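/- Let $w=(w(n))_{n\ge 0}$ be a non-decreasing sequence of positive real numbers with $\sum_{n\ge 0} 1/w(n)=\infty$. Extend $w$ to $[0,\infty)$ by $w(t)=w(\lfloor t\rfloor)$, let $W(t)=\int_0^t \frac{du}{w(u)}$ (an increasing homeomorphism of $[0,\infty)$), and define $$I_\alpha(w)=\int_0^\infty \frac{dx}{w\big(W^{-1}(W(x)+\alpha)\big)}\quad(\alpha\ge 0),\qquad \alpha_c(w)=\inf\{\alpha\ge 0 : I_\alpha(w)<\infty\}\in[0,\infty],\quad \inf\emptyset=\infty .$$ Let $(X_n)_{n\ge 0}$ be the vertex reinforced random walk (VRRW) on $\mathbb Z$ with weight $w$, that is, a nearest-neighbour process with $X_0=0$ almost surely such that, with $Z_n(y)=\sum_{k=0}^n 1_{\{X_k=y\}}$ and $\mathcal F_n=\sigma(X_0,\dots,X_n)$, for all $n\ge 0$, almost surely, $$\mathbb P\{X_{n+1}=X_n\pm 1\mid \mathcal F_n\}=\frac{w(Z_n(X_n\pm 1))}{w(Z_n(X_n+1))+w(Z_n(X_n-1))}.$$ Let $R'$ be the (random) set of sites $y\in\mathbb Z$ with $X_n=y$ for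 infinitely many $n$, and $|R'|$ its cardinality. Then: 1. $|R'|=4$ with positive probability if and only if $\alpha_c(w)<\infty$. 2. $|R'|=4$ almost surely if and only if $\alpha_c(w)=0$. 3. $|R'|\in\{4,5\}$ almost surely, with both $\mathbb P\{|R'|=4\}>0$ and $\mathbb P\{|R'|=5\}>0$, if and only if $\alpha_c(w)\in(0,\infty)$. -/

import Mathlib

open MeasureTheory ProbabilityTheory Filter
open scoped ENNReal NNReal

noncomputable section

/-- The weight sequence `w` extended to real arguments by `w(t) = w(⌊t⌋)` (only used for `t ≥ 0`). -/
def weightFun (w : ℕ → ℝ) (t : ℝ) : ℝ := w ⌊t⌋₊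

/-- `W(t) = ∫₀ᵗ du / w(u)`. -/
def weightPrimitive (w : ℕ → ℝ) (t : ℝ) : ℝ := ∫ u in (0 : ℝ)..t, 1 / weightFun w u

/-- `W⁻¹`, the inverse of `W` as a map from `[0, ∞)` to `[0, ∞)`; it is a true inverse as soon as
`w` is positive and `∑ 1 / w(n) = ∞`. -/
def weightPrimitiveInv (w : ℕ → ℝ) (y : ℝ) : ℝ :=
  Function.invFunOn (weightPrimitive w) (Set.Ici 0) y

/-- `I_α(w) = ∫₀^∞ dx / w(W⁻¹(W(x) + α))`, with values in `[0, ∞]`. -/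
def criticalIntegral (w : ℕ → ℝ) (α : ℝ) : ℝ≥0∞ :=
  ∫⁻ x in Set.Ici (0 : ℝ),
    ENNReal.ofReal (1 / weightFun w (weightPrimitiveInv w (weightPrimitive w x + α)))

/-- `α_c(w) = inf {α ≥ 0 : I_α(w) < ∞}` in `[0, ∞]`, with `inf ∅ = ∞`. -/
def criticalParam (w : ℕ → ℝ) : ℝ≥0∞ :=
  ⨅ (α : ℝ≥0) (_ : criticalIntegral w α < ∞), (α : ℝ≥0∞)

/-- The local time `Z_n(y) = ∑_{k=0}^n 1_{X_k = y}` of a path `x` at site `y` and time `n`. -/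
def localTime (x : ℕ → ℤ) (n : ℕ) (y : ℤ) : ℕ :=
  ((Finset.range (n + 1)).filter (fun k => x k = y)).card

/-- `R'`: the set of sites that the path `x` visits infinitely often. -/
def sitesVisitedInfinitelyOften (x : ℕ → ℤ) : Set ℤ := {y | ∃ᶠ n in atTop, x n = y}

/-- `X` is a vertex reinforced random walk on `ℤ` with weight sequence `w`, started at `0` from the
zero local time configuration: given `ℱ_n = σ(X_0, …, X_n)`, it jumps from `X_n` to a neighbour
`X_n ± 1` with probability `w(Z_n(X_n ± 1)) / (w(Z_n(X_n + 1)) + w(Z_n(X_n - 1)))`.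
(For positive `w` the two probabilities add up to `1`, so that jumps to nearest neighbours are the
only ones.) -/
structure IsVRRW {Ω : Type*} [MeasurableSpace Ω] (μ : Measure Ω) (w : ℕ → ℝ)
    (X : ℕ → Ω → ℤ) : Prop where
  stronglyMeasurable : ∀ n, StronglyMeasurable (X n)
  start : ∀ᵐ ω ∂μ, X 0 ω = 0
  step_right : ∀ n,
    μ[({ω | X (n + 1) ω = X n ω + 1} : Set Ω).indicator (fun _ => (1 : ℝ)) |
        Filtration.natural X stronglyMeasurable n] =ᵐ[μ]
      fun ω => w (localTime (X · ω) n (X n ω + 1)) /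
        (w (localTime (X · ω) n (X n ω + 1)) + w (localTime (X · ω) n (X n ω - 1)))
  step_left : ∀ n,
    μ[({ω | X (n + 1) ω = X n ω - 1} : Set Ω).indicator (fun _ => (1 : ℝ)) |
        Filtration.natural X stronglyMeasurable n] =ᵐ[μ]
      fun ω => w (localTime (X · ω) n (X n ω - 1)) /
        (w (localTime (X · ω) n (X n ω + 1)) + w (localTime (X · ω) n (X n ω - 1)))

end

/-! Sites are compared on the scale `W`. Along a nearest-neighbour path, `W(Z_n(y))` is a constant
plus the sum of `1 / w(Z)` over the jumps into `y`, split by the neighbour they come from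
(`cumWeight_localTime`). The two jump sums out of `y` differ by a martingale `siteMart` with bounded
increments. Almost surely it is bounded above if and only if it is bounded below, so both jump sums
out of a site converge or both diverge. Finiteness of `I_α` is convergence of `∑_j 1 / w(F_α(j))`,
where `F_α` = `levelShift` moves `j` by `α` on the scale `W` (`CriticalSummable`). This series
bounds the sum over all jumps from `y` to `z` made while `z` is ahead of `y` by at least `α`
(`jumpSum_sub_le`); conversely, if almost all visits to `y` lead to `z` and `z` is never ahead by
more than `α`, a finite jump sum makes the series converge (`summable_of_finiteJumpSum`).

Lower bound and necessity. Following which jump sums converge from an end of `R'` inwards shows that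
a bounded `R'` is an interval with at least four sites (`left_end`). If there are exactly four, the
differences on the scale `W` stay bounded in the direction that matters, and the convergent jump sum
out of the end site yields a convergent critical series (`exists_criticalSummable_of_four_sites`).

Sufficiency. A convergent critical series makes `w` grow at least linearly, so `∑ 1 / w(n)^2`
converges and the martingales are bounded. Force the walk to begin with a long path that favours the
inner sites. A supermartingale argument (`exit_bound`), with potentials controlling the martingales
and the escape through the end sites, keeps the walk on four sites with positive probability
(`measure_four_sites_pos`). If the series diverges for some `η > 0`, the same method keeps `-1` and
`1` within `η` of each other inside `{-2, …, 2}`; four sites would then force convergence at `η`, so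
all five are recurrent (`measure_five_sites_pos`).

At most five sites. The range is almost surely finite, since conditionally on reaching a new site to
the left, the walk fails to reach the site two steps further with probability bounded below
(`measure_hit_le`). With six recurrent sites, the comparison in `barrier` makes a jump sum converge
that `left_end` says diverges, unless some site with infinitely many jumps to both sides has a
convergent jump sum.

Excluding balance. That exception, and also five sites when every series with `α > 0` converges
(`five_sites_balanced`), would be a site `c` at which the walk is balanced in the sense of
`BalancedAt`. This has probability zero. Realize the walk by exponential clocks, using running alarm
clocks at `c`. Changing only the first left clock at `c` moves two driven paths apart monotonically
(`dominatedAt`), with a gap that persists in alarm time, and both cannot be balanced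
(`driven_exclusion`). Hence every line in the direction of that clock meets the balanced event at
most once, and the event is null because the exponential law has no atoms. Finally `IsVRRW.map_eq`
identifies the driven path in law with any vertex reinforced random walk. -/

/-- `W` at integer arguments. -/
noncomputable def cumWeight (w : ℕ → ℝ) (n : ℕ) : ℝ := ∑ k ∈ Finset.range n, (w k)⁻¹

lemma cumWeight_zero (w : ℕ → ℝ) : cumWeight w 0 = 0 := by simp [cumWeight]

lemma cumWeight_succ (w : ℕ → ℝ) (n : ℕ) : cumWeight w (n + 1) = cumWeight w n + (w n)⁻¹ := by
  simp [cumWeight, Finset.sum_range_succ]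

/-! ### The scale `W`, shifts on it, and the critical series -/

section Weight

variable {w : ℕ → ℝ} (hpos : ∀ n, 0 < w n)

include hpos

lemma cumWeight_strictMono : StrictMono (cumWeight w) :=
  strictMono_nat_of_lt_succ fun n => by
    rw [cumWeight_succ]; linarith [inv_pos.2 (hpos n)]

lemma cumWeight_mono : Monotone (cumWeight w) := (cumWeight_strictMono hpos).monotone

lemma cumWeight_nonneg (n : ℕ) : 0 ≤ cumWeight w n :=
  Finset.sum_nonneg fun k _ => (inv_pos.2 (hpos k)).le

lemma cumWeight_tendsto (hdiv : ¬ Summable (fun n => 1 / w n)) :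
    Tendsto (cumWeight w) atTop atTop := by
  have := (not_summable_iff_tendsto_nat_atTop_of_nonneg
    (f := fun n => 1 / w n) fun n => (one_div_pos.2 (hpos n)).le).1 hdiv
  simp only [one_div] at this
  exact this

variable (hmono : Monotone w)

include hmono

lemma weightFun_inv_antitone : Antitone (fun t => 1 / weightFun w t) := fun _ _ hst =>
  one_div_le_one_div_of_le (hpos _) (hmono (Nat.floor_mono hst))

lemma intervalIntegrable_weightFun (a b : ℝ) :
    IntervalIntegrable (fun t => 1 / weightFun w t) volume a b :=
  (weightFun_inv_antitone hpos hmono).intervalIntegrable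

lemma weightPrimitive_sub (a b : ℝ) :
    weightPrimitive w b - weightPrimitive w a = ∫ u in a..b, 1 / weightFun w u :=
  intervalIntegral.integral_interval_sub_left (intervalIntegrable_weightFun hpos hmono _ _)
    (intervalIntegrable_weightFun hpos hmono _ _)

lemma weightPrimitive_strictMono : StrictMono (weightPrimitive w) := fun a b hab => by
  have := weightPrimitive_sub hpos hmono a b
  have h2 : 0 < ∫ u in a..b, 1 / weightFun w u :=
    intervalIntegral.intervalIntegral_pos_of_pos (intervalIntegrable_weightFun hpos hmono _ _)
      (fun x => one_div_pos.2 (hpos _)) hab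
  linarith

lemma weightPrimitive_continuous : Continuous (weightPrimitive w) :=
  intervalIntegral.continuous_primitive (fun a b => intervalIntegrable_weightFun hpos hmono a b) 0

lemma weightPrimitive_natCast (n : ℕ) : weightPrimitive w n = cumWeight w n := by
  induction n with
  | zero => simp [weightPrimitive, cumWeight]
  | succ n ih =>
    have h := weightPrimitive_sub hpos hmono n (n + 1)
    have h2 : ∫ u in (n : ℝ)..(n + 1), 1 / weightFun w u = (w n)⁻¹ := by
      have : ∫ u in (n : ℝ)..(n + 1), 1 / weightFun w u = ∫ u in (n : ℝ)..(n + 1), (w n)⁻¹ := by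
        apply intervalIntegral.integral_congr_ae
        have hne : ∀ᵐ x : ℝ, x ≠ n + 1 := by
          rw [ae_iff]; simp
        filter_upwards [hne] with x hx hmem
        rw [Set.uIoc_of_le (by linarith)] at hmem
        have : ⌊x⌋₊ = n := by
          rw [Nat.floor_eq_iff (le_trans (Nat.cast_nonneg n) hmem.1.le)]
          exact ⟨hmem.1.le, lt_of_le_of_ne hmem.2 hx⟩
        simp [weightFun, this]
      rw [this]; simp
    push_cast
    rw [cumWeight_succ, ← ih, ← h2, ← h]; ring

variable (hdiv : ¬ Summable (fun n => 1 / w n))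

include hdiv

lemma weightPrimitiveInv_spec {y : ℝ} (hy : 0 ≤ y) :
    0 ≤ weightPrimitiveInv w y ∧ weightPrimitive w (weightPrimitiveInv w y) = y := by
  have hex : ∃ t ∈ Set.Ici (0 : ℝ), weightPrimitive w t = y := by
    obtain ⟨N, hN⟩ := ((cumWeight_tendsto hpos hdiv).eventually_ge_atTop y).exists
    rw [← weightPrimitive_natCast hpos hmono] at hN
    obtain ⟨t, ht, h⟩ := intermediate_value_Icc (Nat.cast_nonneg N)
      (weightPrimitive_continuous hpos hmono).continuousOn
      (⟨by simpa [weightPrimitive] using hy, hN⟩ : y ∈ Set.Icc (weightPrimitive w 0) _)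
    exact ⟨t, ht.1, h⟩
  exact ⟨Function.invFunOn_mem hex, Function.invFunOn_eq hex⟩

omit hpos hmono hdiv in
/-- The integer part of `W⁻¹(W(j) + a)`. -/
noncomputable def levelShift (w : ℕ → ℝ) (a : ℝ) (j : ℕ) : ℕ :=
  ⌊weightPrimitiveInv w (weightPrimitive w j + a)⌋₊

/-- `W` is strictly increasing, so the inverse can be removed. This adjunction is how the shift is
handled from here on. -/
lemma le_levelShift_iff {a : ℝ} (ha : 0 ≤ a) {j y : ℕ} :
    y ≤ levelShift w a j ↔ cumWeight w y ≤ cumWeight w j + a := by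
  have h0 : 0 ≤ weightPrimitive w j + a := by
    rw [weightPrimitive_natCast hpos hmono]
    exact add_nonneg (cumWeight_nonneg hpos j) ha
  obtain ⟨h1, h2⟩ := weightPrimitiveInv_spec hpos hmono hdiv h0
  rw [levelShift, Nat.le_floor_iff h1, ← (weightPrimitive_strictMono hpos hmono).le_iff_le, h2,
    weightPrimitive_natCast hpos hmono, weightPrimitive_natCast hpos hmono]

omit hpos hmono hdiv in
/-- Finiteness of `I_a(w)`, in discrete form. -/
def CriticalSummable (w : ℕ → ℝ) (a : ℝ) : Prop := Summable fun j => (w (levelShift w a j))⁻¹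

/-- The integrand is antitone and takes the values `1 / w (levelShift w a n)` at integers, so the
integral over `[n, n + 1)` lies between two consecutive terms of the series. -/
lemma criticalIntegral_lt_top_iff {a : ℝ} (ha : 0 ≤ a) :
    criticalIntegral w a < ∞ ↔ CriticalSummable w a := by
  set G : ℝ → ℝ≥0∞ := fun x => ENNReal.ofReal
    (1 / weightFun w (weightPrimitiveInv w (weightPrimitive w x + a))) with hG
  have hanti : AntitoneOn G (Set.Ici 0) := by
    intro x hx y hy hxy
    have h0 : 0 ≤ weightPrimitive w x := by
      have := (weightPrimitive_strictMono hpos hmono).monotone (Set.mem_Ici.1 hx)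
      simpa [weightPrimitive] using this
    have hxy' := (weightPrimitive_strictMono hpos hmono).monotone hxy
    obtain ⟨h1, h2⟩ := weightPrimitiveInv_spec hpos hmono hdiv (add_nonneg h0 ha)
    obtain ⟨h3, h4⟩ := weightPrimitiveInv_spec hpos hmono hdiv (add_nonneg (h0.trans hxy') ha)
    apply ENNReal.ofReal_le_ofReal
    apply weightFun_inv_antitone hpos hmono
    rw [← (weightPrimitive_strictMono hpos hmono).le_iff_le, h2, h4]
    linarith
  have hGn : ∀ n : ℕ, G n = ENNReal.ofReal ((w (levelShift w a n))⁻¹) := fun n => by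
    simp [hG, weightFun, levelShift]
  have hdec : criticalIntegral w a = ∑' n : ℕ, ∫⁻ x in Set.Ico (n : ℝ) (n + 1), G x := by
    have : Set.Ici (0 : ℝ) = ⋃ n : ℕ, Set.Ico (n : ℝ) (n + 1) := by
      ext x
      simp only [Set.mem_Ici, Set.mem_iUnion, Set.mem_Ico]
      exact ⟨fun h => ⟨⌊x⌋₊, Nat.floor_le h, Nat.lt_floor_add_one x⟩,
        fun ⟨n, hn, _⟩ => le_trans (Nat.cast_nonneg n) hn⟩
    rw [criticalIntegral, this, lintegral_iUnion (fun _ => measurableSet_Ico)]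
    intro m n hmn
    refine Set.disjoint_left.2 fun x hx hx' => hmn ?_
    rw [← (Nat.floor_eq_iff (le_trans (Nat.cast_nonneg m) hx.1)).2 hx,
      ← (Nat.floor_eq_iff (le_trans (Nat.cast_nonneg n) hx'.1)).2 hx']
  have hup : ∀ n : ℕ, ∫⁻ x in Set.Ico (n : ℝ) (n + 1), G x ≤ G n := fun n => by
    calc _ ≤ ∫⁻ x in Set.Ico (n : ℝ) (n + 1), G n := by
          apply setLIntegral_mono measurable_const
          intro x hx
          exact hanti (Set.mem_Ici.2 (Nat.cast_nonneg n))
            (Set.mem_Ici.2 (le_trans (Nat.cast_nonneg n) hx.1)) hx.1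
      _ = G n := by simp
  have hlow : ∀ n : ℕ, G (n + 1 : ℕ) ≤ ∫⁻ x in Set.Ico (n : ℝ) (n + 1), G x := fun n => by
    calc G (n + 1 : ℕ) = ∫⁻ x in Set.Ico (n : ℝ) (n + 1), G (n + 1 : ℕ) := by simp
      _ ≤ _ := by
          apply setLIntegral_mono' measurableSet_Ico
          intro x hx
          refine hanti (Set.mem_Ici.2 (le_trans (Nat.cast_nonneg n) hx.1))
            (Set.mem_Ici.2 (Nat.cast_nonneg _)) ?_
          push_cast; exact hx.2.le
  have hnn : ∀ n, 0 ≤ (w (levelShift w a n))⁻¹ := fun n => (inv_pos.2 (hpos _)).le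
  constructor
  · intro h
    have h2 : ∑' n : ℕ, G (n + 1 : ℕ) ≠ ∞ :=
      ((ENNReal.tsum_le_tsum hlow).trans (hdec ▸ le_rfl)).trans_lt h |>.ne
    have h3 := ENNReal.summable_toReal h2
    rw [CriticalSummable, ← summable_nat_add_iff 1]
    refine h3.congr fun n => ?_
    rw [hGn, ENNReal.toReal_ofReal (hnn _)]
  · intro h
    rw [hdec]
    refine (ENNReal.tsum_le_tsum hup).trans_lt ?_
    simp_rw [hGn]
    rw [← ENNReal.ofReal_tsum_of_nonneg hnn h]
    exact ENNReal.ofReal_lt_top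

lemma levelShift_mono {a b : ℝ} (ha : 0 ≤ a) (hab : a ≤ b) (j : ℕ) :
    levelShift w a j ≤ levelShift w b j := by
  rw [le_levelShift_iff hpos hmono hdiv (ha.trans hab)]
  linarith [(le_levelShift_iff hpos hmono hdiv ha (j := j)).1 le_rfl]

lemma levelShift_mono_right {a : ℝ} (ha : 0 ≤ a) : Monotone (levelShift w a) := fun i j hij => by
  rw [le_levelShift_iff hpos hmono hdiv ha]
  linarith [(le_levelShift_iff hpos hmono hdiv ha (j := i)).1 le_rfl, cumWeight_mono hpos hij]

lemma levelShift_le {a : ℝ} (ha : 0 ≤ a) {j y : ℕ} (h : cumWeight w j + a ≤ cumWeight w y) :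
    levelShift w a j ≤ y := by
  rw [← (cumWeight_strictMono hpos).le_iff_le]
  exact ((le_levelShift_iff hpos hmono hdiv ha).1 le_rfl).trans h

lemma CriticalSummable.mono {a b : ℝ} (ha : 0 ≤ a) (hab : a ≤ b) (h : CriticalSummable w a) :
    CriticalSummable w b :=
  h.of_nonneg_of_le (fun _ => (inv_pos.2 (hpos _)).le) fun j =>
    inv_anti₀ (hpos _) (hmono (levelShift_mono hpos hmono hdiv ha hab j))

lemma criticalParam_lt_top_iff : criticalParam w < ∞ ↔ ∃ a : ℝ, 0 ≤ a ∧ CriticalSummable w a := by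
  simp only [criticalParam, iInf_lt_top]
  constructor
  · rintro ⟨a, h, _⟩
    exact ⟨a, a.2, (criticalIntegral_lt_top_iff hpos hmono hdiv a.2).1 h⟩
  · rintro ⟨a, ha, h⟩
    exact ⟨⟨a, ha⟩, (criticalIntegral_lt_top_iff hpos hmono hdiv ha).2 h, ENNReal.coe_lt_top⟩

lemma criticalParam_eq_zero_iff :
    criticalParam w = 0 ↔ ∀ a : ℝ, 0 < a → CriticalSummable w a := by
  constructor
  · intro h a ha
    have h1 : criticalParam w < ENNReal.ofReal a := by rw [h]; simpa using ha
    simp only [criticalParam, iInf_lt_iff] at h1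
    obtain ⟨b, hb, hba⟩ := h1
    refine CriticalSummable.mono hpos hmono hdiv b.2 ?_
      ((criticalIntegral_lt_top_iff hpos hmono hdiv b.2).1 hb)
    rw [ENNReal.ofReal, ENNReal.coe_lt_coe] at hba
    have : (b : ℝ) < (a.toNNReal : ℝ) := NNReal.coe_lt_coe.2 hba
    rw [Real.coe_toNNReal a ha.le] at this
    exact this.le
  · intro h
    by_contra hne
    obtain ⟨c, hc0, hc⟩ := ENNReal.lt_iff_exists_nnreal_btwn.1 (pos_iff_ne_zero.2 hne)
    have hc0' : (0 : ℝ) < c := by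
      have : (0 : ℝ≥0) < c := by exact_mod_cast hc0
      exact_mod_cast this
    have : criticalParam w ≤ c :=
      iInf₂_le c ((criticalIntegral_lt_top_iff hpos hmono hdiv c.2).2 (h c hc0'))
    exact absurd hc (not_lt.2 this)

section Summable

variable {a : ℝ} (ha : 0 ≤ a) (hs : CriticalSummable w a)

include ha hs

/-- A summable critical series forces at least linear growth of the weights. -/
lemma CriticalSummable.linear_growth : ∃ c : ℝ, 0 < c ∧ ∀ n : ℕ, c * (n + 1) ≤ w n := by
  set J := ∑' j, (w (levelShift w a j))⁻¹ with hJ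
  have hJ1 : ∀ k : ℕ, (k : ℝ) * (w (levelShift w a k))⁻¹ ≤ J := fun k => by
    calc (k : ℝ) * (w (levelShift w a k))⁻¹
        = ∑ _j ∈ Finset.range k, (w (levelShift w a k))⁻¹ := by simp
      _ ≤ ∑ j ∈ Finset.range k, (w (levelShift w a j))⁻¹ := by
          refine Finset.sum_le_sum fun j hj => inv_anti₀ (hpos _) (hmono ?_)
          exact levelShift_mono_right hpos hmono hdiv ha (Finset.mem_range.1 hj).le
      _ ≤ J := hs.sum_le_tsum _ fun j _ => (inv_pos.2 (hpos _)).le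
  set K := max (max J a) 1 with hK
  have hK1 : 1 ≤ K := le_max_right _ _
  have hK0 : 0 < K := by linarith
  have hJK : J ≤ K := (le_max_left _ _).trans (le_max_left _ _)
  have haK : a ≤ K := (le_max_right _ _).trans (le_max_left _ _)
  -- Either the shift of `n / 2` stays below `n`, and `hJ1` bounds `w n` from below; or `W` gains at
  -- most `a` between `n / 2` and `n`, where each summand is at least `1 / w n`.
  have key : ∀ n : ℕ, ((n / 2 : ℕ) : ℝ) ≤ K * w n := fun n => by
    rcases le_total (levelShift w a (n / 2)) n with h | h
    · have h1 := hJ1 (n / 2)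
      have h2 : w (levelShift w a (n / 2)) ≤ w n := hmono h
      rw [← div_eq_mul_inv, div_le_iff₀ (hpos _)] at h1
      calc _ ≤ J * w (levelShift w a (n / 2)) := h1
        _ ≤ K * w (levelShift w a (n / 2)) := by gcongr; exact (hpos _).le
        _ ≤ K * w n := by gcongr
    · rw [le_levelShift_iff hpos hmono hdiv ha] at h
      have h1 : cumWeight w n - cumWeight w (n / 2) = ∑ k ∈ Finset.Ico (n / 2) n, (w k)⁻¹ := by
        rw [Finset.sum_Ico_eq_sub _ (Nat.div_le_self n 2)]; rfl
      have h2 : ((n - n / 2 : ℕ) : ℝ) * (w n)⁻¹ ≤ ∑ k ∈ Finset.Ico (n / 2) n, (w k)⁻¹ := by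
        rw [← nsmul_eq_mul, ← Nat.card_Ico]
        refine Finset.card_nsmul_le_sum _ _ _ fun k hk => inv_anti₀ (hpos _) (hmono ?_)
        exact (Finset.mem_Ico.1 hk).2.le
      have h3 : ((n - n / 2 : ℕ) : ℝ) ≤ K * w n := by
        have : ((n - n / 2 : ℕ) : ℝ) * (w n)⁻¹ ≤ K := by linarith
        rwa [← div_eq_mul_inv, div_le_iff₀ (hpos _)] at this
      refine le_trans ?_ h3
      exact_mod_cast (by omega : n / 2 ≤ n - n / 2)
  have hw0 := hpos 0
  refine ⟨(3 * K + 2 / w 0)⁻¹, by positivity, fun n => ?_⟩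
  rw [inv_mul_le_iff₀ (by positivity)]
  have h1 := key n
  have h2 : (n : ℝ) ≤ 2 * ((n / 2 : ℕ) : ℝ) + 1 := by exact_mod_cast (by omega : n ≤ 2 * (n / 2) + 1)
  have h3 : 1 ≤ 1 / w 0 * w n := by
    rw [one_div, ← div_eq_inv_mul, le_div_iff₀ hw0, one_mul]; exact hmono (Nat.zero_le n)
  have h4 := hpos n
  have : (3 * K + 2 / w 0) * w n = 3 * (K * w n) + 2 * (1 / w 0 * w n) := by ring
  rw [this]
  nlinarith [mul_pos hK0 h4]

/-- A consequence of linear growth. The series bounds the quadratic variation of each `siteMart`,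
since the jumps to a given site use each level of its local time once. -/
lemma CriticalSummable.summable_sq : Summable fun n => ((w n)⁻¹) ^ 2 := by
  obtain ⟨c, hc, h⟩ := hs.linear_growth hpos hmono hdiv ha
  have h1 : Summable fun n : ℕ => c⁻¹ ^ 2 * (1 / ((n + 1 : ℕ) : ℝ) ^ 2) :=
    ((summable_nat_add_iff 1).2 (Real.summable_one_div_nat_pow.2 one_lt_two)).mul_left _
  refine h1.of_nonneg_of_le (fun n => by positivity) fun n => ?_
  have h2 : (w n)⁻¹ ≤ (c * (n + 1))⁻¹ := inv_anti₀ (by positivity) (h n)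
  calc ((w n)⁻¹) ^ 2 ≤ ((c * (n + 1))⁻¹) ^ 2 :=
        pow_le_pow_left₀ (inv_pos.2 (hpos n)).le h2 2
    _ = _ := by push_cast; rw [mul_inv, mul_pow, one_div, inv_pow (_ + _)]

lemma CriticalSummable.weight_tendsto : Tendsto w atTop atTop := by
  obtain ⟨c, hc, h⟩ := hs.linear_growth hpos hmono hdiv ha
  refine tendsto_atTop_mono h (Tendsto.const_mul_atTop hc ?_)
  exact tendsto_atTop_add_const_right _ _ tendsto_natCast_atTop_atTop

/-- Doubling the argument changes `W` by a bounded amount only. -/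
lemma CriticalSummable.cumWeight_add_le : ∃ C : ℝ, 0 ≤ C ∧ ∀ x y z : ℕ, z ≤ x + y + 1 →
    cumWeight w z ≤ max (cumWeight w x) (cumWeight w y) + C := by
  obtain ⟨c, hc, h⟩ := hs.linear_growth hpos hmono hdiv ha
  have key : ∀ x : ℕ, cumWeight w (x + x + 1) ≤ cumWeight w x + c⁻¹ := fun x => by
    have h1 : cumWeight w (x + x + 1) - cumWeight w x
        = ∑ k ∈ Finset.Ico x (x + x + 1), (w k)⁻¹ := by
      rw [Finset.sum_Ico_eq_sub _ (by omega)]; rfl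
    have h2 : ∑ k ∈ Finset.Ico x (x + x + 1), (w k)⁻¹ ≤ (x + 1 : ℕ) • (w x)⁻¹ := by
      have : (x + 1 : ℕ) = (Finset.Ico x (x + x + 1)).card := by simp; omega
      rw [this]
      exact Finset.sum_le_card_nsmul _ _ _ fun k hk =>
        inv_anti₀ (hpos _) (hmono (Finset.mem_Ico.1 hk).1)
    have h3 : (x + 1 : ℕ) • (w x)⁻¹ ≤ c⁻¹ := by
      rw [nsmul_eq_mul, ← div_eq_mul_inv, div_le_iff₀ (hpos _), ← div_eq_inv_mul, le_div_iff₀ hc]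
      push_cast; linarith [h x]
    linarith
  refine ⟨c⁻¹, by positivity, fun x y z hz => ?_⟩
  rcases le_total x y with hxy | hxy
  · rw [max_eq_right (cumWeight_mono hpos hxy)]
    exact (cumWeight_mono hpos (by omega)).trans (key y)
  · rw [max_eq_left (cumWeight_mono hpos hxy)]
    exact (cumWeight_mono hpos (by omega)).trans (key x)

omit ha hs in
lemma tendsto_levelShift (j : ℕ) : Tendsto (fun A => levelShift w A j) atTop atTop := by
  refine tendsto_atTop.2 fun y => ?_
  filter_upwards [eventually_ge_atTop (cumWeight w y), eventually_ge_atTop 0] with A hA hA0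
  rw [le_levelShift_iff hpos hmono hdiv hA0]
  linarith [cumWeight_nonneg hpos j]

/-- Dominated convergence, with the series at `a` as dominating function. A large lead thus makes
later jump sums and exit probabilities as small as desired. -/
lemma CriticalSummable.tendsto_tsum :
    Tendsto (fun A => ∑' j, (w (levelShift w A j))⁻¹) atTop (nhds 0) := by
  have h0 : (0 : ℝ) = ∑' _j : ℕ, (0 : ℝ) := by simp
  rw [h0]
  refine tendsto_tsum_of_dominated_convergence (bound := fun j => (w (levelShift w a j))⁻¹) hs
    (fun j => ?_) ?_
  · exact tendsto_inv_atTop_zero.comp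
      ((hs.weight_tendsto hpos hmono hdiv ha).comp (tendsto_levelShift hpos hmono hdiv j))
  · filter_upwards [eventually_ge_atTop a] with A hA j
    rw [Real.norm_of_nonneg (inv_pos.2 (hpos _)).le]
    exact inv_anti₀ (hpos _) (hmono (levelShift_mono hpos hmono hdiv ha hA j))

end Summable

end Weight

/-! ### Nearest-neighbour paths, local times and jump sums -/

/-- Paths that move to a nearest neighbour in every step. -/
def IsNearestNeighbor (x : ℕ → ℤ) : Prop := ∀ n, x (n + 1) = x n + 1 ∨ x (n + 1) = x n - 1

/-- The sum of `1 / w(Z_k(z))` over the jumps from `y` to `z` made before time `n`. -/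
noncomputable def jumpSum (w : ℕ → ℝ) (x : ℕ → ℤ) (y z : ℤ) (n : ℕ) : ℝ :=
  ∑ k ∈ Finset.range n, if x k = y ∧ x (k + 1) = z then (w (localTime x k z))⁻¹ else 0

/-- The martingale attached to the site `y`. -/
noncomputable def siteMart (w : ℕ → ℝ) (x : ℕ → ℤ) (y : ℤ) (n : ℕ) : ℝ :=
  jumpSum w x y (y + 1) n - jumpSum w x y (y - 1) n

/-- The sum over all jumps from `y` to `z` is finite. -/
def FiniteJumpSum (w : ℕ → ℝ) (x : ℕ → ℤ) (y z : ℤ) : Prop :=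
  BddAbove (Set.range (jumpSum w x y z))

section LocalTime

variable (x : ℕ → ℤ)

lemma localTime_zero (y : ℤ) : localTime x 0 y = if x 0 = y then 1 else 0 := by
  simp [localTime, Finset.filter_singleton]; split_ifs <;> rfl

lemma localTime_succ (n : ℕ) (y : ℤ) :
    localTime x (n + 1) y = localTime x n y + if x (n + 1) = y then 1 else 0 := by
  rw [localTime, Finset.range_add_one, Finset.filter_insert, localTime]
  split_ifs <;> simp

lemma localTime_mono (y : ℤ) : Monotone (fun n => localTime x n y) :=
  monotone_nat_of_le_succ fun n => by simp only [localTime_succ]; omega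

lemma localTime_lt {m n : ℕ} {y : ℤ} (hmn : m < n) (hy : x n = y) :
    localTime x m y < localTime x n y := by
  obtain ⟨k, rfl⟩ : ∃ k, n = k + 1 := ⟨n - 1, by omega⟩
  rw [localTime_succ, if_pos hy]
  exact Nat.lt_succ_of_le (localTime_mono x y (by omega))

lemma localTime_pos {n : ℕ} {y : ℤ} (hy : x n = y) : 0 < localTime x n y :=
  Finset.card_pos.2 ⟨n, by simp [hy]⟩

lemma localTime_congr {x x' : ℕ → ℤ} {n : ℕ} (h : ∀ k ≤ n, x k = x' k) (y : ℤ) :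
    localTime x n y = localTime x' n y := by
  unfold localTime
  congr 1
  refine Finset.filter_congr fun k hk => ?_
  rw [h k (by simpa [Nat.lt_succ_iff] using hk)]

lemma localTime_neg (n : ℕ) (y : ℤ) : localTime (fun k => -x k) n (-y) = localTime x n y := by
  simp [localTime, neg_inj]

lemma localTime_tendsto {y : ℤ} (h : y ∈ sitesVisitedInfinitelyOften x) :
    Tendsto (fun n => localTime x n y) atTop atTop := by
  refine tendsto_atTop_atTop_of_monotone (localTime_mono x y) fun b => ?_
  induction b with
  | zero => exact ⟨0, Nat.zero_le _⟩
  | succ b ih =>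
    obtain ⟨n, hn⟩ := ih
    obtain ⟨m, hm, hm'⟩ := Filter.frequently_atTop.1 h (n + 1)
    exact ⟨m, by have := localTime_lt x (show n < m by omega) hm'; omega⟩

lemma localTime_eventually_const {y : ℤ} (h : y ∉ sitesVisitedInfinitelyOften x) :
    ∃ n₀, ∀ n ≥ n₀, x n ≠ y ∧ localTime x n y = localTime x n₀ y := by
  obtain ⟨n₀, hn⟩ := eventually_atTop.1 (not_frequently.1 h)
  refine ⟨n₀, fun n hge => ⟨hn n hge, ?_⟩⟩
  induction n, hge using Nat.le_induction with
  | base => rfl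
  | succ k hk ih => rw [localTime_succ, if_neg (hn _ (by omega)), ih]; rfl

end LocalTime

section JumpSum

variable {w : ℕ → ℝ} (hpos : ∀ n, 0 < w n) {x : ℕ → ℤ}

lemma jumpSum_succ (w : ℕ → ℝ) (x : ℕ → ℤ) (y z : ℤ) (n : ℕ) :
    jumpSum w x y z (n + 1) = jumpSum w x y z n +
      if x n = y ∧ x (n + 1) = z then (w (localTime x n z))⁻¹ else 0 := by
  simp [jumpSum, Finset.sum_range_succ]

lemma jumpSum_zero (w : ℕ → ℝ) (x : ℕ → ℤ) (y z : ℤ) : jumpSum w x y z 0 = 0 := by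
  simp [jumpSum]

lemma jumpSum_congr {w : ℕ → ℝ} {x x' : ℕ → ℤ} {n : ℕ} (h : ∀ k ≤ n, x k = x' k) (y z : ℤ) :
    jumpSum w x y z n = jumpSum w x' y z n := by
  refine Finset.sum_congr rfl fun k hk => ?_
  have hk := Finset.mem_range.1 hk
  rw [h k hk.le, h (k + 1) hk, localTime_congr fun j hj => h j (by omega)]

lemma jumpSum_neg (w : ℕ → ℝ) (x : ℕ → ℤ) (y z : ℤ) (n : ℕ) :
    jumpSum w (fun k => -x k) (-y) (-z) n = jumpSum w x y z n := by
  simp [jumpSum, localTime_neg, neg_inj]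

lemma siteMart_neg (w : ℕ → ℝ) (x : ℕ → ℤ) (y : ℤ) (n : ℕ) :
    siteMart w (fun k => -x k) (-y) n = -siteMart w x y n := by
  have h1 := jumpSum_neg w x y (y + 1) n
  have h2 := jumpSum_neg w x y (y - 1) n
  rw [show -(y + 1) = -y - 1 by ring] at h1
  rw [show -(y - 1) = -y + 1 by ring] at h2
  rw [siteMart, siteMart, h1, h2]; ring

include hpos

lemma jumpSum_mono (y z : ℤ) : Monotone (jumpSum w x y z) :=
  monotone_nat_of_le_succ fun n => by
    rw [jumpSum_succ]
    have := inv_pos.2 (hpos (localTime x n z))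
    split_ifs <;> linarith

lemma jumpSum_nonneg (y z : ℤ) (n : ℕ) : 0 ≤ jumpSum w x y z n := by
  rw [← jumpSum_zero w x y z]; exact jumpSum_mono hpos y z (Nat.zero_le n)

omit hpos in
/-- For a nearest neighbour path, `W(Z_n(y))` is the sum of the contributions of the jumps to `y`
from its two neighbours. -/
lemma cumWeight_localTime (hx : IsNearestNeighbor x) (y : ℤ) (n : ℕ) :
    cumWeight w (localTime x n y) = cumWeight w (localTime x 0 y) +
      jumpSum w x (y - 1) y n + jumpSum w x (y + 1) y n := by
  induction n with
  | zero => simp [jumpSum_zero]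
  | succ n ih =>
    rw [localTime_succ, jumpSum_succ, jumpSum_succ]
    by_cases h : x (n + 1) = y
    · rw [if_pos h, cumWeight_succ, ih]
      rcases hx n with h1 | h1
      · rw [if_pos ⟨by omega, h⟩, if_neg (by omega)]; ring
      · rw [if_neg (by omega), if_pos ⟨by omega, h⟩]; ring
    · simp [h, ih]

lemma jumpSum_le_cumWeight_right (hx : IsNearestNeighbor x) (y : ℤ) (n : ℕ) :
    jumpSum w x (y + 1) y n ≤ cumWeight w (localTime x n y) := by
  rw [cumWeight_localTime hx]
  linarith [jumpSum_nonneg (x := x) hpos (y - 1) y n, cumWeight_nonneg hpos (localTime x 0 y)]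

omit hpos in
lemma cumWeight_localTime_sub (hx : IsNearestNeighbor x) (y : ℤ) (m n : ℕ) :
    cumWeight w (localTime x n y) - cumWeight w (localTime x m y) =
      (jumpSum w x (y - 1) y n - jumpSum w x (y - 1) y m) +
      (jumpSum w x (y + 1) y n - jumpSum w x (y + 1) y m) := by
  rw [cumWeight_localTime hx y n, cumWeight_localTime hx y m]; ring

lemma FiniteJumpSum.of_finite {y z : ℤ} (h : ¬ ∃ᶠ n in atTop, x n = y ∧ x (n + 1) = z) :
    FiniteJumpSum w x y z := by
  obtain ⟨n₀, hn⟩ := eventually_atTop.1 (not_frequently.1 h)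
  refine ⟨jumpSum w x y z n₀, ?_⟩
  rintro _ ⟨n, rfl⟩
  rcases le_total n n₀ with h | h
  · exact jumpSum_mono hpos y z h
  · induction n, h using Nat.le_induction with
    | base => exact le_rfl
    | succ k hk ih => rw [jumpSum_succ, if_neg (hn k hk)]; linarith

lemma FiniteJumpSum.of_le {y z : ℤ} {C : ℝ} {n₀ : ℕ} (h : ∀ n ≥ n₀, jumpSum w x y z n ≤ C) :
    FiniteJumpSum w x y z := by
  refine ⟨C, ?_⟩
  rintro _ ⟨n, rfl⟩
  exact (jumpSum_mono hpos y z (le_max_left n n₀)).trans (h _ (le_max_right _ _))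

/-- If one jump sum converges, their difference `siteMart` is bounded on one side, hence on both,
and the other jump sum is bounded too. -/
lemma finiteJumpSum_iff (hd : ∀ y, BddAbove (Set.range (siteMart w x y)) ↔
    BddBelow (Set.range (siteMart w x y))) (y : ℤ) :
    FiniteJumpSum w x y (y + 1) ↔ FiniteJumpSum w x y (y - 1) := by
  constructor
  · rintro ⟨C, hC⟩
    have : BddAbove (Set.range (siteMart w x y)) := by
      refine ⟨C, ?_⟩
      rintro _ ⟨n, rfl⟩
      have := hC ⟨n, rfl⟩
      rw [siteMart]; linarith [jumpSum_nonneg (x := x) hpos y (y - 1) n]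
    obtain ⟨L, hL⟩ := (hd y).1 this
    refine ⟨C - L, ?_⟩
    rintro _ ⟨n, rfl⟩
    have h1 := hC ⟨n, rfl⟩
    have h2 := hL ⟨n, rfl⟩
    rw [siteMart] at h2; linarith
  · rintro ⟨C, hC⟩
    have : BddBelow (Set.range (siteMart w x y)) := by
      refine ⟨-C, ?_⟩
      rintro _ ⟨n, rfl⟩
      have := hC ⟨n, rfl⟩
      rw [siteMart]; linarith [jumpSum_nonneg (x := x) hpos y (y + 1) n]
    obtain ⟨L, hL⟩ := (hd y).2 this
    refine ⟨C + L, ?_⟩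
    rintro _ ⟨n, rfl⟩
    have h1 := hC ⟨n, rfl⟩
    have h2 := hL ⟨n, rfl⟩
    rw [siteMart] at h2; linarith

end JumpSum

section NearestNeighbor

variable {x : ℕ → ℤ} (hx : IsNearestNeighbor x)

include hx

omit hx in
lemma IsNearestNeighbor.neg (hx : IsNearestNeighbor x) : IsNearestNeighbor fun n => -x n :=
  fun n => by rcases hx n with h | h <;> simp only [h] <;> omega

/-- Every earlier visit to `y` was followed at once by a visit to a neighbour; the indicator
accounts for the visit in progress. -/
lemma localTime_le_neighbors (y : ℤ) (n : ℕ) :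
    localTime x n y ≤ localTime x n (y - 1) + localTime x n (y + 1) + if x n = y then 1 else 0 := by
  induction n with
  | zero => rw [localTime_zero]; omega
  | succ n ih =>
    simp only [localTime_succ]
    rcases hx n with h | h <;> split_ifs at * <;> omega

lemma localTime_le_neighbors' (y : ℤ) (n : ℕ) :
    localTime x n y ≤ localTime x n (y - 1) + localTime x n (y + 1) + 1 := by
  have := localTime_le_neighbors hx y n
  split_ifs at this <;> omega

lemma exists_visit_between {m n : ℕ} (hmn : m ≤ n) {c : ℤ}
    (h : (x m ≤ c ∧ c ≤ x n) ∨ (x n ≤ c ∧ c ≤ x m)) : ∃ k, m ≤ k ∧ k ≤ n ∧ x k = c := by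
  induction n, hmn using Nat.le_induction with
  | base => exact ⟨m, le_rfl, le_rfl, by omega⟩
  | succ n hmn ih =>
    by_cases hc : x (n + 1) = c
    · exact ⟨n + 1, by omega, le_rfl, hc⟩
    · obtain ⟨k, h1, h2, h3⟩ := ih (by rcases hx n with h' | h' <;> omega)
      exact ⟨k, h1, by omega, h3⟩

lemma mem_sites_of_between {a b c : ℤ} (ha : a ∈ sitesVisitedInfinitelyOften x)
    (hb : b ∈ sitesVisitedInfinitelyOften x) (hac : a ≤ c) (hcb : c ≤ b) :
    c ∈ sitesVisitedInfinitelyOften x := by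
  refine frequently_atTop.2 fun N => ?_
  obtain ⟨m, hm, hm'⟩ := frequently_atTop.1 ha N
  obtain ⟨n, hn, hn'⟩ := frequently_atTop.1 hb m
  obtain ⟨k, h1, -, h3⟩ := exists_visit_between hx hn (c := c) (Or.inl (by omega))
  exact ⟨k, by omega, h3⟩

lemma sites_eq_Icc (hfin : (sitesVisitedInfinitelyOften x).Finite)
    (hne : (sitesVisitedInfinitelyOften x).Nonempty) :
    ∃ a b : ℤ, a ≤ b ∧ sitesVisitedInfinitelyOften x = Set.Icc a b := by
  obtain ⟨a, ha, ha'⟩ := Set.exists_min_image _ id hfin hne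
  obtain ⟨b, hb, hb'⟩ := Set.exists_max_image _ id hfin hne
  refine ⟨a, b, ha' b hb, Set.Subset.antisymm (fun c hc => ⟨ha' c hc, hb' c hc⟩) fun c hc => ?_⟩
  exact mem_sites_of_between hx ha hb hc.1 hc.2

/-- Once `a - 1` and `b + 1` have been visited for the last time and the path is at `a`, it cannot
leave without crossing one of them. -/
lemma eventually_mem_Icc {a b : ℤ} (hab : a ≤ b)
    (h : sitesVisitedInfinitelyOften x = Set.Icc a b) : ∀ᶠ n in atTop, x n ∈ Set.Icc a b := by
  have ha : a ∈ sitesVisitedInfinitelyOften x := by rw [h]; exact ⟨le_rfl, hab⟩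
  have h1 : a - 1 ∉ sitesVisitedInfinitelyOften x := by rw [h]; simp
  have h2 : b + 1 ∉ sitesVisitedInfinitelyOften x := by rw [h]; simp
  obtain ⟨n₁, h1⟩ := localTime_eventually_const x h1
  obtain ⟨n₂, h2⟩ := localTime_eventually_const x h2
  obtain ⟨n₀, hn₀, hn₀'⟩ := frequently_atTop.1 ha (max n₁ n₂)
  have hge := max_le_iff.1 hn₀
  filter_upwards [eventually_ge_atTop n₀] with n hn
  by_contra hcon
  rw [Set.mem_Icc, not_and_or, not_le, not_le] at hcon
  rcases hcon with hc | hc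
  · obtain ⟨k, hk, -, hk'⟩ := exists_visit_between hx hn (c := a - 1) (Or.inr (by omega))
    exact (h1 k (by omega)).1 hk'
  · obtain ⟨k, hk, -, hk'⟩ := exists_visit_between hx hn (c := b + 1) (Or.inl (by omega))
    exact (h2 k (by omega)).1 hk'

lemma frequently_jump {y : ℤ} (h1 : y ∈ sitesVisitedInfinitelyOften x)
    (h2 : y + 1 ∈ sitesVisitedInfinitelyOften x) :
    (∃ᶠ n in atTop, x n = y ∧ x (n + 1) = y + 1) ∧
      ∃ᶠ n in atTop, x n = y + 1 ∧ x (n + 1) = y := by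
  constructor
  · refine frequently_atTop.2 fun N => ?_
    obtain ⟨m, hm, hm'⟩ := frequently_atTop.1 h1 N
    obtain ⟨n, hn, hn'⟩ := frequently_atTop.1 h2 m
    by_contra! hcon
    have : ∀ k, m ≤ k → x k ≤ y := fun k hk => by
      induction k, hk using Nat.le_induction with
      | base => omega
      | succ k hk ih => have := hcon k (by omega); rcases hx k with h | h <;> omega
    have := this n hn; omega
  · refine frequently_atTop.2 fun N => ?_
    obtain ⟨m, hm, hm'⟩ := frequently_atTop.1 h2 N
    obtain ⟨n, hn, hn'⟩ := frequently_atTop.1 h1 m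
    by_contra! hcon
    have : ∀ k, m ≤ k → y + 1 ≤ x k := fun k hk => by
      induction k, hk using Nat.le_induction with
      | base => omega
      | succ k hk ih => have := hcon k (by omega); rcases hx k with h | h <;> omega
    have := this n hn; omega

omit hx in
lemma sites_neg (x : ℕ → ℤ) :
    sitesVisitedInfinitelyOften (fun n => -x n) = -sitesVisitedInfinitelyOften x := by
  ext y
  simp only [sitesVisitedInfinitelyOften, Set.mem_ofPred_eq, Set.mem_neg]
  refine ⟨fun h => h.mono fun n hn => by omega, fun h => h.mono fun n hn => by omega⟩

end NearestNeighbor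

/-! ### Sums over visits against sums over levels -/

section VisitSums

variable {w : ℕ → ℝ} (hpos : ∀ n, 0 < w n) (hmono : Monotone w)
  (hdiv : ¬ Summable (fun n => 1 / w n)) {x : ℕ → ℤ}

include hpos hmono hdiv

open Classical in
/-- The visits to `y` at which `z` has been visited much more often contribute little. -/
lemma sum_visits_le {a : ℝ} (ha : 0 ≤ a) (hs : CriticalSummable w a) {y z : ℤ} (P : ℕ → Prop)
    (n : ℕ) (hP : ∀ k < n, x k = y → P k →
      cumWeight w (localTime x k y) + a ≤ cumWeight w (localTime x k z)) :
    ∑ k ∈ Finset.range n with (x k = y ∧ P k), (w (localTime x k z))⁻¹ ≤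
      ∑' j, (w (levelShift w a j))⁻¹ := by
  set s := (Finset.range n).filter fun k => x k = y ∧ P k with hsdef
  -- Different visits to `y` have different local times at `y`, so the sum over visits becomes a sum
  -- over distinct levels `j`.
  have hinj : Set.InjOn (fun k => localTime x k y) s := by
    intro k hk l hl hkl
    simp only [hsdef, Finset.coe_filter, Finset.mem_range, Set.mem_ofPred_eq] at hk hl
    rcases lt_trichotomy k l with h | h | h
    · exact absurd hkl (localTime_lt x h hl.2.1).ne
    · exact h
    · exact absurd hkl (localTime_lt x h hk.2.1).ne'
  calc ∑ k ∈ s, (w (localTime x k z))⁻¹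
      ≤ ∑ k ∈ s, (w (levelShift w a (localTime x k y)))⁻¹ := by
        refine Finset.sum_le_sum fun k hk => inv_anti₀ (hpos _) (hmono ?_)
        simp only [hsdef, Finset.mem_filter, Finset.mem_range] at hk
        exact levelShift_le hpos hmono hdiv ha (hP k hk.1 hk.2.1 hk.2.2)
    _ = ∑ j ∈ s.image fun k => localTime x k y, (w (levelShift w a j))⁻¹ := by
        rw [Finset.sum_image hinj]
    _ ≤ _ := hs.sum_le_tsum _ fun j _ => (inv_pos.2 (hpos _)).le

/-- The same for the jumps made between two times. -/
lemma jumpSum_sub_le {a : ℝ} (ha : 0 ≤ a) (hs : CriticalSummable w a) {y z : ℤ} {m n : ℕ}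
    (hP : ∀ k, m ≤ k → k < n → x k = y →
      cumWeight w (localTime x k y) + a ≤ cumWeight w (localTime x k z)) :
    jumpSum w x y z n - jumpSum w x y z m ≤ ∑' j, (w (levelShift w a j))⁻¹ := by
  classical
  have hnn : 0 ≤ ∑' j, (w (levelShift w a j))⁻¹ := tsum_nonneg fun j => (inv_pos.2 (hpos _)).le
  rcases le_total n m with h | h
  · linarith [jumpSum_mono (x := x) hpos y z h]
  refine le_trans ?_ (sum_visits_le hpos hmono hdiv ha hs (fun k => m ≤ k) n
    fun k hk hy hm => hP k hm hk hy)
  rw [Finset.sum_filter, jumpSum, jumpSum, ← Finset.sum_range_add_sum_Ico _ h,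
    ← Finset.sum_range_add_sum_Ico _ h, add_sub_cancel_left]
  refine le_trans (Finset.sum_le_sum fun k hk => ?_) (le_add_of_nonneg_left
    (Finset.sum_nonneg fun k _ => by split_ifs <;> simp [(hpos _).le]))
  have := (inv_pos.2 (hpos (localTime x k z))).le
  have hmk := (Finset.mem_Ico.1 hk).1
  split_ifs <;> first | exact le_rfl | exact this | (exfalso; tauto)

omit hmono hdiv in
/-- The sum over the jumps from `y` to `z` dominates a sum over the local time levels of `y`, if all
visits to `y` are followed by a jump to `z` and the local time at `z` is controlled by the one
at `y`. -/
lemma sum_levels_le_jumpSum (hw : Monotone w) {f : ℕ → ℕ} {y z : ℤ} {n₀ n : ℕ} (hn : n₀ ≤ n)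
    (hjump : ∀ k ≥ n₀, x k = y → x (k + 1) = z)
    (hf : ∀ k ≥ n₀, k ≤ n → x k = y → localTime x k z ≤ f (localTime x k y))
    {N : ℕ} (hN : N ≤ localTime x n y - localTime x n₀ y) :
    ∑ j ∈ Finset.range N, (w (f (localTime x n₀ y + 1 + j)))⁻¹ ≤
      jumpSum w x y z (n + 1) - jumpSum w x y z n₀ := by
  induction n, hn using Nat.le_induction generalizing N with
  | base =>
    have : N = 0 := by omega
    subst this
    have := jumpSum_mono (x := x) hpos y z (Nat.le_succ n₀)
    simp at this ⊢; linarith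
  | succ n hn ih =>
    have ih := fun {N} => @ih (fun k hk hkn => hf k hk (by omega)) N
    by_cases hN' : N ≤ localTime x n y - localTime x n₀ y
    · exact (ih hN').trans (by
        have := jumpSum_mono (x := x) hpos y z (Nat.le_succ (n + 1)); simp at this ⊢; linarith)
    · rw [localTime_succ] at hN
      have hxn : x (n + 1) = y := by by_contra h; rw [if_neg h] at hN; exact hN' hN
      rw [if_pos hxn] at hN
      have hle0 : localTime x n₀ y ≤ localTime x n y := localTime_mono x y hn
      obtain ⟨N, rfl⟩ : ∃ N', N = N' + 1 := ⟨N - 1, by omega⟩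
      have h1 := @ih N (by omega)
      rw [Finset.sum_range_succ, jumpSum_succ, if_pos ⟨hxn, hjump _ (by omega) hxn⟩]
      have h2 : localTime x (n + 1) y = localTime x n₀ y + 1 + N := by
        rw [localTime_succ, if_pos hxn]; omega
      have h3 := inv_anti₀ (hpos _) (hw (hf (n + 1) (by omega) le_rfl hxn))
      rw [h2] at h3
      linarith

omit hmono hdiv in
/-- If `y` is visited infinitely often, almost always followed by a jump to `z`, and the local time
at `z` is controlled by the one at `y`, then finiteness of the sum over these jumps forces the
sum over levels to converge. -/
lemma summable_of_finiteJumpSum (hw : Monotone w) {f : ℕ → ℕ} {y z : ℤ}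
    (hy : y ∈ sitesVisitedInfinitelyOften x) (n₀ : ℕ)
    (hjump : ∀ n ≥ n₀, x n = y → x (n + 1) = z)
    (hf : ∀ n ≥ n₀, x n = y → localTime x n z ≤ f (localTime x n y))
    (hfin : FiniteJumpSum w x y z) : Summable fun j => (w (f j))⁻¹ := by
  obtain ⟨C, hC⟩ := hfin
  rw [← summable_nat_add_iff (localTime x n₀ y + 1)]
  refine summable_of_sum_range_le (c := C) (fun j => (inv_pos.2 (hpos _)).le) fun N => ?_
  obtain ⟨n, hn⟩ := (localTime_tendsto x hy).eventually_ge_atTop (localTime x n₀ y + N) |>.and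
    (eventually_ge_atTop n₀) |>.exists
  have h1 := sum_levels_le_jumpSum hpos hw hn.2 hjump (fun k hk _ => hf k hk) (N := N) (by omega)
  have h2 := hC ⟨n + 1, rfl⟩
  have h3 := jumpSum_nonneg (x := x) hpos y z n₀
  simp_rw [add_comm _ (localTime x n₀ y + 1)]
  linarith

end VisitSums

/-! ### Reflection, and the ends of the set of recurrent sites -/

lemma FiniteJumpSum.neg_iff {w : ℕ → ℝ} {x : ℕ → ℤ} {y z : ℤ} :
    FiniteJumpSum w (fun n => -x n) (-y) (-z) ↔ FiniteJumpSum w x y z := by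
  have : jumpSum w (fun n => -x n) (-y) (-z) = jumpSum w x y z := funext (jumpSum_neg w x y z)
  rw [FiniteJumpSum, FiniteJumpSum, this]

/-- The martingales of all sites are bounded above if and only if they are bounded below. -/
def MartDichotomy (w : ℕ → ℝ) (x : ℕ → ℤ) : Prop :=
  ∀ y, BddAbove (Set.range (siteMart w x y)) ↔ BddBelow (Set.range (siteMart w x y))

lemma MartDichotomy.neg {w : ℕ → ℝ} {x : ℕ → ℤ} (hd : MartDichotomy w x) :
    MartDichotomy w (fun n => -x n) := fun y => by
  have : siteMart w (fun n => -x n) y = -siteMart w x (-y) := by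
    funext n
    have := siteMart_neg w x (-y) n
    rwa [neg_neg] at this
  have h2 : Set.range (-siteMart w x (-y)) = -Set.range (siteMart w x (-y)) := by
    ext r; simp [neg_eq_iff_eq_neg]
  rw [this, h2, bddAbove_neg, bddBelow_neg]
  exact (hd (-y)).symm

lemma martDichotomy_of_bounded {w : ℕ → ℝ} {x : ℕ → ℤ} (hb : ∀ y, ∃ K, ∀ n, |siteMart w x y n| ≤ K) :
    MartDichotomy w x := fun y => by
  obtain ⟨K, hK⟩ := hb y
  refine ⟨fun _ => ⟨-K, ?_⟩, fun _ => ⟨K, ?_⟩⟩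
  · rintro _ ⟨n, rfl⟩; exact (abs_le.1 (hK n)).1
  · rintro _ ⟨n, rfl⟩; exact (abs_le.1 (hK n)).2

lemma cumWeight_add_le_mul {w : ℕ → ℝ} (hpos : ∀ n, 0 < w n) (hmono : Monotone w) (m p : ℕ) :
    cumWeight w (m + p) ≤ cumWeight w m + p * (w m)⁻¹ := by
  have h1 : cumWeight w (m + p) - cumWeight w m = ∑ k ∈ Finset.Ico m (m + p), (w k)⁻¹ := by
    rw [Finset.sum_Ico_eq_sub _ (by omega)]; rfl
  have h2 : ∑ k ∈ Finset.Ico m (m + p), (w k)⁻¹ ≤ p • (w m)⁻¹ := by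
    have : p = (Finset.Ico m (m + p)).card := by simp
    nth_rw 2 [this]
    exact Finset.sum_le_card_nsmul _ _ _ fun k hk =>
      inv_anti₀ (hpos _) (hmono (Finset.mem_Ico.1 hk).1)
  rw [nsmul_eq_mul] at h2
  linarith

section Ends

variable {w : ℕ → ℝ} (hpos : ∀ n, 0 < w n) (hdiv : ¬ Summable (fun n => 1 / w n))
  {x : ℕ → ℤ} (hx : IsNearestNeighbor x)

include hpos hdiv hx

omit hx in
lemma cumWeight_localTime_tendsto {y : ℤ} (hy : y ∈ sitesVisitedInfinitelyOften x) :
    Tendsto (fun n => cumWeight w (localTime x n y)) atTop atTop :=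
  (cumWeight_tendsto hpos hdiv).comp (localTime_tendsto x hy)

/-- The two jump sums into `y` add up to `W(Z_n(y))` minus a constant, which tends to infinity. -/
lemma not_finite_both {y : ℤ} (hy : y ∈ sitesVisitedInfinitelyOften x)
    (h1 : FiniteJumpSum w x (y - 1) y) : ¬ FiniteJumpSum w x (y + 1) y := by
  rintro ⟨C, hC⟩
  obtain ⟨C', hC'⟩ := h1
  obtain ⟨n, hn⟩ := ((cumWeight_localTime_tendsto hpos hdiv hy).eventually_gt_atTop
    (cumWeight w (localTime x 0 y) + C' + C)).exists
  have h3 := hC ⟨n, rfl⟩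
  have h4 := hC' ⟨n, rfl⟩
  rw [cumWeight_localTime hx y n] at hn
  linarith

/-- Two rules propagate inwards from the fact that `a - 1` is not recurrent: the jump sums out of a
site converge together, and those into a recurrent site do not both converge. They alternate until
the jump sum from `a + 2` to `a + 3` is seen to diverge, so `a + 3` is recurrent and there are at
least four sites. -/
lemma left_end (hd : MartDichotomy w x) {a b : ℤ} (hab : a ≤ b)
    (h : sitesVisitedInfinitelyOften x = Set.Icc a b) :
    FiniteJumpSum w x (a - 1) a ∧ FiniteJumpSum w x a (a + 1) ∧
      ¬ FiniteJumpSum w x (a + 1) a ∧ ¬ FiniteJumpSum w x (a + 1) (a + 2) ∧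
      ¬ FiniteJumpSum w x (a + 2) (a + 1) ∧ a + 3 ≤ b := by
  have hd' := finiteJumpSum_iff hpos hd
  have ha : a ∈ sitesVisitedInfinitelyOften x := by rw [h]; exact ⟨le_rfl, hab⟩
  have ha1 : a - 1 ∉ sitesVisitedInfinitelyOften x := by rw [h]; simp
  obtain ⟨n₁, hn₁⟩ := localTime_eventually_const x ha1
  have f1 : FiniteJumpSum w x (a - 1) a := FiniteJumpSum.of_finite hpos
    fun hf => ha1 (hf.mono fun n hn => hn.1)
  have f2 : FiniteJumpSum w x a (a - 1) := FiniteJumpSum.of_finite hpos fun hf => by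
    obtain ⟨n, hn, hn'⟩ := frequently_atTop.1 hf n₁
    exact (hn₁ (n + 1) (by omega)).1 hn'.2
  have f3 := (hd' a).2 f2
  have f4 := not_finite_both hpos hdiv hx ha f1
  have f5 : ¬ FiniteJumpSum w x (a + 1) (a + 2) := fun h5 => f4 (by
    have := (hd' (a + 1)).1 (by rwa [show a + 1 + 1 = a + 2 by ring])
    rwa [show a + 1 - 1 = a by ring] at this)
  have ha2 : a + 1 ∈ sitesVisitedInfinitelyOften x := frequently_atTop.2 fun N => by
    obtain ⟨n, hn, hn'⟩ := frequently_atTop.1 ha (max N n₁)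
    have hge := max_le_iff.1 hn
    refine ⟨n + 1, by omega, ?_⟩
    have := (hn₁ (n + 1) (by omega)).1
    rcases hx n with h | h <;> omega
  have f6 : ¬ FiniteJumpSum w x (a + 2) (a + 1) := by
    have := not_finite_both hpos hdiv hx ha2 (by rwa [show a + 1 - 1 = a by ring])
    rwa [show a + 1 + 1 = a + 2 by ring] at this
  have f7 : ¬ FiniteJumpSum w x (a + 2) (a + 2 + 1) := fun h7 => f6 (by
    have := (hd' (a + 2)).1 h7
    rwa [show a + 2 - 1 = a + 1 by ring] at this)
  have hb : a + 3 ∈ sitesVisitedInfinitelyOften x := by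
    by_contra hcon
    refine f7 (FiniteJumpSum.of_finite hpos fun hf => hcon ?_)
    refine frequently_atTop.2 fun N => ?_
    obtain ⟨n, hn, hn'⟩ := frequently_atTop.1 hf N
    exact ⟨n + 1, by omega, by rw [hn'.2]; ring⟩
  rw [h] at hb
  exact ⟨f1, f3, f4, f5, f6, hb.2⟩

omit hpos hdiv hx in
lemma sites_neg_Icc {a b : ℤ} (h : sitesVisitedInfinitelyOften x = Set.Icc a b) :
    sitesVisitedInfinitelyOften (fun n => -x n) = Set.Icc (-b) (-a) := by
  rw [sites_neg, h]; simp

lemma right_end (hd : MartDichotomy w x) {a b : ℤ} (hab : a ≤ b)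
    (h : sitesVisitedInfinitelyOften x = Set.Icc a b) :
    FiniteJumpSum w x (b + 1) b ∧ FiniteJumpSum w x b (b - 1) ∧
      ¬ FiniteJumpSum w x (b - 1) b ∧ ¬ FiniteJumpSum w x (b - 1) (b - 2) ∧
      ¬ FiniteJumpSum w x (b - 2) (b - 1) := by
  have := left_end hpos hdiv hx.neg hd.neg (neg_le_neg hab) (sites_neg_Icc h)
  rw [show -b - 1 = -(b + 1) by ring, show -b + 1 = -(b - 1) by ring,
    show -b + 2 = -(b - 2) by ring] at this
  simp only [FiniteJumpSum.neg_iff] at this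
  exact ⟨this.1, this.2.1, this.2.2.1, this.2.2.2.1, this.2.2.2.2.1⟩

end Ends

/-! ### Localization on four sites forces a convergent critical series -/

section FourSites

variable {w : ℕ → ℝ} (hpos : ∀ n, 0 < w n) (hmono : Monotone w)
  (hdiv : ¬ Summable (fun n => 1 / w n)) {x : ℕ → ℤ} (hx : IsNearestNeighbor x)
  (hd : MartDichotomy w x) {a : ℤ} (h : sitesVisitedInfinitelyOften x = Set.Icc a (a + 3))

include hpos hmono hdiv hx hd h

/-- Up to bounded jump sums, `siteMart` at `a + 1` is `W(Z(a + 2)) - W(Z(a))`. An a priori lower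
bound for this difference becomes an upper bound through the dichotomy; square summability is not
available here. -/
lemma four_sites_difference_le :
    ∃ C, ∀ n, cumWeight w (localTime x n (a + 2)) ≤ cumWeight w (localTime x n a) + C := by
  obtain ⟨f1, f2, -, -, -, -⟩ := left_end hpos hdiv hx hd (by omega) h
  obtain ⟨-, g2, -, -, -⟩ := right_end hpos hdiv hx hd (by omega) h
  rw [show a + 3 - 1 = a + 2 by ring] at g2
  obtain ⟨n₀, hn₀⟩ := eventually_atTop.1 (eventually_mem_Icc hx (by omega) h)
  obtain ⟨C₁, hC₁⟩ := f1
  obtain ⟨C₂, hC₂⟩ := f2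
  obtain ⟨C₃, hC₃⟩ := g2
  have hjump : ∀ k ≥ n₀, x k = a → x (k + 1) = a + 1 := fun k hk hka => by
    have := (hn₀ (k + 1) (by omega)).1
    rcases hx k with h | h <;> omega
  set j₀ := localTime x n₀ a + 1 with hj₀
  -- The lower bound: at a visit to `a` before time `n`, the local time of `a + 1` is at most that
  -- of `a` plus `q + 1`, where `q` is the local time of `a + 2` at time `n`. The convergent jump
  -- sum from `a` to `a + 1` therefore dominates an increment of `W` that starts just above `q` and
  -- ends beyond the local time of `a`.
  have key : ∀ n, cumWeight w (localTime x n a) ≤ cumWeight w (localTime x n (a + 2)) +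
      (C₂ + (j₀ + 1 : ℕ) * (w 0)⁻¹ + cumWeight w (localTime x n₀ a)) := by
    intro n
    have hp : 0 ≤ (j₀ + 1 : ℕ) * (w 0)⁻¹ := by have := hpos 0; positivity
    have hC₂0 : 0 ≤ C₂ := (jumpSum_nonneg hpos _ _ 0).trans (hC₂ ⟨0, rfl⟩)
    rcases le_total n n₀ with hn | hn
    · have h1 := cumWeight_mono hpos (localTime_mono x a hn)
      have h2 := cumWeight_nonneg hpos (localTime x n (a + 2))
      simp only at h1
      linarith
    · set q := localTime x n (a + 2) with hq
      have h1 := sum_levels_le_jumpSum hpos hmono hn hjump (f := fun j => j + q + 1)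
        (N := localTime x n a - localTime x n₀ a) (fun k hk hkn hka => by
          have h2 := localTime_le_neighbors' hx (a + 1) k
          have h3 : localTime x k (a + 2) ≤ q := localTime_mono x _ hkn
          rw [show a + 1 - 1 = a by ring, show a + 1 + 1 = a + 2 by ring] at h2
          omega) le_rfl
      have h2 : ∑ j ∈ Finset.range (localTime x n a - localTime x n₀ a),
          (w (localTime x n₀ a + 1 + j + q + 1))⁻¹ =
          cumWeight w (localTime x n a + 1 + q + 1) - cumWeight w (q + (j₀ + 1)) := by
        have h3 : localTime x n₀ a ≤ localTime x n a := localTime_mono x _ hn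
        rw [cumWeight, cumWeight, ← Finset.sum_Ico_eq_sub _ (by omega), Finset.sum_Ico_eq_sum_range]
        refine Finset.sum_congr (by congr 1; omega) fun j _ => ?_
        congr 2; omega
      rw [h2] at h1
      have h3 := hC₂ ⟨n + 1, rfl⟩
      have h4 := jumpSum_nonneg (x := x) hpos a (a + 1) n₀
      have h5 := cumWeight_add_le_mul hpos hmono q (j₀ + 1)
      have h6 : (w q)⁻¹ ≤ (w 0)⁻¹ := inv_anti₀ (hpos 0) (hmono (Nat.zero_le q))
      have h7 : ((j₀ + 1 : ℕ) : ℝ) * (w q)⁻¹ ≤ (j₀ + 1 : ℕ) * (w 0)⁻¹ := by gcongr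
      have h8 : cumWeight w (localTime x n a) ≤ cumWeight w (localTime x n a + 1 + q + 1) :=
        cumWeight_mono hpos (by omega)
      have h9 := cumWeight_nonneg hpos (localTime x n₀ a)
      linarith
  set K := C₂ + (j₀ + 1 : ℕ) * (w 0)⁻¹ + cumWeight w (localTime x n₀ a)
  have hdec : ∀ n, siteMart w x (a + 1) n = cumWeight w (localTime x n (a + 2)) -
      cumWeight w (localTime x n a) - jumpSum w x (a + 3) (a + 2) n + jumpSum w x (a - 1) a n -
      cumWeight w (localTime x 0 (a + 2)) + cumWeight w (localTime x 0 a) := fun n => by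
    rw [cumWeight_localTime hx a n, cumWeight_localTime hx (a + 2) n, siteMart]
    rw [show a + 1 + 1 = a + 2 by ring, show a + 1 - 1 = a by ring, show a + 2 - 1 = a + 1 by ring,
      show a + 2 + 1 = a + 3 by ring]
    ring
  obtain ⟨B, hB⟩ := (hd (a + 1)).2 ⟨-K - C₃ - cumWeight w (localTime x 0 (a + 2)), by
    rintro _ ⟨n, rfl⟩
    rw [hdec]
    linarith [key n, hC₃ ⟨n, rfl⟩, jumpSum_nonneg (x := x) hpos (a - 1) a n,
      cumWeight_nonneg hpos (localTime x 0 a)]⟩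
  refine ⟨B + C₃ + cumWeight w (localTime x 0 (a + 2)), fun n => ?_⟩
  have h1 := hB ⟨n, rfl⟩
  rw [hdec] at h1
  linarith [hC₃ ⟨n, rfl⟩, jumpSum_nonneg (x := x) hpos (a - 1) a n,
      cumWeight_nonneg hpos (localTime x 0 a)]

/-- Localization on four sites is only possible if some critical series converges. -/
theorem exists_criticalSummable_of_four_sites : ∃ α : ℝ, 0 ≤ α ∧ CriticalSummable w α := by
  obtain ⟨C₁, h1⟩ := four_sites_difference_le hpos hmono hdiv hx hd h
  obtain ⟨C₂, h2⟩ := four_sites_difference_le hpos hmono hdiv hx.neg hd.neg (a := -(a + 3))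
    (by rw [sites_neg_Icc h]; congr 1; ring)
  have h2 : ∀ n, cumWeight w (localTime x n (a + 1)) ≤
      cumWeight w (localTime x n (a + 3)) + C₂ := fun n => by
    have := h2 n
    rwa [show -(a + 3) + 2 = -(a + 1) by ring, localTime_neg, localTime_neg] at this
  obtain ⟨-, f2, -, -, -, -⟩ := left_end hpos hdiv hx hd (by omega) h
  obtain ⟨n₀, hn₀⟩ := eventually_atTop.1 (eventually_mem_Icc hx (by omega) h)
  have hjump : ∀ k ≥ n₀, x k = a → x (k + 1) = a + 1 := fun k hk hka => by
    have := (hn₀ (k + 1) (by omega)).1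
    rcases hx k with h | h <;> omega
  -- Parity: late steps alternate between `{a, a + 2}` and `{a + 1, a + 3}`.
  obtain ⟨p, hp⟩ : ∃ p : ℕ, ∀ n ≥ n₀, localTime x n (a + 1) + localTime x n (a + 3) ≤
      localTime x n a + localTime x n (a + 2) + p + if x n = a ∨ x n = a + 2 then 0 else 1 := by
    refine ⟨localTime x n₀ (a + 1) + localTime x n₀ (a + 3), fun n hn => ?_⟩
    induction n, hn using Nat.le_induction with
    | base => omega
    | succ n hn ih =>
      simp only [localTime_succ]
      have h3 := hn₀ n hn
      have h4 := hn₀ (n + 1) (by omega)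
      rw [Set.mem_Icc] at h3 h4
      rcases hx n with h | h <;> split_ifs at * <;> omega
  set α := max (max C₁ C₂ + (p + 1 : ℕ) * (w 0)⁻¹) 0 with hα
  have hw0 : 0 ≤ (p + 1 : ℕ) * (w 0)⁻¹ := by have := hpos 0; positivity
  have hα1 : C₁ + (p + 1 : ℕ) * (w 0)⁻¹ ≤ α :=
    le_trans (by gcongr; exact le_max_left _ _) (le_max_left _ _)
  have hα2 : C₂ ≤ α := le_trans (le_trans (le_max_right C₁ _) (by linarith)) (le_max_left _ _)
  refine ⟨α, le_max_right _ _, summable_of_finiteJumpSum (f := levelShift w α) hpos hmono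
    (by rw [h]; exact ⟨le_rfl, by omega⟩) n₀ hjump (fun n hn hna => ?_) f2⟩
  rw [le_levelShift_iff hpos hmono hdiv (le_max_right _ _)]
  -- If `a` is the less visited end, parity bounds `a + 1` by `a + 2`, and `h1` leads to `a`.
  -- Otherwise `h2` bounds `a + 1` by `a + 3`, which is visited at most as often as `a`.
  rcases le_total (localTime x n a) (localTime x n (a + 3)) with hle | hle
  · have h3 : localTime x n (a + 1) ≤ localTime x n (a + 2) + (p + 1) := by
      have := hp n hn
      split_ifs at this <;> omega
    have h4 := cumWeight_add_le_mul hpos hmono (localTime x n (a + 2)) (p + 1)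
    have h6 : (w (localTime x n (a + 2)))⁻¹ ≤ (w 0)⁻¹ := inv_anti₀ (hpos 0) (hmono (Nat.zero_le _))
    have h7 : ((p + 1 : ℕ) : ℝ) * (w (localTime x n (a + 2)))⁻¹ ≤ (p + 1 : ℕ) * (w 0)⁻¹ := by gcongr
    linarith [cumWeight_mono hpos h3, h1 n]
  · linarith [cumWeight_mono hpos hle, h2 n]

end FourSites

/-! ### A convergent critical series: at most five sites unless a site is exceptional -/

section Barrier

variable {w : ℕ → ℝ} (hpos : ∀ n, 0 < w n) (hmono : Monotone w)
  (hdiv : ¬ Summable (fun n => 1 / w n)) {x : ℕ → ℤ} {α : ℝ} (hα : 0 ≤ α)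
  (hs : CriticalSummable w α)

include hpos hmono hdiv hα hs

/-- As long as `y + 1` is much more visited than `y - 1`, the site `y` is much more visited than
`y - 1`, or `y - 1` is hardly visited. -/
lemma barrier {y : ℤ} {A C₀ K : ℝ} {t₀ n : ℕ} (hn : t₀ ≤ n) (hA : α ≤ A / 2)
    (hbar : ∀ k, t₀ ≤ k → k ≤ n →
      cumWeight w (localTime x k (y - 1)) + A ≤ cumWeight w (localTime x k (y + 1)))
    (hin : ∀ t, t₀ ≤ t → t ≤ n → cumWeight w (localTime x n (y - 1)) -
      cumWeight w (localTime x t (y - 1)) ≤ C₀ + (jumpSum w x y (y - 1) n - jumpSum w x y (y - 1) t))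
    (hM : ∀ t, t₀ ≤ t → t ≤ n → |siteMart w x y n - siteMart w x y t| ≤ K) :
    cumWeight w (localTime x n (y - 1)) +
        (A / 2 - (C₀ + K + (w 0)⁻¹ + ∑' j, (w (levelShift w α j))⁻¹)) ≤
        cumWeight w (localTime x n y) ∨
      cumWeight w (localTime x n (y - 1)) - cumWeight w (localTime x t₀ (y - 1)) ≤
        C₀ + K + ∑' j, (w (levelShift w α j))⁻¹ := by
  set J := ∑' j, (w (levelShift w α j))⁻¹ with hJ
  -- At a good time `y` is at most `A / 2` behind `y + 1`, hence at least `A / 2` ahead of `y - 1`.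
  -- At bad times `y + 1` leads `y` by at least `α`, so the jumps from `y` to `y + 1` made then
  -- contribute at most `J`.
  set good : ℕ → Prop := fun k => cumWeight w (localTime x k (y + 1)) - A / 2 ≤
    cumWeight w (localTime x k y) with hgood
  have hJb : ∀ s, t₀ ≤ s → (∀ k, s ≤ k → k < n → ¬ good k) →
      jumpSum w x y (y + 1) n - jumpSum w x y (y + 1) s ≤ J := fun s hs0 hb =>
    jumpSum_sub_le hpos hmono hdiv hα hs fun k hk hkn _ => by
      have := hb k hk hkn
      simp only [hgood, not_le] at this
      linarith
  have hM' : ∀ t, t₀ ≤ t → t ≤ n → jumpSum w x y (y - 1) n - jumpSum w x y (y - 1) t ≤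
      K + (jumpSum w x y (y + 1) n - jumpSum w x y (y + 1) t) := fun t h1 h2 => by
    have := (abs_le.1 (hM t h1 h2)).1
    rw [siteMart, siteMart] at this
    linarith
  by_cases hex : ∃ t, t₀ ≤ t ∧ t ≤ n ∧ good t
  · left
    classical
    -- After the last good time the jump sum to `y + 1` grows by at most `J`, apart from the jump at
    -- `t` itself, worth at most `(w 0)⁻¹`. The martingale transfers this bound to the jumps to `y -
    -- 1`, so `y - 1` cannot make up the lead that `y` had at `t`.
    set t := Nat.findGreatest (fun t => t₀ ≤ t ∧ good t) n with ht
    obtain ⟨t', h1, h2, h3⟩ := hex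
    have hspec : t₀ ≤ t ∧ good t := Nat.findGreatest_spec (P := fun t => t₀ ≤ t ∧ good t) h2 ⟨h1, h3⟩
    have htn : t ≤ n := Nat.findGreatest_le n
    have hlast : ∀ k, t + 1 ≤ k → k ≤ n → ¬ good k := fun k hk hkn hg =>
      Nat.findGreatest_is_greatest (P := fun t => t₀ ≤ t ∧ good t) hk hkn ⟨by omega, hg⟩
    have h4 := hJb (t + 1) (by omega) fun k hk hkn => hlast k hk hkn.le
    have h5 : jumpSum w x y (y + 1) (t + 1) ≤ jumpSum w x y (y + 1) t + (w 0)⁻¹ := by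
      rw [jumpSum_succ]
      have h6 : (w (localTime x t (y + 1)))⁻¹ ≤ (w 0)⁻¹ := inv_anti₀ (hpos 0) (hmono (Nat.zero_le _))
      have h7 := inv_pos.2 (hpos 0)
      split_ifs <;> linarith
    have h6 := hin t hspec.1 htn
    have h7 := hM' t hspec.1 htn
    have h8 := hbar t hspec.1 htn
    have h9 := hspec.2
    have h10 := cumWeight_mono hpos (localTime_mono x y htn)
    simp only [hgood] at h9 h10
    linarith
  · right
    push Not at hex
    have h4 := hJb t₀ le_rfl fun k hk hkn => hex k hk hkn.le
    have h6 := hin t₀ le_rfl hn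
    have h7 := hM' t₀ le_rfl hn
    linarith

variable (hx : IsNearestNeighbor x) (hb : ∀ y, ∃ K, ∀ n, |siteMart w x y n| ≤ K)

include hx hb

/-- On the scale `W`, `y + 1` exceeds `y - 1` by `siteMart` at `y` plus the divergent jump sum from
`y + 2`, up to bounded terms. Then `barrier` puts `y` ahead of `y - 1` by `α`, and the critical
series bounds the jumps from `y - 1` to `y`. -/
lemma three_sites {y : ℤ} (hout : y - 1 ∈ sitesVisitedInfinitelyOften x)
    (h0 : FiniteJumpSum w x (y - 2) (y - 1))
    (h4 : ¬ FiniteJumpSum w x (y + 2) (y + 1)) : FiniteJumpSum w x (y - 1) y := by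
  obtain ⟨C₀, hC₀⟩ := h0
  obtain ⟨K, hK⟩ := hb y
  have hK0 : 0 ≤ K := (abs_nonneg _).trans (hK 0)
  have hC₀' : ∀ n, jumpSum w x (y - 2) (y - 1) n ≤ C₀ := fun n => hC₀ ⟨n, rfl⟩
  set J := ∑' j, (w (levelShift w α j))⁻¹ with hJ
  have hJ0 : 0 ≤ J := tsum_nonneg fun j => (inv_pos.2 (hpos _)).le
  have hw0 := inv_pos.2 (hpos 0)
  have hC₀0 : 0 ≤ C₀ := (jumpSum_nonneg hpos _ _ 0).trans (hC₀' 0)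
  set K' := C₀ + 2 * K + (w 0)⁻¹ + J with hK'
  -- With this `A` the first alternative of `barrier` leaves a lead of exactly `α`; the second one
  -- fails once the recurrent site `y - 1` has been visited often enough.
  set A := 2 * (K' + α) with hA
  obtain ⟨n₁, hn₁⟩ : ∃ n₁, ∀ n ≥ n₁,
      cumWeight w (localTime x n (y - 1)) + A ≤ cumWeight w (localTime x n (y + 1)) := by
    have : ∃ n₁, A + C₀ + K + cumWeight w (localTime x 0 (y - 1)) <
        jumpSum w x (y + 2) (y + 1) n₁ := by
      by_contra! hcon
      exact h4 ⟨_, by rintro _ ⟨n, rfl⟩; exact hcon n⟩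
    obtain ⟨n₁, hn₁⟩ := this
    refine ⟨n₁, fun n hn => ?_⟩
    rw [cumWeight_localTime hx (y - 1) n, cumWeight_localTime hx (y + 1) n]
    rw [show y - 1 - 1 = y - 2 by ring, show y - 1 + 1 = y by ring, show y + 1 - 1 = y by ring,
      show y + 1 + 1 = y + 2 by ring]
    have h1 := jumpSum_mono (x := x) hpos (y + 2) (y + 1) hn
    have h2 := (abs_le.1 (hK n)).1
    rw [siteMart] at h2
    linarith [hC₀' n, cumWeight_nonneg hpos (localTime x 0 (y + 1))]
  obtain ⟨n₂, hn₂⟩ := eventually_atTop.1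
    ((cumWeight_localTime_tendsto hpos hdiv hout).eventually_gt_atTop
      (cumWeight w (localTime x n₁ (y - 1)) + (C₀ + 2 * K + J)))
  have hfinal : ∀ n ≥ max n₁ n₂, cumWeight w (localTime x n (y - 1)) + α ≤
      cumWeight w (localTime x n y) := fun n hn => by
    have hge := max_le_iff.1 hn
    rcases barrier hpos hmono hdiv hα hs (y := y) (A := A) (C₀ := C₀) (K := 2 * K) hge.1
      (by linarith) (fun k hk _ => hn₁ k hk) (fun t _ _ => by
        rw [cumWeight_localTime_sub hx, show y - 1 - 1 = y - 2 by ring, show y - 1 + 1 = y by ring]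
        linarith [hC₀' n, jumpSum_nonneg (x := x) hpos (y - 2) (y - 1) t])
      (fun t _ _ => by
        have h1 := abs_le.1 (hK n)
        have h2 := abs_le.1 (hK t)
        rw [abs_le]; constructor <;> linarith) with h | h
    · linarith
    · linarith [hn₂ n hge.2]
  refine FiniteJumpSum.of_le hpos (C := J + jumpSum w x (y - 1) y (max n₁ n₂))
    (n₀ := max n₁ n₂) fun n hn => ?_
  have := jumpSum_sub_le hpos hmono hdiv hα hs (x := x) (y := y - 1) (z := y) (m := max n₁ n₂)
    (n := n) fun k hk _ _ => hfinal k hk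
  linarith

/-- Under a convergent critical series, infinitely many jumps in both directions from an interior
site with a finite jump sum is the only obstruction to localization on at most five sites. -/
theorem at_most_five_sites {a b : ℤ} (hab : a ≤ b)
    (h : sitesVisitedInfinitelyOften x = Set.Icc a b)
    (hU : ∀ c, (∃ᶠ n in atTop, x n = c ∧ x (n + 1) = c + 1) →
      (∃ᶠ n in atTop, x n = c ∧ x (n + 1) = c - 1) → ¬ FiniteJumpSum w x c (c - 1)) :
    b ≤ a + 4 := by
  by_contra! hlt
  have hd := martDichotomy_of_bounded hb
  obtain ⟨-, f2, -, f5, -, -⟩ := left_end hpos hdiv hx hd hab h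
  have hmem : ∀ i : ℤ, 0 ≤ i → i ≤ 5 → a + i ∈ sitesVisitedInfinitelyOften x := fun i h0 h5 => by
    rw [h]; exact ⟨by omega, by omega⟩
  -- A sixth site makes the walk jump infinitely often from `a + 4` to both sides.
  have j1 := (frequently_jump hx (hmem 4 (by omega) (by omega))
    (by rw [add_assoc]; exact hmem 5 (by omega) (by omega))).1
  have j2 := (frequently_jump hx (hmem 3 (by omega) (by omega))
    (by rw [add_assoc]; exact hmem 4 (by omega) (by omega))).2
  have h4 := hU (a + 4) j1 (by
    rwa [show a + 3 + 1 = a + 4 by ring, show a + 3 = a + 4 - 1 by ring] at j2)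
  refine f5 ?_
  have := three_sites hpos hmono hdiv hα hs hx hb (y := a + 2)
    (by rw [show a + 2 - 1 = a + 1 by ring]; exact hmem 1 (by omega) (by omega))
    (by rwa [show a + 2 - 1 = a + 1 by ring, show a + 2 - 2 = a by ring])
    (by rwa [show a + 2 + 2 = a + 4 by ring, show a + 2 + 1 = a + 4 - 1 by ring])
  rwa [show a + 2 - 1 = a + 1 by ring] at this

end Barrier

/-! ### Five sites are balanced if all critical series converge -/

section FiveSites

variable {w : ℕ → ℝ} (hpos : ∀ n, 0 < w n) (hmono : Monotone w)
  (hdiv : ¬ Summable (fun n => 1 / w n)) (hs : ∀ α : ℝ, 0 < α → CriticalSummable w α)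

include hpos hmono hdiv hs

/-- The site `a` is so far behind `a + 2` that it hardly adds to the bound `Z(a + 1) ≤ Z(a) + Z(a +
2) + 1`. So if `a + 1` led `a + 3` by a limit `C > 0`, then `a + 2` would lead `a + 3` by `C / 4`,
and the series at `C / 4` would make the divergent jump sum from `a + 3` to `a + 2` converge. -/
lemma five_sites_limit_nonpos {x : ℕ → ℤ} (hx : IsNearestNeighbor x)
    (hb : ∀ y, ∃ K, ∀ n, |siteMart w x y n| ≤ K) {a : ℤ}
    (h : sitesVisitedInfinitelyOften x = Set.Icc a (a + 4)) {C : ℝ} (hC : Tendsto (fun n =>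
      cumWeight w (localTime x n (a + 1)) - cumWeight w (localTime x n (a + 3))) atTop (nhds C)) :
    C ≤ 0 := by
  by_contra! hC0
  have hd := martDichotomy_of_bounded hb
  obtain ⟨f1, -, -, -, -, -⟩ := left_end hpos hdiv hx hd (by omega) h
  obtain ⟨-, -, -, g4, g5⟩ := right_end hpos hdiv hx hd (by omega) h
  rw [show a + 4 - 1 = a + 3 by ring, show a + 4 - 2 = a + 2 by ring] at g4
  obtain ⟨A, hA0, hA⟩ : ∃ A : ℝ, 0 < A ∧ ∑' j, (w (levelShift w A j))⁻¹ < C / 4 :=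
    ((eventually_gt_atTop 0).and (((hs 1 one_pos).tendsto_tsum hpos hmono hdiv
      zero_le_one).eventually (gt_mem_nhds (by linarith : 0 < C / 4)))).exists
  obtain ⟨K, hK⟩ := hb (a + 1)
  obtain ⟨C₁, hC₁⟩ := f1
  obtain ⟨n₁, hn₁⟩ : ∃ n₁, ∀ n ≥ n₁,
      cumWeight w (localTime x n a) + A ≤ cumWeight w (localTime x n (a + 2)) := by
    have : ∃ n₁, A + C₁ + K + cumWeight w (localTime x 0 a) <
        jumpSum w x (a + 3) (a + 2) n₁ := by
      by_contra! hcon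
      exact g4 ⟨_, by rintro _ ⟨n, rfl⟩; exact hcon n⟩
    obtain ⟨n₁, hn₁⟩ := this
    refine ⟨n₁, fun n hn => ?_⟩
    rw [cumWeight_localTime hx a n, cumWeight_localTime hx (a + 2) n]
    have h1 := jumpSum_mono (x := x) hpos (a + 3) (a + 2) hn
    have h2 := (abs_le.1 (hK n)).1
    have h3 := hC₁ ⟨n, rfl⟩
    rw [siteMart, show a + 1 + 1 = a + 2 by ring, show a + 1 - 1 = a by ring] at h2
    rw [show a + 2 - 1 = a + 1 by ring, show a + 2 + 1 = a + 3 by ring]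
    linarith [cumWeight_nonneg hpos (localTime x 0 (a + 2))]
  obtain ⟨n₂, hn₂⟩ := eventually_atTop.1 (hC.eventually (lt_mem_nhds (by linarith : C / 2 < C)))
  have hfinal : ∀ n ≥ max n₁ n₂, cumWeight w (localTime x n (a + 3)) + C / 4 ≤
      cumWeight w (localTime x n (a + 2)) := fun n hn => by
    have hge := max_le_iff.1 hn
    have h1 := levelShift_le hpos hmono hdiv hA0.le (hn₁ n hge.1)
    set j := localTime x n a with hj
    -- Each of the first `j + 1` terms of the series at `A` is at least the term of index `j`, so `j
    -- + 1` copies of the latter are bounded by the sum.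
    have h2 : ((j + 1 : ℕ) : ℝ) * (w (localTime x n (a + 2)))⁻¹ ≤ C / 4 := by
      calc ((j + 1 : ℕ) : ℝ) * (w (localTime x n (a + 2)))⁻¹
          ≤ ((j + 1 : ℕ) : ℝ) * (w (levelShift w A j))⁻¹ := by
            gcongr
            · exact hpos _
            · exact hmono h1
        _ = ∑ _i ∈ Finset.range (j + 1), (w (levelShift w A j))⁻¹ := by simp
        _ ≤ ∑ i ∈ Finset.range (j + 1), (w (levelShift w A i))⁻¹ :=
            Finset.sum_le_sum fun i hi => inv_anti₀ (hpos _) (hmono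
              (levelShift_mono_right hpos hmono hdiv hA0.le (by
                have := Finset.mem_range.1 hi; omega)))
        _ ≤ ∑' j, (w (levelShift w A j))⁻¹ :=
            (hs A hA0).sum_le_tsum _ fun i _ => (inv_pos.2 (hpos _)).le
        _ ≤ C / 4 := hA.le
    have h3 := localTime_le_neighbors' hx (a + 1) n
    rw [show a + 1 - 1 = a by ring, show a + 1 + 1 = a + 2 by ring] at h3
    have h4 := cumWeight_add_le_mul hpos hmono (localTime x n (a + 2)) (j + 1)
    have h5 : cumWeight w (localTime x n (a + 1)) ≤
        cumWeight w (localTime x n (a + 2) + (j + 1)) := cumWeight_mono hpos (by omega)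
    linarith [hn₂ n hge.2]
  refine g4 (FiniteJumpSum.of_le hpos (n₀ := max n₁ n₂)
    (C := ∑' j, (w (levelShift w (C / 4) j))⁻¹ + jumpSum w x (a + 3) (a + 2) (max n₁ n₂))
    fun n hn => ?_)
  have := jumpSum_sub_le hpos hmono hdiv (by linarith) (hs (C / 4) (by linarith)) (x := x)
    (y := a + 3) (z := a + 2) (m := max n₁ n₂) (n := n) fun k hk _ _ => hfinal k hk
  linarith

/-- If all critical series converge, then localization on five sites forces a perfect balance
between the two neighbours of the central site. -/
theorem five_sites_balanced {x : ℕ → ℤ} (hx : IsNearestNeighbor x)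
    (hc : ∀ y, ∃ l, Tendsto (siteMart w x y) atTop (nhds l))
    (hb : ∀ y, ∃ K, ∀ n, |siteMart w x y n| ≤ K) {a : ℤ}
    (h : sitesVisitedInfinitelyOften x = Set.Icc a (a + 4)) :
    Tendsto (fun n => cumWeight w (localTime x n (a + 1)) - cumWeight w (localTime x n (a + 3)))
      atTop (nhds 0) := by
  have hd := martDichotomy_of_bounded hb
  obtain ⟨-, f2, -, -, -, -⟩ := left_end hpos hdiv hx hd (by omega) h
  obtain ⟨-, g2, -, -, -⟩ := right_end hpos hdiv hx hd (by omega) h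
  rw [show a + 4 - 1 = a + 3 by ring] at g2
  obtain ⟨l, hl⟩ := hc (a + 2)
  have t1 := tendsto_atTop_ciSup (jumpSum_mono (x := x) hpos a (a + 1)) f2
  have t2 := tendsto_atTop_ciSup (jumpSum_mono (x := x) hpos (a + 4) (a + 3)) g2
  have hlim : ∃ C, Tendsto (fun n =>
      cumWeight w (localTime x n (a + 1)) - cumWeight w (localTime x n (a + 3))) atTop (nhds C) := by
    refine ⟨_, (((t1.sub t2).sub hl).add_const (cumWeight w (localTime x 0 (a + 1)) -
      cumWeight w (localTime x 0 (a + 3)))).congr fun n => ?_⟩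
    rw [cumWeight_localTime hx (a + 1) n, cumWeight_localTime hx (a + 3) n, siteMart,
      show a + 1 - 1 = a by ring, show a + 1 + 1 = a + 2 by ring, show a + 3 - 1 = a + 2 by ring,
      show a + 3 + 1 = a + 4 by ring, show a + 2 + 1 = a + 3 by ring,
      show a + 2 - 1 = a + 1 by ring]
    ring
  obtain ⟨C, hC⟩ := hlim
  have h1 := five_sites_limit_nonpos hpos hmono hdiv hs hx hb h hC
  have h2 := five_sites_limit_nonpos hpos hmono hdiv hs hx.neg (fun y => by
      obtain ⟨K, hK⟩ := hb (-y)
      refine ⟨K, fun n => ?_⟩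
      have := siteMart_neg w x (-y) n
      rw [neg_neg] at this
      rw [this, abs_neg]; exact hK n) (a := -(a + 4))
    (by rw [sites_neg_Icc h]; congr 1; ring) (C := -C) (hC.neg.congr fun n => by
      rw [show -(a + 4) + 1 = -(a + 3) by ring, show -(a + 4) + 3 = -(a + 1) by ring,
        localTime_neg, localTime_neg]; ring)
  rwa [show C = 0 by linarith] at hC

end FiveSites

/-! ### Paths driven by clocks, with running alarm clocks at one site -/

/-- The number of jumps from `y` to `z` made before time `n`. -/
def jumpCount (x : ℕ → ℤ) (y z : ℤ) (n : ℕ) : ℕ :=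
  ((Finset.range n).filter fun k => x k = y ∧ x (k + 1) = z).card

/-- The total length of the clocks that rang for the jumps from `y` to `z` made before time `n`:
the `i`-th one has length `f i / w(Z_k(z))`, where `k` is the time of the jump. -/
noncomputable def clockSum (w : ℕ → ℝ) (f : ℕ → ℝ) (x : ℕ → ℤ) (y z : ℤ) (n : ℕ) : ℝ :=
  ∑ k ∈ Finset.range n,
    if x k = y ∧ x (k + 1) = z then f (jumpCount x y z k) * (w (localTime x k z))⁻¹ else 0

/-- The moment at which the current clock for the jump from `y` to `z` rings. -/
noncomputable def alarm (w : ℕ → ℝ) (f : ℕ → ℝ) (x : ℕ → ℤ) (y z : ℤ) (n : ℕ) : ℝ :=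
  clockSum w f x y z n + f (jumpCount x y z n) * (w (localTime x n z))⁻¹

/-- The decision to jump to the left: at the site `c` it is taken by comparing two alarm clocks, at
all other sites by comparing two clocks that are used only once. -/
def GoesLeft (w : ℕ → ℝ) (c : ℤ) (ζ : ℤ × ℕ × Bool → ℝ) (x : ℕ → ℤ) (n : ℕ) : Prop :=
  if x n = c then
    alarm w (fun i => ζ (c, i, false)) x c (c - 1) n ≤ alarm w (fun i => ζ (c, i, true)) x c (c + 1) n
  else
    ζ (x n, localTime x n (x n), false) * (w (localTime x n (x n - 1)))⁻¹ ≤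
      ζ (x n, localTime x n (x n), true) * (w (localTime x n (x n + 1)))⁻¹

/-- The path driven by the clocks `ζ`. -/
structure IsDriven (w : ℕ → ℝ) (c : ℤ) (ζ : ℤ × ℕ × Bool → ℝ) (x : ℕ → ℤ) : Prop where
  start : x 0 = 0
  left : ∀ n, GoesLeft w c ζ x n → x (n + 1) = x n - 1
  right : ∀ n, ¬ GoesLeft w c ζ x n → x (n + 1) = x n + 1

lemma IsDriven.isNearestNeighbor {w : ℕ → ℝ} {c : ℤ} {ζ : ℤ × ℕ × Bool → ℝ} {x : ℕ → ℤ}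
    (h : IsDriven w c ζ x) : IsNearestNeighbor x := fun n => by
  by_cases hg : GoesLeft w c ζ x n
  · exact Or.inr (h.left n hg)
  · exact Or.inl (h.right n hg)

lemma IsDriven.goesLeft_of {w : ℕ → ℝ} {c : ℤ} {ζ : ℤ × ℕ × Bool → ℝ} {x : ℕ → ℤ}
    (h : IsDriven w c ζ x) {n : ℕ} {y : ℤ} (hy : x n = y) (hl : x (n + 1) = y - 1) :
    GoesLeft w c ζ x n := by
  by_contra hg
  have := h.right n hg
  omega

lemma IsDriven.not_goesLeft_of {w : ℕ → ℝ} {c : ℤ} {ζ : ℤ × ℕ × Bool → ℝ} {x : ℕ → ℤ}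
    (h : IsDriven w c ζ x) {n : ℕ} {y : ℤ} (hy : x n = y) (hl : x (n + 1) = y + 1) :
    ¬ GoesLeft w c ζ x n := fun hg => by
  have := h.left n hg
  omega

section Counting

variable {x : ℕ → ℤ}

lemma jumpCount_zero (x : ℕ → ℤ) (y z : ℤ) : jumpCount x y z 0 = 0 := by simp [jumpCount]

lemma jumpCount_succ (x : ℕ → ℤ) (y z : ℤ) (n : ℕ) :
    jumpCount x y z (n + 1) = jumpCount x y z n + if x n = y ∧ x (n + 1) = z then 1 else 0 := by
  rw [jumpCount, Finset.range_add_one, Finset.filter_insert, jumpCount]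
  split_ifs <;> simp

lemma jumpCount_mono (x : ℕ → ℤ) (y z : ℤ) : Monotone (jumpCount x y z) :=
  monotone_nat_of_le_succ fun n => by simp only [jumpCount_succ]; omega

lemma jumpCount_congr {x x' : ℕ → ℤ} {n : ℕ} (h : ∀ k ≤ n, x k = x' k) (y z : ℤ) :
    jumpCount x y z n = jumpCount x' y z n := by
  unfold jumpCount
  congr 1
  refine Finset.filter_congr fun k hk => ?_
  have hk := Finset.mem_range.1 hk
  rw [h k hk.le, h (k + 1) hk]

lemma exists_jump_of_lt {y z : ℤ} {r n : ℕ} (h : r < jumpCount x y z n) :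
    ∃ k < n, x k = y ∧ x (k + 1) = z ∧ jumpCount x y z k = r := by
  induction n with
  | zero => simp [jumpCount_zero] at h
  | succ n ih =>
    by_cases hr : r < jumpCount x y z n
    · obtain ⟨k, hk, h'⟩ := ih hr
      exact ⟨k, by omega, h'⟩
    · rw [jumpCount_succ] at h
      split_ifs at h with hj
      · exact ⟨n, by omega, hj.1, hj.2, by omega⟩
      · omega

lemma exists_visit_of_le {y : ℤ} {m n : ℕ} (hm : 0 < m) (h : m ≤ localTime x n y) :
    ∃ k ≤ n, x k = y ∧ localTime x k y = m := by
  induction n with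
  | zero =>
    rw [localTime_zero] at h
    split_ifs at h with h0
    · exact ⟨0, le_rfl, h0, by rw [localTime_zero, if_pos h0]; omega⟩
    · omega
  | succ n ih =>
    by_cases hr : m ≤ localTime x n y
    · obtain ⟨k, hk, h'⟩ := ih hr
      exact ⟨k, by omega, h'⟩
    · have h' := h
      rw [localTime_succ] at h
      split_ifs at h with hj
      · exact ⟨n + 1, le_rfl, hj, by rw [localTime_succ, if_pos hj]; omega⟩
      · omega

/-- On the `m`-th visit to `y` the path jumps to `z`. -/
def JumpsOnVisit (x : ℕ → ℤ) (y z : ℤ) (m : ℕ) : Prop :=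
  ∃ k, x k = y ∧ localTime x k y = m ∧ x (k + 1) = z

lemma visit_unique {y : ℤ} {k l : ℕ} (hk : x k = y) (hl : x l = y)
    (h : localTime x k y = localTime x l y) : k = l := by
  rcases lt_trichotomy k l with h' | h' | h'
  · exact absurd h (localTime_lt x h' hl).ne
  · exact h'
  · exact absurd h (localTime_lt x h' hk).ne'

open Classical in
-- Jumps become sets of visit numbers, which can be compared between two paths by inclusion. A visit
-- in progress is left out because its jump is still to come.
lemma jumpCount_eq_card (y z : ℤ) (n : ℕ) : jumpCount x y z n =
    ((Finset.Icc 1 (localTime x n y - if x n = y then 1 else 0)).filter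
      (JumpsOnVisit x y z)).card := by
  induction n with
  | zero =>
    have : localTime x 0 y - (if x 0 = y then 1 else 0) = 0 := by rw [localTime_zero]; omega
    rw [this, jumpCount_zero]; simp
  | succ n ih =>
    rw [jumpCount_succ, ih, localTime_succ, Nat.add_sub_cancel]
    by_cases hy : x n = y
    · have hpos := localTime_pos x hy
      rw [if_pos hy]
      obtain ⟨m, hm⟩ : ∃ m, localTime x n y = m + 1 := ⟨localTime x n y - 1, by omega⟩
      rw [hm, Nat.add_sub_cancel, ← Finset.insert_Icc_right_eq_Icc_add_one (by omega),
        Finset.filter_insert]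
      have hiff : JumpsOnVisit x y z (m + 1) ↔ x (n + 1) = z := by
        refine ⟨?_, fun h => ⟨n, hy, hm, h⟩⟩
        rintro ⟨k, h1, h2, h3⟩
        rwa [visit_unique h1 hy (by omega)] at h3
      by_cases hz : x (n + 1) = z
      · rw [if_pos ⟨hy, hz⟩, if_pos (hiff.2 hz), Finset.card_insert_of_notMem (by simp)]
      · rw [if_neg (fun h => hz h.2), if_neg (fun h => hz (hiff.1 h)), add_zero]
    · rw [if_neg hy, if_neg (fun h => hy h.1)]; simp

variable (hx : IsNearestNeighbor x)

include hx

/-- Crossings of an edge alternate in direction, so the two counts differ only through the starting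
and the current position. -/
lemma jumpCount_flow (y : ℤ) (n : ℕ) :
    (jumpCount x y (y + 1) n : ℤ) + (if y + 1 ≤ x 0 then 1 else 0) =
      jumpCount x (y + 1) y n + if y + 1 ≤ x n then 1 else 0 := by
  induction n with
  | zero => simp [jumpCount_zero]
  | succ n ih =>
    simp only [jumpCount_succ]
    push_cast
    rcases hx n with h | h <;> split_ifs at * <;> omega

lemma jumpCount_add (y : ℤ) (n : ℕ) :
    jumpCount x y (y - 1) n + jumpCount x y (y + 1) n + (if x n = y then 1 else 0) =
      localTime x n y := by
  induction n with
  | zero => simp [jumpCount_zero, localTime_zero]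
  | succ n ih =>
    simp only [jumpCount_succ, localTime_succ]
    rcases hx n with h | h <;> split_ifs at * <;> omega

/-- The last exit from `u` before reaching the neighbour `z` leads to `z`. -/
lemma exists_last_exit {u z : ℤ} (hz : z = u + 1 ∨ z = u - 1) {n : ℕ} (hn : x n = z)
    (hv : 0 < localTime x n u) :
    ∃ k < n, x k = u ∧ x (k + 1) = z ∧ localTime x k u = localTime x n u ∧
      ∀ y, jumpCount x u y n = jumpCount x u y (k + 1) := by
  have key : ∀ n, (z = u + 1 ∧ u < x n ∨ z = u - 1 ∧ x n < u) → 0 < localTime x n u →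
      ∃ k < n, x k = u ∧ x (k + 1) = z ∧ localTime x k u = localTime x n u ∧
        ∀ y, jumpCount x u y n = jumpCount x u y (k + 1) := by
    intro n
    induction n with
    | zero => intro h1 h2; rw [localTime_zero] at h2; split_ifs at h2 <;> omega
    | succ n ih =>
      intro h1 h2
      have hne : x (n + 1) ≠ u := by omega
      rw [localTime_succ, if_neg hne, add_zero] at h2 ⊢
      by_cases hu : x n = u
      · exact ⟨n, by omega, hu, by rcases hx n with h | h <;> omega, rfl, fun y => rfl⟩
      · obtain ⟨k, hk, h3, h4, h5, h6⟩ := ih (by rcases hx n with h | h <;> omega) h2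
        refine ⟨k, by omega, h3, h4, h5, fun y => ?_⟩
        rw [jumpCount_succ, if_neg (fun h => hu h.1), add_zero, h6]
  exact key n (by omega) hv

/-- Between two visits to `c` without jumps to `z` the site `z` is not visited. -/
lemma localTime_eq_of_jumpCount_eq {c z : ℤ} (hz : z = c + 1 ∨ z = c - 1) {m n : ℕ} (hmn : m ≤ n)
    (hm : x m = c) (h : jumpCount x c z m = jumpCount x c z n) :
    localTime x m z = localTime x n z := by
  have key : ∀ k, m ≤ k → k ≤ n → (z = c + 1 ∧ x k ≤ c ∨ z = c - 1 ∧ c ≤ x k) ∧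
      localTime x m z = localTime x k z := by
    intro k hk
    induction k, hk using Nat.le_induction with
    | base => intro _; exact ⟨by omega, rfl⟩
    | succ k hk ih =>
      intro hkn
      obtain ⟨h1, h2⟩ := ih (by omega)
      have h3 : ¬ (x k = c ∧ x (k + 1) = z) := fun h4 => by
        have h5 := jumpCount_mono x c z hk
        have h6 := jumpCount_mono x c z hkn
        rw [jumpCount_succ, if_pos h4] at h6
        omega
      have h4 : x (k + 1) ≠ z := by rcases hx k with h' | h' <;> omega
      rw [localTime_succ, if_neg h4, add_zero]
      exact ⟨by rcases hx k with h' | h' <;> omega, h2⟩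
  exact (key n hmn le_rfl).2

omit hx in
-- All jumps of `p` from `u` to `z` occur on the same visit numbers for `q`, and the last exit of
-- `q` from `u` is one more jump to `z`.
lemma jumpCount_lt_of_visits {p q : ℕ → ℤ} (hq : IsNearestNeighbor q) {u z : ℤ}
    (hz : z = u + 1 ∨ z = u - 1) {s t : ℕ} (hs : p s ≠ u) (ht : q t = z)
    (hlt : localTime p s u < localTime q t u)
    (hpw : ∀ m, 0 < m → m ≤ localTime p s u → JumpsOnVisit p u z m → JumpsOnVisit q u z m) :
    jumpCount p u z s < jumpCount q u z t := by
  classical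
  rw [jumpCount_eq_card, jumpCount_eq_card, if_neg hs, if_neg (by omega), Nat.sub_zero, Nat.sub_zero]
  obtain ⟨k, -, h1, h2, h3, -⟩ := exists_last_exit hq hz ht (by omega)
  apply Finset.card_lt_card
  rw [Finset.ssubset_iff_of_subset]
  · refine ⟨localTime q t u, ?_, ?_⟩
    · simp only [Finset.mem_filter, Finset.mem_Icc]
      exact ⟨⟨by omega, le_rfl⟩, k, h1, h3, h2⟩
    · simp only [Finset.mem_filter, Finset.mem_Icc]
      omega
  · intro m hm
    simp only [Finset.mem_filter, Finset.mem_Icc] at hm ⊢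
    exact ⟨⟨hm.1.1, by omega⟩, hpw m hm.1.1 hm.1.2 hm.2⟩

end Counting

section Alarm

variable {w : ℕ → ℝ} (hpos : ∀ n, 0 < w n) {f : ℕ → ℝ} {x : ℕ → ℤ} (hx : IsNearestNeighbor x)
  {c z : ℤ} (hz : z = c + 1 ∨ z = c - 1)

lemma clockSum_succ (w f : ℕ → ℝ) (x : ℕ → ℤ) (y z : ℤ) (n : ℕ) :
    clockSum w f x y z (n + 1) = clockSum w f x y z n +
      if x n = y ∧ x (n + 1) = z then f (jumpCount x y z n) * (w (localTime x n z))⁻¹ else 0 := by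
  simp [clockSum, Finset.sum_range_succ]

lemma clockSum_eq_of_jumpCount_eq {y z : ℤ} {m n : ℕ} (hmn : m ≤ n)
    (h : jumpCount x y z m = jumpCount x y z n) : clockSum w f x y z m = clockSum w f x y z n := by
  induction n, hmn using Nat.le_induction with
  | base => rfl
  | succ n hmn ih =>
    have h1 := jumpCount_mono x y z hmn
    rw [jumpCount_succ] at h
    have h2 : ¬ (x n = y ∧ x (n + 1) = z) := fun h2 => by rw [if_pos h2] at h; omega
    rw [if_neg h2] at h
    rw [clockSum_succ, if_neg h2, add_zero, ih h]

include hx hz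

/-- Between two visits to `c` without a jump to `z`, the site `z` is not visited, so the scale of
its pending clock does not change. At visits to `c` an alarm thus depends only on the number of
earlier jumps. -/
lemma alarm_eq_of_jumpCount_eq {m n : ℕ} (hm : x m = c) (hn : x n = c)
    (h : jumpCount x c z m = jumpCount x c z n) : alarm w f x c z m = alarm w f x c z n := by
  wlog hmn : m ≤ n generalizing m n
  · exact (this hn hm h.symm (by omega)).symm
  rw [alarm, alarm, clockSum_eq_of_jumpCount_eq hmn h, h, localTime_eq_of_jumpCount_eq hx hz hmn hm h]

/-- The recursion for the successive alarms. -/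
lemma alarm_succ {m n : ℕ} (hm : x m = c)
    (h : jumpCount x c z n = jumpCount x c z m + 1) :
    alarm w f x c z n = alarm w f x c z m + f (jumpCount x c z n) * (w (localTime x n z))⁻¹ := by
  obtain ⟨k, hk, h1, h2, h3⟩ := exists_jump_of_lt (show jumpCount x c z m < jumpCount x c z n by omega)
  rw [alarm_eq_of_jumpCount_eq hx hz hm h1 h3.symm]
  nth_rw 1 [alarm]
  rw [← clockSum_eq_of_jumpCount_eq (m := k + 1) (by omega)
    (by rw [jumpCount_succ, if_pos ⟨h1, h2⟩]; omega), clockSum_succ, if_pos ⟨h1, h2⟩, alarm]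

include hpos

lemma alarm_mono (hf : ∀ i, 0 ≤ f i) {m n : ℕ} (hm : x m = c) (hn : x n = c)
    (h : jumpCount x c z m ≤ jumpCount x c z n) : alarm w f x c z m ≤ alarm w f x c z n := by
  obtain ⟨d, hd⟩ := Nat.exists_eq_add_of_le h
  clear h
  induction d generalizing n with
  | zero => exact (alarm_eq_of_jumpCount_eq hx hz hm hn (by omega)).le
  | succ d ih =>
    obtain ⟨k, hk, h1, h2, h3⟩ := exists_jump_of_lt
      (show jumpCount x c z m + d < jumpCount x c z n by omega)
    rw [alarm_succ (n := n) hx hz h1 (by omega)]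
    have := mul_nonneg (hf (jumpCount x c z n)) (inv_pos.2 (hpos (localTime x n z))).le
    linarith [ih h1 h3]

end Alarm

/-! ### Monotone coupling of two paths that differ in one clock -/

section Comparison

variable {w : ℕ → ℝ} (hpos : ∀ n, 0 < w n) (hmono : Monotone w) {c : ℤ}
  {ζ ζ' : ℤ × ℕ × Bool → ℝ} (hζ : ∀ i, 0 ≤ ζ i) (hζ' : ∀ i, i ≠ (c, 0, false) → ζ i = ζ' i)
  (hlt : ζ (c, 0, false) ≤ ζ' (c, 0, false))
  {x x' : ℕ → ℤ} (hx : IsDriven w c ζ x) (hx' : IsDriven w c ζ' x')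

/-- At time `s` the path `x` is further to the left than the path `x'` at all comparable times. -/
def DominatedAt (c : ℤ) (x x' : ℕ → ℤ) (s : ℕ) : Prop := ∀ t,
  (∀ y ≠ c, x s = y → x' t = y → localTime x s y = localTime x' t y →
    localTime x' t (y - 1) ≤ localTime x s (y - 1) ∧
    localTime x s (y + 1) ≤ localTime x' t (y + 1)) ∧
  (x s = c → x' t = c → jumpCount x c (c - 1) s = jumpCount x' c (c - 1) t →
    localTime x' t (c - 1) ≤ localTime x s (c - 1)) ∧
  (x s = c → x' t = c → jumpCount x c (c + 1) s = jumpCount x' c (c + 1) t →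
    localTime x s (c + 1) ≤ localTime x' t (c + 1))

include hpos hmono hζ hζ' hx hx'

/-- Both paths read the same clocks on the `m`-th visit to `y`. Domination shortens the scaled left
clock of `x` and lengthens its right one, so `x` goes left whenever `x'` does. The indicators ensure
that the jump on this visit has already been made. -/
lemma jumpsOnVisit_of_dominated {s : ℕ} (hdom : ∀ s' < s, DominatedAt c x x' s') {y : ℤ}
    (hy : y ≠ c) {m t : ℕ} (hm0 : 0 < m) (hms : m + (if x s = y then 1 else 0) ≤ localTime x s y)
    (hmt : m + (if x' t = y then 1 else 0) ≤ localTime x' t y) :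
    (JumpsOnVisit x' y (y - 1) m → JumpsOnVisit x y (y - 1) m) ∧
      (JumpsOnVisit x y (y + 1) m → JumpsOnVisit x' y (y + 1) m) := by
  obtain ⟨k, hk, h1, h2⟩ := exists_visit_of_le hm0 (show m ≤ localTime x s y by omega)
  obtain ⟨l, hl, h3, h4⟩ := exists_visit_of_le hm0 (show m ≤ localTime x' t y by omega)
  have hks : k < s := lt_of_le_of_ne hk fun h => by subst h; rw [if_pos h1] at hms; omega
  obtain ⟨h5, h6⟩ := ((hdom k hks) l).1 y hy h1 h3 (by omega)
  have himp : GoesLeft w c ζ' x' l → GoesLeft w c ζ x k := by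
    rw [GoesLeft, GoesLeft, if_neg (by rw [h3]; exact hy), if_neg (by rw [h1]; exact hy), h1, h3,
      h2, h4, hζ' _ (by simp [hy]), hζ' _ (by simp [hy])]
    intro h
    have h7 := inv_anti₀ (hpos _) (hmono h5)
    have h8 := inv_anti₀ (hpos _) (hmono h6)
    have h9 : 0 ≤ ζ' (y, m, false) := by rw [← hζ' _ (by simp [hy])]; exact hζ _
    have h10 : 0 ≤ ζ' (y, m, true) := by rw [← hζ' _ (by simp [hy])]; exact hζ _
    exact (mul_le_mul_of_nonneg_left h7 h9).trans (h.trans (mul_le_mul_of_nonneg_left h8 h10))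
  constructor
  · rintro ⟨l', h7, h8, h9⟩
    obtain rfl := visit_unique h7 h3 (by omega)
    exact ⟨k, h1, h2, by rw [hx.left k (himp (hx'.goesLeft_of h3 h9)), h1]⟩
  · rintro ⟨k', h7, h8, h9⟩
    obtain rfl := visit_unique h7 h1 (by omega)
    exact ⟨l, h3, h4, by rw [hx'.right l (fun h => hx.not_goesLeft_of h1 h9 (himp h)), h3]⟩

include hlt

/-- Comparison of the alarms for the jumps to the left, including the gap coming from the first
clock. -/
lemma alarm_left_le {s : ℕ} (hdom : ∀ s' ≤ s, DominatedAt c x x' s') {t t₀ : ℕ} (hs : x s = c)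
    (ht : x' t = c) (h : jumpCount x c (c - 1) s = jumpCount x' c (c - 1) t)
    (ht₀ : x' t₀ = c) (h0 : jumpCount x' c (c - 1) t₀ = 0) :
    alarm w (fun i => ζ (c, i, false)) x c (c - 1) s +
      (ζ' (c, 0, false) - ζ (c, 0, false)) * (w (localTime x' t₀ (c - 1)))⁻¹ ≤
      alarm w (fun i => ζ' (c, i, false)) x' c (c - 1) t := by
  have hle : ∀ i, ζ (c, i, false) ≤ ζ' (c, i, false) := fun i => by
    rcases Nat.eq_zero_or_pos i with rfl | hi
    · exact hlt
    · exact (hζ' _ (by simp; omega)).le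
  have hnn := hx.isNearestNeighbor
  have hnn' := hx'.isNearestNeighbor
  obtain ⟨d, hd⟩ : ∃ d, d = jumpCount x c (c - 1) s := ⟨_, rfl⟩
  induction d generalizing s t with
  | zero =>
    have h1 := ((hdom s le_rfl) t).2.1 hs ht h
    rw [← alarm_eq_of_jumpCount_eq hnn' (Or.inr rfl) ht₀ ht (by omega), alarm, alarm, h0, ← hd]
    have h2 : clockSum w (fun i => ζ (c, i, false)) x c (c - 1) s = 0 := by
      rw [← clockSum_eq_of_jumpCount_eq (m := 0) (Nat.zero_le s) (by rw [jumpCount_zero]; omega)]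
      simp [clockSum]
    have h3 : clockSum w (fun i => ζ' (c, i, false)) x' c (c - 1) t₀ = 0 := by
      rw [← clockSum_eq_of_jumpCount_eq (m := 0) (Nat.zero_le t₀) (by rw [jumpCount_zero]; omega)]
      simp [clockSum]
    -- Until the first left jump from `c`, all visits to `c` see the same local time of `c - 1`, so
    -- the gap does not depend on `t`.
    have h4 : localTime x' t (c - 1) = localTime x' t₀ (c - 1) := by
      rcases le_total t t₀ with h' | h'
      · exact localTime_eq_of_jumpCount_eq hnn' (Or.inr rfl) h' ht (by omega)
      · exact (localTime_eq_of_jumpCount_eq hnn' (Or.inr rfl) h' ht₀ (by omega)).symm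
    rw [h4] at h1
    rw [h2, h3]
    have h5 := mul_le_mul_of_nonneg_left (inv_anti₀ (hpos _) (hmono h1)) (hζ (c, 0, false))
    linarith
  | succ d ih =>
    obtain ⟨k, hk, h1, h2, h3⟩ := exists_jump_of_lt (show d < jumpCount x c (c - 1) s by omega)
    obtain ⟨l, hl, h4, h5, h6⟩ := exists_jump_of_lt (show d < jumpCount x' c (c - 1) t by omega)
    rw [alarm_succ (n := s) hnn (Or.inr rfl) h1 (by omega), alarm_succ (n := t) hnn' (Or.inr rfl) h4 (by omega)]
    have h7 := ih (fun s' hs' => hdom s' (by omega)) h1 h4 (by omega) h3.symm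
    have h8 := ((hdom s le_rfl) t).2.1 hs ht h
    have h9 : ζ (c, jumpCount x c (c - 1) s, false) * (w (localTime x s (c - 1)))⁻¹ ≤
        ζ' (c, jumpCount x' c (c - 1) t, false) * (w (localTime x' t (c - 1)))⁻¹ := by
      rw [h]
      exact mul_le_mul (hle _) (inv_anti₀ (hpos _) (hmono h8)) (inv_pos.2 (hpos _)).le
        ((hζ _).trans (hle _))
    linarith

lemma alarm_left_le' {s : ℕ} (hdom : ∀ s' ≤ s, DominatedAt c x x' s') {t : ℕ} (hs : x s = c)
    (ht : x' t = c) (h : jumpCount x c (c - 1) s = jumpCount x' c (c - 1) t) :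
    alarm w (fun i => ζ (c, i, false)) x c (c - 1) s ≤
      alarm w (fun i => ζ' (c, i, false)) x' c (c - 1) t := by
  obtain ⟨t₀, ht₀, h0⟩ : ∃ t₀, x' t₀ = c ∧ jumpCount x' c (c - 1) t₀ = 0 := by
    rcases Nat.eq_zero_or_pos (jumpCount x' c (c - 1) t) with h0 | h0
    · exact ⟨t, ht, h0⟩
    · obtain ⟨k, -, h1, -, h2⟩ := exists_jump_of_lt h0
      exact ⟨k, h1, h2⟩
  have h1 := alarm_left_le hpos hmono hζ hζ' hlt hx hx' hdom hs ht h ht₀ h0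
  have h2 := mul_nonneg (sub_nonneg.2 hlt) (inv_pos.2 (hpos (localTime x' t₀ (c - 1)))).le
  linarith

omit hlt in
-- The right clocks at `c` are shared, while `x` has visited `c + 1` less often at equal jump
-- counts, so each of its increments is at least as long.
lemma alarm_right_le {s : ℕ} (hdom : ∀ s' ≤ s, DominatedAt c x x' s') {t : ℕ} (hs : x s = c)
    (ht : x' t = c) (h : jumpCount x c (c + 1) s = jumpCount x' c (c + 1) t) :
    alarm w (fun i => ζ' (c, i, true)) x' c (c + 1) t ≤
      alarm w (fun i => ζ (c, i, true)) x c (c + 1) s := by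
  have heq : (fun i => ζ' (c, i, true)) = fun i => ζ (c, i, true) :=
    funext fun i => (hζ' _ (by simp)).symm
  have hnn := hx.isNearestNeighbor
  have hnn' := hx'.isNearestNeighbor
  rw [heq]
  obtain ⟨d, hd⟩ : ∃ d, d = jumpCount x c (c + 1) s := ⟨_, rfl⟩
  induction d generalizing s t with
  | zero =>
    have h1 := ((hdom s le_rfl) t).2.2 hs ht h
    rw [alarm, alarm, ← clockSum_eq_of_jumpCount_eq (m := 0) (Nat.zero_le s)
      (by rw [jumpCount_zero]; omega), ← clockSum_eq_of_jumpCount_eq (m := 0) (Nat.zero_le t)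
      (by rw [jumpCount_zero]; omega), ← h]
    have h5 := mul_le_mul_of_nonneg_left (inv_anti₀ (hpos _) (hmono h1))
      (hζ (c, jumpCount x c (c + 1) s, true))
    simpa [clockSum] using h5
  | succ d ih =>
    obtain ⟨k, hk, h1, h2, h3⟩ := exists_jump_of_lt (show d < jumpCount x c (c + 1) s by omega)
    obtain ⟨l, hl, h4, h5, h6⟩ := exists_jump_of_lt (show d < jumpCount x' c (c + 1) t by omega)
    rw [alarm_succ (n := s) hnn (Or.inl rfl) h1 (by omega), alarm_succ (n := t) hnn' (Or.inl rfl) h4 (by omega)]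
    have h7 := ih (fun s' hs' => hdom s' (by omega)) h1 h4 (by omega) h3.symm
    have h8 := ((hdom s le_rfl) t).2.2 hs ht h
    have h9 := mul_le_mul_of_nonneg_left (inv_anti₀ (hpos _) (hmono h8))
      (hζ (c, jumpCount x c (c + 1) s, true))
    rw [← h]
    linarith

/-- Too many visits of `x'` to `c` would mean extra left jumps there. Matching a right jump of `x`
with one of `x'` of equal index, and a left jump of `x'` with a left alarm of `x`, then gives a
strict cycle: right alarm of `x`, its left alarm, left and right alarm of `x'`, and back to the
right alarm of `x`. -/
lemma center_le_of_right {s : ℕ} (hdom : ∀ s' < s, DominatedAt c x x' s') {t : ℕ}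
    (hs : x s = c + 1) (ht : x' t = c + 1)
    (h : jumpCount x' c (c + 1) t ≤ jumpCount x c (c + 1) s) :
    localTime x' t c ≤ localTime x s c := by
  have hnn := hx.isNearestNeighbor
  have hnn' := hx'.isNearestNeighbor
  by_contra! hcon
  have e1 := jumpCount_add hnn c s
  have e2 := jumpCount_add hnn' c t
  rw [if_neg (by omega)] at e1 e2
  obtain ⟨t', ht', h1, h2, -, h3⟩ := exists_last_exit hnn' (Or.inl rfl) ht (by omega)
  have h3l := h3 (c - 1)
  have h3r := h3 (c + 1)
  rw [jumpCount_succ, if_neg (by omega), add_zero] at h3l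
  rw [jumpCount_succ, if_pos ⟨h1, h2⟩] at h3r
  obtain ⟨s', hs', h4, h5, h6⟩ := exists_jump_of_lt
    (show jumpCount x' c (c + 1) t' < jumpCount x c (c + 1) s by omega)
  have h7 := jumpCount_mono x c (c - 1) hs'.le
  obtain ⟨t'', ht'', h8, h9, h10⟩ := exists_jump_of_lt
    (show jumpCount x c (c - 1) s' < jumpCount x' c (c - 1) t' by omega)
  have hA := hx.not_goesLeft_of h4 h5
  have hB := hx'.goesLeft_of h8 h9
  rw [GoesLeft, if_pos h4, not_le] at hA
  rw [GoesLeft, if_pos h8] at hB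
  have hd : ∀ r ≤ s', DominatedAt c x x' r := fun r hr => hdom r (by omega)
  have i1 := alarm_left_le' hpos hmono hζ hζ' hlt hx hx' hd h4 h8 h10.symm
  have i2 := alarm_right_le hpos hmono hζ hζ' hx hx' hd h4 h1 h6
  have i3 := alarm_mono hpos hnn' (Or.inl rfl) (f := fun i => ζ' (c, i, true))
    (fun i => by rw [← hζ' _ (by simp)]; exact hζ _) h8 h1 (jumpCount_mono x' c (c + 1) ht''.le)
  linarith

lemma center_le_of_left {s : ℕ} (hdom : ∀ s' < s, DominatedAt c x x' s') {t : ℕ}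
    (hs : x s = c - 1) (ht : x' t = c - 1)
    (h : jumpCount x c (c - 1) s ≤ jumpCount x' c (c - 1) t) :
    localTime x s c ≤ localTime x' t c := by
  have hnn := hx.isNearestNeighbor
  have hnn' := hx'.isNearestNeighbor
  by_contra! hcon
  have e1 := jumpCount_add hnn c s
  have e2 := jumpCount_add hnn' c t
  rw [if_neg (by omega)] at e1 e2
  obtain ⟨s', hs', h1, h2, -, h3⟩ := exists_last_exit hnn (Or.inr rfl) hs (by omega)
  have h3l := h3 (c - 1)
  have h3r := h3 (c + 1)
  rw [jumpCount_succ, if_pos ⟨h1, h2⟩] at h3l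
  rw [jumpCount_succ, if_neg (by omega), add_zero] at h3r
  obtain ⟨t', ht', h4, h5, h6⟩ := exists_jump_of_lt
    (show jumpCount x c (c - 1) s' < jumpCount x' c (c - 1) t by omega)
  have h7 := jumpCount_mono x' c (c + 1) ht'.le
  obtain ⟨s'', hs'', h8, h9, h10⟩ := exists_jump_of_lt
    (show jumpCount x' c (c + 1) t' < jumpCount x c (c + 1) s' by omega)
  have hA := hx.not_goesLeft_of h8 h9
  have hB := hx'.goesLeft_of h4 h5
  rw [GoesLeft, if_pos h8, not_le] at hA
  rw [GoesLeft, if_pos h4] at hB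
  have i1 := alarm_left_le' hpos hmono hζ hζ' hlt hx hx' (fun r hr => hdom r (by omega)) h1 h4 h6.symm
  have i2 := alarm_right_le hpos hmono hζ hζ' hx hx' (fun r hr => hdom r (by omega)) h8 h4 h10
  have i3 := alarm_mono hpos hnn (Or.inr rfl) (f := fun i => ζ (c, i, false))
    (fun i => hζ _) h8 h1 (jumpCount_mono x c (c - 1) hs''.le)
  linarith

/-- Strong induction along `x`. At equal visit numbers the decisions already compared order the
jumps out of `y`; `jumpCount_flow` turns this into an order for the jumps into `y` from its
neighbours. A wrong order of local times at a neighbour would give strictly too many such jumps. If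
that neighbour is `c`, the alarms take the place of the one-visit clocks. -/
theorem dominatedAt (s : ℕ) : DominatedAt c x x' s := by
  classical
  induction s using Nat.strong_induction_on with
  | _ s hdom =>
  have hnn := hx.isNearestNeighbor
  have hnn' := hx'.isNearestNeighbor
  intro t
  have left_nbr : ∀ u ≠ c, x s = u + 1 → x' t = u + 1 →
      jumpCount x' u (u + 1) t ≤ jumpCount x u (u + 1) s →
      localTime x' t u ≤ localTime x s u := fun u hu hs ht h => by
    by_contra! hcon
    refine absurd h (not_le.2 (jumpCount_lt_of_visits hnn' (Or.inl rfl) (by omega) ht hcon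
      fun m hm0 hm => ?_))
    exact (jumpsOnVisit_of_dominated hpos hmono hζ hζ' hx hx' hdom hu hm0
      (by rw [if_neg (by omega)]; exact hm) (t := t) (by rw [if_neg (by omega)]; omega)).2
  have right_nbr : ∀ u ≠ c, x s = u - 1 → x' t = u - 1 →
      jumpCount x u (u - 1) s ≤ jumpCount x' u (u - 1) t →
      localTime x s u ≤ localTime x' t u := fun u hu hs ht h => by
    by_contra! hcon
    refine absurd h (not_le.2 (jumpCount_lt_of_visits hnn (Or.inr rfl) (by omega) hs hcon
      fun m hm0 hm => ?_))
    exact (jumpsOnVisit_of_dominated hpos hmono hζ hζ' hx hx' hdom hu hm0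
      (by rw [if_neg (by omega)]; omega) (t := t) (by rw [if_neg (by omega)]; exact hm)).1
  have s0 := hx.start
  have s0' := hx'.start
  have flowL : ∀ y, x s = y → x' t = y → jumpCount x' y (y - 1) t ≤ jumpCount x y (y - 1) s →
      jumpCount x' (y - 1) (y - 1 + 1) t ≤ jumpCount x (y - 1) (y - 1 + 1) s := fun y hs ht h => by
    have f1 := jumpCount_flow hnn (y - 1) s
    have f2 := jumpCount_flow hnn' (y - 1) t
    rw [hs, s0] at f1
    rw [ht, s0'] at f2
    rw [sub_add_cancel] at f1 f2 ⊢
    omega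
  have flowR : ∀ y, x s = y → x' t = y → jumpCount x y (y + 1) s ≤ jumpCount x' y (y + 1) t →
      jumpCount x (y + 1) (y + 1 - 1) s ≤ jumpCount x' (y + 1) (y + 1 - 1) t := fun y hs ht h => by
    have f1 := jumpCount_flow hnn y s
    have f2 := jumpCount_flow hnn' y t
    rw [hs, s0] at f1
    rw [ht, s0'] at f2
    rw [add_sub_cancel_right]
    omega
  refine ⟨fun y hy hs ht hm => ?_, fun hs ht h => ?_, fun hs ht h => ?_⟩
  · have hL : jumpCount x' y (y - 1) t ≤ jumpCount x y (y - 1) s := by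
      rw [jumpCount_eq_card, jumpCount_eq_card, if_pos hs, if_pos ht, hm]
      refine Finset.card_le_card fun m hmem => ?_
      simp only [Finset.mem_filter, Finset.mem_Icc] at hmem ⊢
      exact ⟨hmem.1, (jumpsOnVisit_of_dominated hpos hmono hζ hζ' hx hx' hdom hy hmem.1.1
        (by rw [if_pos hs]; omega) (t := t) (by rw [if_pos ht]; omega)).1 hmem.2⟩
    have hR : jumpCount x y (y + 1) s ≤ jumpCount x' y (y + 1) t := by
      have e1 := jumpCount_add hnn y s
      have e2 := jumpCount_add hnn' y t
      rw [if_pos hs] at e1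
      rw [if_pos ht] at e2
      omega
    have hL' := flowL y hs ht hL
    have hR' := flowR y hs ht hR
    constructor
    · by_cases hc : y - 1 = c
      · rw [hc] at hL' ⊢
        exact center_le_of_right hpos hmono hζ hζ' hlt hx hx' hdom (by omega) (by omega) hL'
      · exact left_nbr (y - 1) hc (by omega) (by omega) hL'
    · by_cases hc : y + 1 = c
      · rw [hc] at hR' ⊢
        exact center_le_of_left hpos hmono hζ hζ' hlt hx hx' hdom (by omega) (by omega) hR'
      · exact right_nbr (y + 1) hc (by omega) (by omega) hR'
  · exact left_nbr (c - 1) (by omega) (by omega) (by omega) (flowL c hs ht h.symm.le)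
  · exact right_nbr (c + 1) (by omega) (by omega) (by omega) (flowR c hs ht h.le)

end Comparison

/-! ### Alarms are controlled by jump sums -/

section Abel

variable {w : ℕ → ℝ} (hpos : ∀ n, 0 < w n) (hmono : Monotone w) {f : ℕ → ℝ} {C : ℝ}
  (hf : ∀ I, ∑ i ∈ Finset.range I, (f i - 2) ≤ C)

include hpos hmono hf

/-- Abel summation: the weights `1 / w(Z(z))` are non-increasing in time and multiply a nonnegative
slack, so the left side never grows. The number `2` stands for any constant above the mean `1` of
the clocks. -/
lemma clockSum_le (x : ℕ → ℤ) (y z : ℤ) (n : ℕ) :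
    clockSum w f x y z n - 2 * jumpSum w x y z n +
      (C - ∑ i ∈ Finset.range (jumpCount x y z n), (f i - 2)) * (w (localTime x n z))⁻¹ ≤
      C * (w 0)⁻¹ := by
  have hC : 0 ≤ C := by simpa using hf 0
  induction n with
  | zero =>
    have h1 : (w (localTime x 0 z))⁻¹ ≤ (w 0)⁻¹ := inv_anti₀ (hpos 0) (hmono (Nat.zero_le _))
    simpa [clockSum, jumpSum, jumpCount_zero] using mul_le_mul_of_nonneg_left h1 hC
  | succ n ih =>
    have h1 : (w (localTime x (n + 1) z))⁻¹ ≤ (w (localTime x n z))⁻¹ :=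
      inv_anti₀ (hpos _) (hmono (localTime_mono x z (Nat.le_succ n)))
    have h2 := mul_le_mul_of_nonneg_left h1 (sub_nonneg.2 (hf (jumpCount x y z (n + 1))))
    rw [clockSum_succ, jumpSum_succ]
    refine le_trans ?_ ih
    refine le_trans (add_le_add_right h2 _) ?_
    rw [jumpCount_succ]
    split_ifs with h
    · rw [Finset.sum_range_succ]; apply le_of_eq; ring
    · simp

lemma alarm_le (x : ℕ → ℤ) (y z : ℤ) (n : ℕ) :
    alarm w f x y z n ≤ 2 * jumpSum w x y z n + (C + 2) * (w 0)⁻¹ := by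
  have h1 := clockSum_le hpos hmono hf x y z n
  have h2 := hf (jumpCount x y z n + 1)
  rw [Finset.sum_range_succ] at h2
  have h3 : (w (localTime x n z))⁻¹ ≤ (w 0)⁻¹ := inv_anti₀ (hpos 0) (hmono (Nat.zero_le _))
  have h4 := inv_pos.2 (hpos (localTime x n z))
  have h5 : (f (jumpCount x y z n) - 2) * (w (localTime x n z))⁻¹ ≤
      (C - ∑ i ∈ Finset.range (jumpCount x y z n), (f i - 2)) * (w (localTime x n z))⁻¹ := by
    apply mul_le_mul_of_nonneg_right _ h4.le; linarith
  rw [alarm]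
  linarith

end Abel

section Driven

variable {w : ℕ → ℝ} {c : ℤ} {ζ : ℤ × ℕ × Bool → ℝ} {x : ℕ → ℤ} (hx : IsDriven w c ζ x)

lemma jumpCount_tendsto {y z : ℤ} (h : ∃ᶠ n in atTop, x n = y ∧ x (n + 1) = z) (r : ℕ) :
    ∃ n, r < jumpCount x y z n := by
  induction r with
  | zero =>
    obtain ⟨n, -, hn⟩ := frequently_atTop.1 h 0
    exact ⟨n + 1, by rw [jumpCount_succ, if_pos hn]; omega⟩
  | succ r ih =>
    obtain ⟨m, hm⟩ := ih
    obtain ⟨n, hmn, hn⟩ := frequently_atTop.1 h m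
    have := jumpCount_mono x y z hmn
    exact ⟨n + 1, by rw [jumpCount_succ, if_pos hn]; omega⟩

lemma exists_jump_with_count {y z : ℤ} (h : ∃ᶠ n in atTop, x n = y ∧ x (n + 1) = z) (r : ℕ) :
    ∃ k, x k = y ∧ x (k + 1) = z ∧ jumpCount x y z k = r := by
  obtain ⟨n, hn⟩ := jumpCount_tendsto h r
  obtain ⟨k, -, hk⟩ := exists_jump_of_lt hn
  exact ⟨k, hk⟩

/-- The left alarm at time `n`. -/
noncomputable abbrev alarmL (w : ℕ → ℝ) (c : ℤ) (ζ : ℤ × ℕ × Bool → ℝ) (x : ℕ → ℤ) : ℕ → ℝ :=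
  alarm w (fun i => ζ (c, i, false)) x c (c - 1)

/-- The right alarm at time `n`. -/
noncomputable abbrev alarmR (w : ℕ → ℝ) (c : ℤ) (ζ : ℤ × ℕ × Bool → ℝ) (x : ℕ → ℤ) : ℕ → ℝ :=
  alarm w (fun i => ζ (c, i, true)) x c (c + 1)

/-- Only finitely many alarms occur before time `N`, and a sufficiently large `τ` exceeds them all.
-/
lemma first_after_tendsto {x : ℕ → ℤ} {ζ : ℤ × ℕ × Bool → ℝ} {v : ℝ → ℕ}
    (hv : ∀ τ, x (v τ) = c ∧ τ < alarmL w c ζ x (v τ)) : Tendsto v atTop atTop := by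
  refine tendsto_atTop.2 fun N => ?_
  filter_upwards [eventually_ge_atTop (∑ k ∈ Finset.range N, |alarmL w c ζ x k|)] with τ hτ
  by_contra! hcon
  have h1 := (hv τ).2
  have h2 := Finset.single_le_sum (f := fun k => |alarmL w c ζ x k|) (fun k _ => abs_nonneg _)
    (Finset.mem_range.2 hcon)
  have h3 := le_abs_self (alarmL w c ζ x (v τ))
  linarith

include hx

lemma IsDriven.alarm_le_of_left {n : ℕ} (hn : x n = c) (hl : x (n + 1) = c - 1) :
    alarmL w c ζ x n ≤ alarmR w c ζ x n := by
  have := hx.goesLeft_of hn hl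
  rwa [GoesLeft, if_pos hn] at this

lemma IsDriven.alarm_lt_of_right {n : ℕ} (hn : x n = c) (hl : x (n + 1) = c + 1) :
    alarmR w c ζ x n < alarmL w c ζ x n := by
  have := hx.not_goesLeft_of hn hl
  rwa [GoesLeft, if_pos hn, not_le] at this

/-- If the left alarms are unbounded, there is a first visit to `c` at which both pending alarms
exceed `τ`, and all alarms before were at most `τ`. -/
lemma IsDriven.exists_first_after (hl : ∃ᶠ n in atTop, x n = c ∧ x (n + 1) = c - 1)
    (hunb : ∀ τ, ∃ n, x n = c ∧ τ < alarmL w c ζ x n) (τ : ℝ) :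
    ∃ v, x v = c ∧ τ < alarmL w c ζ x v ∧ τ < alarmR w c ζ x v ∧
      ∀ k < v, x k = c → (x (k + 1) = c - 1 → alarmL w c ζ x k ≤ τ) ∧
        (x (k + 1) = c + 1 → alarmR w c ζ x k ≤ τ) := by
  classical
  have hex : ∃ v, x v = c ∧ τ < alarmL w c ζ x v ∧ τ < alarmR w c ζ x v := by
    obtain ⟨n, hn, hn'⟩ := hunb τ
    obtain ⟨k, h1, h2, h3⟩ := exists_jump_with_count hl (jumpCount x c (c - 1) n)
    have h4 : alarmL w c ζ x k = alarmL w c ζ x n :=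
      alarm_eq_of_jumpCount_eq hx.isNearestNeighbor (Or.inr rfl) h1 hn h3
    have h5 := hx.alarm_le_of_left h1 h2
    exact ⟨k, h1, by linarith, by linarith⟩
  refine ⟨Nat.find hex, (Nat.find_spec hex).1, (Nat.find_spec hex).2.1, (Nat.find_spec hex).2.2,
    fun k hk hkc => ?_⟩
  have hmin := Nat.find_min hex hk
  simp only [not_and, not_lt] at hmin
  constructor
  · intro h
    by_contra! hcon
    have := hx.alarm_le_of_left hkc h
    linarith [hmin hkc hcon]
  · intro h
    have h1 := hx.alarm_lt_of_right hkc h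
    by_contra! hcon
    linarith [hmin hkc (by linarith)]

end Driven

/-! ### Two coupled paths cannot both be balanced -/

section Exclusion

variable {w : ℕ → ℝ} (hpos : ∀ n, 0 < w n) (hmono : Monotone w) {c : ℤ}
  {ζ ζ' : ℤ × ℕ × Bool → ℝ} (hζ : ∀ i, 0 ≤ ζ i) (hζ' : ∀ i, i ≠ (c, 0, false) → ζ i = ζ' i)
  (hlt : ζ (c, 0, false) < ζ' (c, 0, false))
  {x x' : ℕ → ℤ} (hx : IsDriven w c ζ x) (hx' : IsDriven w c ζ' x')
  (hl : ∃ᶠ n in atTop, x n = c ∧ x (n + 1) = c - 1)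
  (hr : ∃ᶠ n in atTop, x n = c ∧ x (n + 1) = c + 1)
  (hl' : ∃ᶠ n in atTop, x' n = c ∧ x' (n + 1) = c - 1)

include hpos hmono hζ hζ' hlt hx hx' hl hr hl'

/-- Near a finite supremum of the left alarms of `x`, the gap lifts a left alarm of `x'` above it.
When `x'` jumps left at that alarm, its right alarm is above the supremum as well, and so is the
right alarm of `x` of the same index. When `x` later jumps right at it, its left alarm is still
larger, which is impossible. -/
lemma not_bounded_alarm : ¬ ∃ T, ∀ n, x n = c → alarmL w c ζ x n ≤ T := by
  rintro ⟨T₀, hT₀⟩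
  have hdom := dominatedAt hpos hmono hζ hζ' hlt.le hx hx'
  obtain ⟨t₀, ht₀, -, h0⟩ := exists_jump_with_count hl' 0
  set Δ := (ζ' (c, 0, false) - ζ (c, 0, false)) * (w (localTime x' t₀ (c - 1)))⁻¹ with hΔ
  have hΔ0 : 0 < Δ := mul_pos (sub_pos.2 hlt) (inv_pos.2 (hpos _))
  set S := {r | ∃ n, x n = c ∧ alarmL w c ζ x n = r} with hS
  have hSne : S.Nonempty := by
    obtain ⟨n, -, hn⟩ := frequently_atTop.1 hl 0
    exact ⟨_, n, hn.1, rfl⟩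
  have hSb : BddAbove S := ⟨T₀, by rintro _ ⟨n, hn, rfl⟩; exact hT₀ n hn⟩
  obtain ⟨_, ⟨n, hn, rfl⟩, hgt⟩ := exists_lt_of_lt_csSup hSne (sub_lt_self (sSup S) hΔ0)
  obtain ⟨t, h1, h2, h3⟩ := exists_jump_with_count hl' (jumpCount x c (c - 1) n)
  have h4 : alarmL w c ζ x n + Δ ≤ alarmL w c ζ' x' t :=
    alarm_left_le hpos hmono hζ hζ' hlt.le hx hx' (fun s _ => hdom s) hn h1 h3.symm ht₀ h0
  have h5 := hx'.alarm_le_of_left h1 h2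
  obtain ⟨s, h6, h7, h8⟩ := exists_jump_with_count hr (jumpCount x' c (c + 1) t)
  have h9 := hx.alarm_lt_of_right h6 h7
  have h10 : alarmR w c ζ' x' t ≤ alarmR w c ζ x s :=
    alarm_right_le hpos hmono hζ hζ' hx hx' (fun s _ => hdom s) h6 h1 h8
  have h11 : alarmL w c ζ x s ≤ sSup S := le_csSup hSb ⟨s, h6, rfl⟩
  linarith

variable (hf : ∃ C, ∀ I, ∑ i ∈ Finset.range I, (ζ (c, i, false) - 2) ≤ C)
  (hf' : ∃ C, ∀ I, ∑ i ∈ Finset.range I, (ζ' (c, i, false) - 2) ≤ C)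

include hf hf'

/-- Two paths driven by clocks that differ only in the first left clock at `c` cannot both jump
infinitely often from `c` in both directions and be perfectly balanced. -/
theorem driven_exclusion
    (hE : FiniteJumpSum w x c (c - 1) ∨ Tendsto (fun n => cumWeight w (localTime x n (c - 1)) -
      cumWeight w (localTime x n (c + 1))) atTop (nhds 0))
    (hE' : FiniteJumpSum w x' c (c - 1) ∨ Tendsto (fun n => cumWeight w (localTime x' n (c - 1)) -
      cumWeight w (localTime x' n (c + 1))) atTop (nhds 0)) : False := by
  have hdom := dominatedAt hpos hmono hζ hζ' hlt.le hx hx'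
  have hnb := not_bounded_alarm hpos hmono hζ hζ' hlt hx hx' hl hr hl'
  obtain ⟨C, hC⟩ := hf
  obtain ⟨C', hC'⟩ := hf'
  have hA : ∀ n, alarmL w c ζ x n ≤ 2 * jumpSum w x c (c - 1) n + (C + 2) * (w 0)⁻¹ :=
    alarm_le hpos hmono hC x c (c - 1)
  have hB : ∀ n, alarmL w c ζ' x' n ≤ 2 * jumpSum w x' c (c - 1) n + (C' + 2) * (w 0)⁻¹ :=
    alarm_le hpos hmono hC' x' c (c - 1)
  obtain ⟨t₀, ht₀, -, h0⟩ := exists_jump_with_count hl' 0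
  set Δ := (ζ' (c, 0, false) - ζ (c, 0, false)) * (w (localTime x' t₀ (c - 1)))⁻¹ with hΔ
  have hΔ0 : 0 < Δ := mul_pos (sub_pos.2 hlt) (inv_pos.2 (hpos _))
  have hAB : ∀ s t, x s = c → x' t = c → jumpCount x c (c - 1) s = jumpCount x' c (c - 1) t →
      alarmL w c ζ x s + Δ ≤ alarmL w c ζ' x' t := fun s t hs ht h =>
    alarm_left_le hpos hmono hζ hζ' hlt.le hx hx' (fun s _ => hdom s) hs ht h ht₀ h0
  have hRAB : ∀ s t, x s = c → x' t = c → jumpCount x c (c + 1) s = jumpCount x' c (c + 1) t →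
      alarmR w c ζ' x' t ≤ alarmR w c ζ x s := fun s t hs ht h =>
    alarm_right_le hpos hmono hζ hζ' hx hx' (fun s _ => hdom s) hs ht h
  have hunb : ∀ τ, ∃ n, x n = c ∧ τ < alarmL w c ζ x n := by
    intro τ; by_contra! hcon; exact hnb ⟨τ, hcon⟩
  have hunb' : ∀ τ, ∃ n, x' n = c ∧ τ < alarmL w c ζ' x' n := by
    intro τ
    obtain ⟨s, hs, hs'⟩ := hunb τ
    obtain ⟨t, h1, -, h2⟩ := exists_jump_with_count hl' (jumpCount x c (c - 1) s)
    exact ⟨t, h1, by linarith [hAB s t hs h1 h2.symm]⟩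
  -- A convergent jump sum would bound the alarms by `alarm_le`, so only the balanced alternative
  -- survives.
  have hbal : Tendsto (fun n => cumWeight w (localTime x n (c - 1)) -
      cumWeight w (localTime x n (c + 1))) atTop (nhds 0) := by
    refine hE.resolve_left ?_
    rintro ⟨B, hB⟩
    obtain ⟨n, -, hn⟩ := hunb (2 * B + (C + 2) * (w 0)⁻¹)
    linarith [hA n, hB ⟨n, rfl⟩]
  have hbal' : Tendsto (fun n => cumWeight w (localTime x' n (c - 1)) -
      cumWeight w (localTime x' n (c + 1))) atTop (nhds 0) := by
    refine hE'.resolve_left ?_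
    rintro ⟨B', hB'⟩
    obtain ⟨n, -, hn⟩ := hunb' (2 * B' + (C' + 2) * (w 0)⁻¹)
    linarith [hB n, hB' ⟨n, rfl⟩]
  choose v hv1 hv2 hv3 hv4 using hx.exists_first_after hl hunb
  choose v' hv1' hv2' hv3' hv4' using hx'.exists_first_after hl' hunb'
  have hv : Tendsto v atTop atTop := first_after_tendsto fun τ => ⟨hv1 τ, hv2 τ⟩
  have hv' : Tendsto v' atTop atTop := first_after_tendsto fun τ => ⟨hv1' τ, hv2' τ⟩
  -- Left alarms of `x'` come at least `Δ` later than those of `x`, so by alarm time `τ + Δ` it has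
  -- made no more left jumps than `x` by `τ`. For right jumps the order is reversed, without a
  -- delay.
  have hleft : ∀ τ, localTime x' (v' (τ + Δ)) (c - 1) ≤ localTime x (v τ) (c - 1) := fun τ => by
    have hcount : jumpCount x' c (c - 1) (v' (τ + Δ)) ≤ jumpCount x c (c - 1) (v τ) := by
      by_contra! hcon
      obtain ⟨k, hk, h1, h2, h3⟩ := exists_jump_of_lt hcon
      linarith [((hv4' (τ + Δ)) k hk h1).1 h2, hv2 τ, hAB (v τ) k (hv1 τ) h1 h3.symm]
    rcases hcount.eq_or_lt with h | h
    · exact ((hdom _) _).2.1 (hv1 τ) (hv1' _) h.symm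
    · obtain ⟨k, hk, h1, h2, h3⟩ := exists_jump_of_lt h
      exact (((hdom _) _).2.1 h1 (hv1' _) h3).trans (localTime_mono x (c - 1) hk.le)
  have hright : ∀ τ, localTime x (v τ) (c + 1) ≤ localTime x' (v' τ) (c + 1) := fun τ => by
    have hcount : jumpCount x c (c + 1) (v τ) ≤ jumpCount x' c (c + 1) (v' τ) := by
      by_contra! hcon
      obtain ⟨k, hk, h1, h2, h3⟩ := exists_jump_of_lt hcon
      linarith [((hv4 τ) k hk h1).2 h2, hv3' τ, hRAB k (v' τ) h1 (hv1' τ) h3]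
    rcases hcount.eq_or_lt with h | h
    · exact ((hdom _) _).2.2 (hv1 τ) (hv1' _) h
    · obtain ⟨k, hk, h1, h2, h3⟩ := exists_jump_of_lt h
      exact (((hdom _) _).2.2 (hv1 τ) h1 h3.symm).trans (localTime_mono x' (c + 1) hk.le)
  set g : ℝ → ℝ := fun τ => cumWeight w (localTime x' (v' τ) (c - 1)) with hg
  -- Chain `hleft`, the balance of `x`, `hright` and the balance of `x'`; each balance costs at most
  -- `Δ / 8`. Hence along steps of length `Δ`, `g` grows at most at rate `1 / 4`, whereas `hgrow`
  -- demands rate `1 / 2`.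
  obtain ⟨τ₀, hτ₀⟩ : ∃ τ₀, ∀ τ ≥ τ₀, g (τ + Δ) ≤ g τ + Δ / 4 := by
    have e1 := (hbal.comp hv).eventually (gt_mem_nhds (by linarith : (0 : ℝ) < Δ / 8))
    have e2 := (hbal'.comp hv').eventually (lt_mem_nhds (by linarith : -(Δ / 8) < (0 : ℝ)))
    obtain ⟨τ₀, h⟩ := eventually_atTop.1 (e1.and e2)
    refine ⟨τ₀, fun τ hτ => ?_⟩
    have h1 := (h τ hτ).1
    have h2 := (h τ hτ).2
    simp only [Function.comp] at h1 h2
    have h3 := cumWeight_mono hpos (hleft τ)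
    have h4 := cumWeight_mono hpos (hright τ)
    simp only [hg]
    linarith
  have hiter : ∀ k : ℕ, g (τ₀ + k * Δ) ≤ g τ₀ + k * (Δ / 4) := fun k => by
    induction k with
    | zero => simp
    | succ k ih =>
      have h1 := hτ₀ (τ₀ + k * Δ) (by
        have : 0 ≤ (k : ℝ) * Δ := by positivity
        linarith)
      have h2 : τ₀ + ((k + 1 : ℕ) : ℝ) * Δ = τ₀ + k * Δ + Δ := by push_cast; ring
      rw [h2]
      push_cast
      linarith
  have hgrow : ∀ τ, τ < 2 * g τ + (C' + 2) * (w 0)⁻¹ := fun τ => by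
    have h1 := hB (v' τ)
    have h2 := jumpSum_le_cumWeight_right (x := x') hpos hx'.isNearestNeighbor (c - 1) (v' τ)
    rw [sub_add_cancel] at h2
    simp only [hg]
    linarith [hv2' τ]
  obtain ⟨k, hk⟩ := exists_nat_gt ((2 * g τ₀ + (C' + 2) * (w 0)⁻¹ - τ₀) / (Δ / 2))
  rw [div_lt_iff₀ (by linarith)] at hk
  linarith [hiter k, hgrow (τ₀ + k * Δ)]

end Exclusion

/-! ### Exponential clocks: races, resampling, law of large numbers -/

/-- The law of a standard exponential variable. -/
noncomputable def expLaw : Measure ℝ :=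
  (volume.restrict (Set.Ioi 0)).withDensity fun x => ENNReal.ofReal (Real.exp (-x))

lemma lintegral_expLaw {f : ℝ → ℝ≥0∞} (hf : Measurable f) :
    ∫⁻ x, f x ∂expLaw = ∫⁻ x in Set.Ioi 0, ENNReal.ofReal (Real.exp (-x)) * f x := by
  rw [expLaw, lintegral_withDensity_eq_lintegral_mul _ (by fun_prop) hf]; rfl

lemma lintegral_exp_neg_mul {r : ℝ} (hr : 0 < r) :
    ∫⁻ x in Set.Ioi (0 : ℝ), ENNReal.ofReal (Real.exp (-(r * x))) = ENNReal.ofReal r⁻¹ := by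
  have h := integral_exp_mul_Ioi (a := -r) (by linarith) 0
  have hi := integrableOn_exp_mul_Ioi (a := -r) (by linarith) 0
  simp only [neg_mul] at h hi
  rw [← ofReal_integral_eq_lintegral_ofReal hi (ae_of_all _ fun x => (Real.exp_pos _).le), h]
  congr 1
  simp [neg_div_neg_eq]

instance : IsProbabilityMeasure expLaw := ⟨by
  have h := lintegral_expLaw (f := fun _ => 1) measurable_const
  have h2 := lintegral_exp_neg_mul one_pos
  simp only [lintegral_const, one_mul, mul_one, inv_one, ENNReal.ofReal_one] at h h2
  rw [h, h2]⟩

instance : NullSingletonClass expLaw :=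
  ⟨fun x => withDensity_absolutelyContinuous _ _ (measure_singleton x)⟩

lemma ae_expLaw_nonneg : ∀ᵐ x ∂expLaw, 0 ≤ x :=
  (withDensity_absolutelyContinuous _ _).ae_le
    ((ae_restrict_mem measurableSet_Ioi).mono fun _ hx => le_of_lt hx)

/-- The overshoot of an exponential variable is exponential. -/
lemma lintegral_overshoot {s : ℝ} (hs : 0 < s) {F : ℝ → ℝ≥0∞} (hF : Measurable F) :
    ∫⁻ b, {b | s ≤ b}.indicator (fun b => F (b - s)) b ∂expLaw =
      ENNReal.ofReal (Real.exp (-s)) * ∫⁻ r, F r ∂expLaw := by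
  have hms : MeasurableSet {b : ℝ | s ≤ b} := measurableSet_Ici
  have hm : Measurable ({b | s ≤ b}.indicator fun b => F (b - s)) :=
    (hF.comp (measurable_id.sub_const s)).indicator hms
  rw [lintegral_expLaw hm, lintegral_expLaw hF,
    ← lintegral_const_mul _ (by fun_prop), ← lintegral_indicator measurableSet_Ioi,
    ← setLIntegral_congr (Ioi_ae_eq_Ici (a := (0 : ℝ))).symm,
    ← lintegral_indicator measurableSet_Ici,
    ← lintegral_sub_right_eq_self (Set.indicator (Set.Ici 0) _) s]
  refine lintegral_congr fun b => ?_
  by_cases hb : s ≤ b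
  · rw [Set.indicator_of_mem (show b ∈ Set.Ioi (0 : ℝ) from lt_of_lt_of_le hs hb),
      Set.indicator_of_mem (show b ∈ {b : ℝ | s ≤ b} from hb),
      Set.indicator_of_mem (show b - s ∈ Set.Ici (0 : ℝ) from sub_nonneg.2 hb), ← mul_assoc,
      ← ENNReal.ofReal_mul (Real.exp_pos _).le, ← Real.exp_add]
    congr 3; ring
  · rw [Set.indicator_of_notMem (show b - s ∉ Set.Ici (0 : ℝ) from fun h => hb (sub_nonneg.1 h))]
    refine Set.indicator_apply_eq_zero.2 fun _ => ?_
    rw [Set.indicator_of_notMem (show b ∉ {b : ℝ | s ≤ b} from hb), mul_zero]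

/-- The race of two exponential clocks: the loser's remaining time is again exponential. -/
lemma lintegral_race {ρ : ℝ} (hρ : 0 < ρ) {F : ℝ → ℝ≥0∞} (hF : Measurable F) :
    ∫⁻ a, ∫⁻ b, {b | ρ * a ≤ b}.indicator (fun b => F (b - ρ * a)) b ∂expLaw ∂expLaw =
      ENNReal.ofReal (1 + ρ)⁻¹ * ∫⁻ r, F r ∂expLaw := by
  have h : ∀ᵐ a ∂expLaw, ∫⁻ b, {b | ρ * a ≤ b}.indicator (fun b => F (b - ρ * a)) b ∂expLaw =
      ENNReal.ofReal (Real.exp (-(ρ * a))) * ∫⁻ r, F r ∂expLaw :=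
    (withDensity_absolutelyContinuous _ _).ae_le
      ((ae_restrict_mem measurableSet_Ioi).mono fun a ha => lintegral_overshoot (mul_pos hρ ha) hF)
  rw [lintegral_congr_ae h, lintegral_mul_const _ (by fun_prop), lintegral_expLaw (by fun_prop),
    ← lintegral_exp_neg_mul (by linarith : 0 < 1 + ρ)]
  congr 1
  refine lintegral_congr fun x => ?_
  rw [← ENNReal.ofReal_mul (Real.exp_pos _).le, ← Real.exp_add]
  congr 2; ring

/-- Ties have probability zero. The strict form is needed because ties are decided in favour of the
left. -/
lemma lintegral_race_strict {ρ : ℝ} (hρ : 0 < ρ) {F : ℝ → ℝ≥0∞} (hF : Measurable F) :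
    ∫⁻ a, ∫⁻ b, {b | ρ * a < b}.indicator (fun b => F (b - ρ * a)) b ∂expLaw ∂expLaw =
      ENNReal.ofReal (1 + ρ)⁻¹ * ∫⁻ r, F r ∂expLaw := by
  rw [← lintegral_race hρ hF]
  refine lintegral_congr fun a => lintegral_congr_ae ?_
  filter_upwards [compl_mem_ae_iff.2 (measure_singleton (μ := expLaw) (ρ * a))] with b hb
  have : (b ∈ {b | ρ * a < b}) ↔ b ∈ {b | ρ * a ≤ b} :=
    ⟨fun h => le_of_lt (Set.mem_ofPred_eq ▸ h), fun h => lt_of_le_of_ne h fun h' => hb h'.symm⟩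
  simp only [Set.indicator_apply, this]

lemma integrable_expLaw : Integrable (fun x => x) expLaw ∧ ∫ x, x ∂expLaw = 1 := by
  have h1 := Real.GammaIntegral_convergent (s := 2) (by norm_num)
  have h2 := Real.Gamma_eq_integral (s := 2) (by norm_num)
  have e : ∀ x ∈ Set.Ioi (0 : ℝ), Real.exp (-x) * x ^ ((2 : ℝ) - 1) = Real.exp (-x) * x :=
    fun x _ => by norm_num
  have h3 : IntegrableOn (fun x => Real.exp (-x) * x) (Set.Ioi 0) :=
    h1.congr_fun e measurableSet_Ioi
  rw [setIntegral_congr_fun measurableSet_Ioi e, Real.Gamma_two] at h2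
  have hd : expLaw = (volume.restrict (Set.Ioi 0)).withDensity
      fun x => ((Real.toNNReal (Real.exp (-x)) : ℝ≥0) : ℝ≥0∞) := rfl
  have hm : Measurable fun x : ℝ => Real.toNNReal (Real.exp (-x)) := by fun_prop
  constructor
  · rw [hd, integrable_withDensity_iff_integrable_smul hm]
    refine h3.congr (ae_of_all _ fun x => ?_)
    simp [NNReal.smul_def, Real.exp_nonneg]
  · rw [hd, integral_withDensity_eq_integral_smul hm, h2]
    refine integral_congr_ae (ae_of_all _ fun x => ?_)
    simp [NNReal.smul_def, Real.exp_nonneg]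

section Resample

variable {ι : Type*} [DecidableEq ι]

/-- The law of independent standard exponential clocks indexed by `ι`. -/
noncomputable abbrev clockLaw (ι : Type*) : Measure (ι → ℝ) := Measure.infinitePi fun _ => expLaw

lemma measurable_update_pair (i : ι) :
    Measurable fun p : (ι → ℝ) × ℝ => Function.update p.1 i p.2 := by
  refine measurable_pi_lambda _ fun j => ?_
  by_cases h : j = i
  · subst h; simpa using measurable_snd
  · simpa [Function.update_of_ne h] using (measurable_pi_apply j).fun_comp measurable_fst

/-- Replacing one clock by an independent one does not change the law. -/
lemma map_update_clockLaw (i : ι) :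
    ((clockLaw ι).prod expLaw).map (fun p => Function.update p.1 i p.2) = clockLaw ι := by
  refine Measure.eq_infinitePi _ fun s t ht => ?_
  rw [Measure.map_apply (measurable_update_pair i)
    (MeasurableSet.pi s.countable_toSet fun j _ => ht j)]
  by_cases hi : i ∈ s
  · have : (fun p : (ι → ℝ) × ℝ => Function.update p.1 i p.2) ⁻¹' Set.pi s t =
        (Set.pi (s.erase i : Finset ι) t) ×ˢ t i := by
      ext p
      simp only [Set.mem_preimage, Set.mem_pi, Finset.mem_coe, Set.mem_prod, Finset.mem_erase]
      constructor
      · intro h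
        refine ⟨fun j hj => ?_, ?_⟩
        · simpa [Function.update_of_ne hj.1] using h j hj.2
        · simpa using h i hi
      · rintro ⟨h1, h2⟩ j hj
        by_cases hji : j = i
        · subst hji; simpa using h2
        · simpa [Function.update_of_ne hji] using h1 j ⟨hji, hj⟩
    rw [this, Measure.prod_prod, Measure.infinitePi_pi _ (fun j _ => ht j), mul_comm,
      Finset.mul_prod_erase s (fun j => expLaw (t j)) hi]
  · have : (fun p : (ι → ℝ) × ℝ => Function.update p.1 i p.2) ⁻¹' Set.pi s t =
        (Set.pi s t) ×ˢ Set.univ := by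
      ext p
      simp only [Set.mem_preimage, Set.mem_pi, Finset.mem_coe, Set.mem_prod, Set.mem_univ, and_true]
      refine forall₂_congr fun j hj => ?_
      rw [Function.update_of_ne (fun h : j = i => hi (by rw [← h]; exact hj))]
    rw [this, Measure.prod_prod, Measure.infinitePi_pi _ (fun j _ => ht j), measure_univ, mul_one]

lemma lintegral_resample (i : ι) {f : (ι → ℝ) → ℝ≥0∞} (hf : Measurable f) :
    ∫⁻ ζ, f ζ ∂clockLaw ι = ∫⁻ ζ, ∫⁻ r, f (Function.update ζ i r) ∂expLaw ∂clockLaw ι := by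
  conv_lhs => rw [← map_update_clockLaw i]
  rw [lintegral_map hf (measurable_update_pair i), lintegral_prod]
  exact (hf.comp (measurable_update_pair i)).aemeasurable

/-- A set that every line in the direction of a given coordinate meets at most once is null. -/
lemma clockLaw_null_of_subsingleton (i : ι) {N : Set (ι → ℝ)} (hN : MeasurableSet N)
    (h : ∀ ζ, {r | Function.update ζ i r ∈ N}.Subsingleton) : clockLaw ι N = 0 := by
  rw [← lintegral_indicator_one hN, lintegral_resample i (measurable_one.indicator hN)]
  refine (lintegral_congr fun ζ => ?_).trans lintegral_zero
  have hm : MeasurableSet {r | Function.update ζ i r ∈ N} := hN.preimage (measurable_update ζ)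
  rw [← (h ζ).measure_zero expLaw, ← lintegral_indicator_one hm]
  rfl

omit [DecidableEq ι] in
lemma clockLaw_nonneg [Countable ι] : ∀ᵐ ζ ∂clockLaw ι, ∀ i, 0 ≤ ζ i :=
  ae_all_iff.2 fun i => (measurePreserving_eval_infinitePi (fun _ : ι => expLaw) i).quasiMeasurePreserving.ae
    ae_expLaw_nonneg

omit [DecidableEq ι] in
/-- Strong law of large numbers, as an upper bound. -/
lemma clockLaw_sum_le {j : ℕ → ι} (hj : Function.Injective j) :
    ∀ᵐ ζ ∂clockLaw ι, ∃ C, ∀ I, ∑ i ∈ Finset.range I, (ζ (j i) - 2) ≤ C := by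
  have hmp : ∀ i, MeasurePreserving (fun ζ : ι → ℝ => ζ i) (clockLaw ι) expLaw :=
    measurePreserving_eval_infinitePi _
  have hind : iIndepFun (fun i (ζ : ι → ℝ) => ζ i) (clockLaw ι) :=
    iIndepFun_infinitePi (X := fun _ x => x) fun _ => measurable_id
  have hslln := strong_law_ae_real (μ := clockLaw ι) (fun n ζ => ζ (j n))
    ((hmp (j 0)).integrable_comp_of_integrable integrable_expLaw.1)
    (fun m n hmn => hind.indepFun (hj.ne hmn))
    (fun n => ⟨(hmp _).measurable.aemeasurable, (hmp _).measurable.aemeasurable, by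
      rw [(hmp _).map_eq, (hmp _).map_eq]⟩)
  have hmean : ∫ ζ, ζ (j 0) ∂clockLaw ι = 1 := by
    rw [← integrable_expLaw.2, ← (hmp (j 0)).map_eq, integral_map (hmp _).measurable.aemeasurable
      (by fun_prop)]
  rw [hmean] at hslln
  filter_upwards [hslln] with ζ h
  have h2 := h.eventually (gt_mem_nhds (by norm_num : (1 : ℝ) < 2))
  obtain ⟨N, hN⟩ := eventually_atTop.1 h2
  -- The averages are eventually below `2`, so the partial sums are then nonpositive; this constant
  -- covers the finitely many earlier ones.
  refine ⟨∑ I ∈ Finset.range (N + 1), |∑ i ∈ Finset.range I, (ζ (j i) - 2)|, fun I => ?_⟩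
  by_cases hI : I < N + 1
  · exact (le_abs_self _).trans (Finset.single_le_sum (f := fun I => |∑ i ∈ Finset.range I,
      (ζ (j i) - 2)|) (fun _ _ => abs_nonneg _) (Finset.mem_range.2 hI))
  · have h3 := hN I (by omega)
    have hI0 : (0 : ℝ) < I := by exact_mod_cast (by omega : 0 < I)
    rw [div_lt_iff₀ hI0] at h3
    refine le_trans ?_ (Finset.sum_nonneg fun _ _ => abs_nonneg _)
    rw [Finset.sum_sub_distrib, Finset.sum_const, Finset.card_range, nsmul_eq_mul]
    linarith

end Resample

/-! ### Residual clocks and the law of a driven path -/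

/-- Rescaled times that the two clocks pending at `c` still have to run. -/
noncomputable def residualClocks (w : ℕ → ℝ) (c : ℤ) (ζ : ℤ × ℕ × Bool → ℝ) (x : ℕ → ℤ) : ℕ → ℝ × ℝ
  | 0 => (ζ (c, 0, false), ζ (c, 0, true))
  | n + 1 =>
    if x n = c then
      if x (n + 1) = c - 1 then
        (ζ (c, jumpCount x c (c - 1) (n + 1), false),
          (residualClocks w c ζ x n).2 - w (localTime x n (c + 1)) * (w (localTime x n (c - 1)))⁻¹ *
            (residualClocks w c ζ x n).1)
      else
        ((residualClocks w c ζ x n).1 - w (localTime x n (c - 1)) * (w (localTime x n (c + 1)))⁻¹ *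
            (residualClocks w c ζ x n).2,
          ζ (c, jumpCount x c (c + 1) (n + 1), true))
    else residualClocks w c ζ x n

/-- The time shown by the clocks at `c`. -/
noncomputable def clockTime (w : ℕ → ℝ) (c : ℤ) (ζ : ℤ × ℕ × Bool → ℝ) (x : ℕ → ℤ) (n : ℕ) : ℝ :=
  ∑ k ∈ Finset.range n,
    if x k = c then
      if x (k + 1) = c - 1 then (residualClocks w c ζ x k).1 * (w (localTime x k (c - 1)))⁻¹
      else (residualClocks w c ζ x k).2 * (w (localTime x k (c + 1)))⁻¹
    else 0

section Residual

variable {w : ℕ → ℝ} (hpos : ∀ n, 0 < w n) {c : ℤ} {ζ : ℤ × ℕ × Bool → ℝ} {x : ℕ → ℤ}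
  (hx : IsNearestNeighbor x)

lemma clockTime_succ (w : ℕ → ℝ) (c : ℤ) (ζ : ℤ × ℕ × Bool → ℝ) (x : ℕ → ℤ) (n : ℕ) :
    clockTime w c ζ x (n + 1) = clockTime w c ζ x n +
      if x n = c then
        if x (n + 1) = c - 1 then (residualClocks w c ζ x n).1 * (w (localTime x n (c - 1)))⁻¹
        else (residualClocks w c ζ x n).2 * (w (localTime x n (c + 1)))⁻¹
      else 0 := by
  simp [clockTime, Finset.sum_range_succ]

include hpos hx

/-- A left clock that has not yet run has no definite scale, since `c - 1` may be visited before the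
path is next at `c`: this is the first alternative. After a jump to the right the left clock has
partly run; its alarm stays valid because `c - 1` cannot be reached before `c`, which is why `c ≤ x
n` is carried along. -/
lemma residual_fst (n : ℕ) :
    (clockSum w (fun i => ζ (c, i, false)) x c (c - 1) n = clockTime w c ζ x n ∧
      (residualClocks w c ζ x n).1 = ζ (c, jumpCount x c (c - 1) n, false)) ∨
    (c ≤ x n ∧ alarm w (fun i => ζ (c, i, false)) x c (c - 1) n = clockTime w c ζ x n +
      (residualClocks w c ζ x n).1 * (w (localTime x n (c - 1)))⁻¹) := by
  induction n with
  | zero => left; simp [clockSum, clockTime, residualClocks, jumpCount_zero]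
  | succ n ih =>
    have ih' : alarm w (fun i => ζ (c, i, false)) x c (c - 1) n = clockTime w c ζ x n +
      (residualClocks w c ζ x n).1 * (w (localTime x n (c - 1)))⁻¹ := by
      rcases ih with ⟨h1, h2⟩ | ⟨-, h⟩
      · rw [alarm, h1, h2]
      · exact h
    by_cases hc : x n = c
    · by_cases hl : x (n + 1) = c - 1
      · left
        rw [clockSum_succ, clockTime_succ, residualClocks, if_pos hc, if_pos hl, if_pos ⟨hc, hl⟩, ← ih',
          alarm, if_pos hc, if_pos hl]
        exact ⟨rfl, rfl⟩
      · right
        have hr : x (n + 1) = c + 1 := by rcases hx n with h | h <;> omega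
        refine ⟨by omega, ?_⟩
        have hw := (hpos (localTime x n (c - 1))).ne'
        have hj : jumpCount x c (c - 1) (n + 1) = jumpCount x c (c - 1) n := by
          rw [jumpCount_succ, if_neg (fun h => hl h.2), add_zero]
        have hz : localTime x (n + 1) (c - 1) = localTime x n (c - 1) := by
          rw [localTime_succ, if_neg (by omega), add_zero]
        rw [alarm] at ih' ⊢
        rw [clockSum_succ, clockTime_succ, residualClocks, if_pos hc, if_neg hl, if_neg (fun h => hl h.2),
          hj, hz, if_pos hc, if_neg hl, add_zero, ih']
        field_simp
        ring
    · have hj : ∀ z, jumpCount x c z (n + 1) = jumpCount x c z n := fun z => by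
        rw [jumpCount_succ, if_neg (fun h => hc h.1), add_zero]
      rw [alarm, clockSum_succ, clockTime_succ, residualClocks, hj, if_neg hc,
        if_neg (fun h => hc h.1), if_neg hc, add_zero, add_zero]
      rcases ih with h | ⟨h1, h2⟩
      · exact Or.inl h
      · right
        refine ⟨by rcases hx n with h | h <;> omega, ?_⟩
        rwa [localTime_succ, if_neg (by rcases hx n with h | h <;> omega), add_zero]

lemma residual_snd (n : ℕ) :
    (clockSum w (fun i => ζ (c, i, true)) x c (c + 1) n = clockTime w c ζ x n ∧
      (residualClocks w c ζ x n).2 = ζ (c, jumpCount x c (c + 1) n, true)) ∨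
    (x n ≤ c ∧ alarm w (fun i => ζ (c, i, true)) x c (c + 1) n = clockTime w c ζ x n +
      (residualClocks w c ζ x n).2 * (w (localTime x n (c + 1)))⁻¹) := by
  induction n with
  | zero => left; simp [clockSum, clockTime, residualClocks, jumpCount_zero]
  | succ n ih =>
    have ih' : alarm w (fun i => ζ (c, i, true)) x c (c + 1) n = clockTime w c ζ x n +
      (residualClocks w c ζ x n).2 * (w (localTime x n (c + 1)))⁻¹ := by
      rcases ih with ⟨h1, h2⟩ | ⟨-, h⟩
      · rw [alarm, h1, h2]
      · exact h
    by_cases hc : x n = c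
    · by_cases hl : x (n + 1) = c - 1
      · right
        refine ⟨by omega, ?_⟩
        have hw := (hpos (localTime x n (c + 1))).ne'
        have hr : ¬ (x n = c ∧ x (n + 1) = c + 1) := by omega
        have hj : jumpCount x c (c + 1) (n + 1) = jumpCount x c (c + 1) n := by
          rw [jumpCount_succ, if_neg hr, add_zero]
        have hz : localTime x (n + 1) (c + 1) = localTime x n (c + 1) := by
          rw [localTime_succ, if_neg (by omega), add_zero]
        rw [alarm] at ih' ⊢
        rw [clockSum_succ, clockTime_succ, residualClocks, if_pos hc, if_pos hl, if_neg hr,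
          hj, hz, if_pos hc, if_pos hl, add_zero, ih']
        field_simp
        ring
      · left
        have hr : x (n + 1) = c + 1 := by rcases hx n with h | h <;> omega
        rw [clockSum_succ, clockTime_succ, residualClocks, if_pos hc, if_neg hl, if_pos ⟨hc, hr⟩, ← ih',
          alarm, if_pos hc, if_neg hl]
        exact ⟨rfl, rfl⟩
    · have hj : ∀ z, jumpCount x c z (n + 1) = jumpCount x c z n := fun z => by
        rw [jumpCount_succ, if_neg (fun h => hc h.1), add_zero]
      rw [alarm, clockSum_succ, clockTime_succ, residualClocks, hj (c + 1), if_neg hc,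
        if_neg (fun h => hc h.1), if_neg hc, add_zero, add_zero]
      rcases ih with h | ⟨h1, h2⟩
      · exact Or.inl h
      · right
        refine ⟨by rcases hx n with h | h <;> omega, ?_⟩
        rwa [localTime_succ, if_neg (by rcases hx n with h | h <;> omega), add_zero]

/-- At `c` the decision is a race between the two residualClocks clocks. -/
lemma goesLeft_iff_residual {n : ℕ} (hn : x n = c) : GoesLeft w c ζ x n ↔
    w (localTime x n (c + 1)) * (w (localTime x n (c - 1)))⁻¹ * (residualClocks w c ζ x n).1 ≤
      (residualClocks w c ζ x n).2 := by
  have h1 : alarm w (fun i => ζ (c, i, false)) x c (c - 1) n = clockTime w c ζ x n +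
      (residualClocks w c ζ x n).1 * (w (localTime x n (c - 1)))⁻¹ := by
    rcases residual_fst hpos hx (c := c) (ζ := ζ) n with ⟨h1, h2⟩ | ⟨-, h⟩
    · rw [alarm, h1, h2]
    · exact h
  have h2 : alarm w (fun i => ζ (c, i, true)) x c (c + 1) n = clockTime w c ζ x n +
      (residualClocks w c ζ x n).2 * (w (localTime x n (c + 1)))⁻¹ := by
    rcases residual_snd hpos hx (c := c) (ζ := ζ) n with ⟨h1, h2⟩ | ⟨-, h⟩
    · rw [alarm, h1, h2]
    · exact h
  rw [GoesLeft, if_pos hn, h1, h2, add_le_add_iff_left, ← div_eq_mul_inv _ (w (localTime x n (c + 1))),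
    le_div_iff₀ (hpos _)]
  apply Iff.of_eq
  congr 1
  ring

omit hx in
lemma goesLeft_iff_of_ne {n : ℕ} (hn : x n ≠ c) : GoesLeft w c ζ x n ↔
    w (localTime x n (x n + 1)) * (w (localTime x n (x n - 1)))⁻¹ *
      ζ (x n, localTime x n (x n), false) ≤ ζ (x n, localTime x n (x n), true) := by
  rw [GoesLeft, if_neg hn, ← div_eq_mul_inv _ (w (localTime x n (x n + 1))), le_div_iff₀ (hpos _)]
  apply Iff.of_eq
  congr 1
  ring

end Residual

/-- The decisions prescribed by the clocks along the path `x` agree with `x` up to time `n`. -/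
def DrivenUntil (w : ℕ → ℝ) (c : ℤ) (x : ℕ → ℤ) (n : ℕ) : Set (ℤ × ℕ × Bool → ℝ) :=
  {ζ | ∀ k < n, GoesLeft w c ζ x k ↔ x (k + 1) = x k - 1}

/-- The probability that the walk makes its next step as the path `x` at time `n`. -/
noncomputable def stepProb (w : ℕ → ℝ) (x : ℕ → ℤ) (n : ℕ) : ℝ :=
  w (localTime x n (x (n + 1))) / (w (localTime x n (x n + 1)) + w (localTime x n (x n - 1)))

section Law

variable {w : ℕ → ℝ} (hpos : ∀ n, 0 < w n) {c : ℤ} {x : ℕ → ℤ} (hx : IsNearestNeighbor x)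

lemma measurable_residual (w : ℕ → ℝ) (c : ℤ) (x : ℕ → ℤ) (n : ℕ) :
    Measurable fun ζ => residualClocks w c ζ x n := by
  induction n with
  | zero => simp only [residualClocks]; fun_prop
  | succ n ih =>
    simp only [residualClocks]
    split_ifs
    · exact (measurable_pi_apply _).prodMk (ih.snd.sub (ih.fst.const_mul _))
    · exact (ih.fst.sub (ih.snd.const_mul _)).prodMk (measurable_pi_apply _)
    · exact ih

include hpos hx

lemma measurableSet_goesLeft (n : ℕ) : MeasurableSet {ζ | GoesLeft w c ζ x n} := by
  by_cases hn : x n = c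
  · simp_rw [goesLeft_iff_residual hpos hx hn]
    exact measurableSet_le ((measurable_residual w c x n).fst.const_mul _)
      (measurable_residual w c x n).snd
  · simp_rw [goesLeft_iff_of_ne hpos hn]
    exact measurableSet_le ((measurable_pi_apply _).const_mul _) (measurable_pi_apply _)

lemma measurableSet_drivenUntil (n : ℕ) : MeasurableSet (DrivenUntil w c x n) := by
  have : DrivenUntil w c x n = ⋂ k, ⋂ (_ : k < n), {ζ | GoesLeft w c ζ x k ↔ x (k + 1) = x k - 1} := by
    ext; simp [DrivenUntil]
  rw [this]
  refine MeasurableSet.iInter fun k => MeasurableSet.iInter fun _ => ?_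
  by_cases h : x (k + 1) = x k - 1
  · simpa [h] using measurableSet_goesLeft hpos hx k
  · simp only [h, iff_false]
    exact (measurableSet_goesLeft hpos hx k).compl

omit hpos hx in
lemma drivenUntil_succ (n : ℕ) : DrivenUntil w c x (n + 1) =
    DrivenUntil w c x n ∩ {ζ | GoesLeft w c ζ x n ↔ x (n + 1) = x n - 1} := by
  ext ζ
  simp only [DrivenUntil, Set.mem_inter_iff, Set.mem_ofPred_eq]
  exact ⟨fun h => ⟨fun k hk => h k (by omega), h n (by omega)⟩, fun h k hk => by
    rcases Nat.lt_succ_iff_lt_or_eq.1 hk with h' | rfl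
    exacts [h.1 k h', h.2]⟩

/-- Two families of clocks that agree on the clocks used by the path `x` until time `n`. -/
def AgreeUntil (c : ℤ) (x : ℕ → ℤ) (n : ℕ) (ζ ζ' : ℤ × ℕ × Bool → ℝ) : Prop :=
  (∀ k < n, x k ≠ c → ∀ b, ζ (x k, localTime x k (x k), b) = ζ' (x k, localTime x k (x k), b)) ∧
  (∀ m ≤ jumpCount x c (c - 1) n, ζ (c, m, false) = ζ' (c, m, false)) ∧
  (∀ m ≤ jumpCount x c (c + 1) n, ζ (c, m, true) = ζ' (c, m, true))

omit hpos hx in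
lemma AgreeUntil.mono {n m : ℕ} {ζ ζ' : ℤ × ℕ × Bool → ℝ} (h : AgreeUntil c x n ζ ζ') (hmn : m ≤ n) :
    AgreeUntil c x m ζ ζ' :=
  ⟨fun k hk => h.1 k (by omega), fun m' hm' => h.2.1 m' (hm'.trans (jumpCount_mono _ _ _ hmn)),
    fun m' hm' => h.2.2 m' (hm'.trans (jumpCount_mono _ _ _ hmn))⟩

omit hpos hx in
lemma AgreeUntil.residual_eq {n : ℕ} {ζ ζ' : ℤ × ℕ × Bool → ℝ} (h : AgreeUntil c x n ζ ζ') :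
    residualClocks w c ζ x n = residualClocks w c ζ' x n := by
  induction n with
  | zero => simp only [residualClocks, h.2.1 0 (Nat.zero_le _), h.2.2 0 (Nat.zero_le _)]
  | succ n ih =>
    simp only [residualClocks]
    rw [ih (h.mono (Nat.le_succ n)), h.2.1 _ le_rfl, h.2.2 _ le_rfl]

lemma AgreeUntil.mem_iff {n : ℕ} {ζ ζ' : ℤ × ℕ × Bool → ℝ} (h : AgreeUntil c x n ζ ζ') :
    ζ ∈ DrivenUntil w c x n ↔ ζ' ∈ DrivenUntil w c x n := by
  refine forall₂_congr fun k hk => ?_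
  have : GoesLeft w c ζ x k ↔ GoesLeft w c ζ' x k := by
    by_cases hc : x k = c
    · rw [goesLeft_iff_residual hpos hx hc, goesLeft_iff_residual hpos hx hc,
        (h.mono hk.le).residual_eq]
    · rw [goesLeft_iff_of_ne hpos hc, goesLeft_iff_of_ne hpos hc, h.1 k hk hc, h.1 k hk hc]
  rw [this]

omit hpos hx in
lemma agreeUntil_update {n : ℕ} {i : ℤ × ℕ × Bool} {r : ℝ} {ζ : ℤ × ℕ × Bool → ℝ}
    (h1 : ∀ k < n, x k ≠ c → ∀ b, (x k, localTime x k (x k), b) ≠ i)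
    (h2 : ∀ m ≤ jumpCount x c (c - 1) n, (c, m, false) ≠ i)
    (h3 : ∀ m ≤ jumpCount x c (c + 1) n, (c, m, true) ≠ i) :
    AgreeUntil c x n (Function.update ζ i r) ζ :=
  ⟨fun k hk hc b => Function.update_of_ne (h1 k hk hc b) _ _,
    fun m hm => Function.update_of_ne (h2 m hm) _ _, fun m hm => Function.update_of_ne (h3 m hm) _ _⟩

omit hpos hx in
lemma lintegral_resample_two {ι : Type*} [DecidableEq ι] (i j : ι) {f : (ι → ℝ) → ℝ≥0∞}
    (hf : Measurable f) : ∫⁻ ζ, f ζ ∂clockLaw ι = ∫⁻ ζ, ∫⁻ a, ∫⁻ b,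
      f (Function.update (Function.update ζ i a) j b) ∂expLaw ∂expLaw ∂clockLaw ι := by
  rw [lintegral_resample j hf, lintegral_resample i]
  exact (hf.comp (measurable_update_pair j)).lintegral_prod_right'

/-- Given the path up to time `n`, the residualClocks clocks at `c` are independent and exponential. -/
theorem lintegral_drivenUntil (n : ℕ) {F : ℝ × ℝ → ℝ≥0∞} (hF : Measurable F) :
    ∫⁻ ζ, (DrivenUntil w c x n).indicator (fun ζ => F (residualClocks w c ζ x n)) ζ ∂clockLaw _ =
      (∏ k ∈ Finset.range n, ENNReal.ofReal (stepProb w x k)) *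
        ∫⁻ a, ∫⁻ b, F (a, b) ∂expLaw ∂expLaw := by
  have hmeas : ∀ n, ∀ {F : ℝ × ℝ → ℝ≥0∞}, Measurable F → Measurable fun ζ =>
      (DrivenUntil w c x n).indicator (fun ζ => F (residualClocks w c ζ x n)) ζ := fun n F hF =>
    (hF.comp (measurable_residual w c x n)).indicator (measurableSet_drivenUntil hpos hx n)
  induction n generalizing F with
  | zero =>
    have h0 : DrivenUntil w c x 0 = Set.univ := by ext; simp [DrivenUntil]
    rw [h0, Finset.prod_range_zero, one_mul]
    simp only [Set.indicator_univ, residualClocks]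
    rw [lintegral_resample (c, 0, true) (by fun_prop)]
    have : ∀ ζ : ℤ × ℕ × Bool → ℝ, ∫⁻ r, F (Function.update ζ (c, 0, true) r (c, 0, false),
        Function.update ζ (c, 0, true) r (c, 0, true)) ∂expLaw =
        (fun a => ∫⁻ b, F (a, b) ∂expLaw) (ζ (c, 0, false)) := fun ζ => by simp
    simp_rw [this]
    exact (measurePreserving_eval_infinitePi (fun _ => expLaw) _).lintegral_comp
      hF.lintegral_prod_right'
  | succ n ih =>
    set p := w (localTime x n (x n + 1)) with hp
    set m := w (localTime x n (x n - 1)) with hm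
    have hp0 : 0 < p := hpos _
    have hm0 : 0 < m := hpos _
    have hprobL : x (n + 1) = x n - 1 → stepProb w x n = (1 + p * m⁻¹)⁻¹ := fun h => by
      rw [stepProb, h, ← hp, ← hm]; field_simp; ring
    have hprobR : x (n + 1) = x n + 1 → stepProb w x n = (1 + m * p⁻¹)⁻¹ := fun h => by
      rw [stepProb, h, ← hp, ← hm]; field_simp
    have hρ : 0 < p * m⁻¹ := by positivity
    have hρ' : 0 < m * p⁻¹ := by positivity
    rw [Finset.prod_range_succ]
    have hstrict : ∀ a b : ℝ, ¬ p * m⁻¹ * a ≤ b ↔ m * p⁻¹ * b < a := fun a b => by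
      rw [not_le, ← div_eq_mul_inv, ← div_eq_mul_inv, div_mul_eq_mul_div, div_mul_eq_mul_div,
        lt_div_iff₀ hm0, div_lt_iff₀ hp0]
      apply Iff.of_eq; congr 1 <;> ring
    by_cases hc : x n = c
    · rcases hx n with hr | hl
      · have hnl : x (n + 1) ≠ c - 1 := by omega
        -- The clock started by this jump has not been read by the path so far. Integrating it out
        -- first leaves a race of the two residual clocks, after which the remainder of the losing
        -- clock is again exponential.
        set i : ℤ × ℕ × Bool := (c, jumpCount x c (c + 1) n + 1, true) with hi
        have hj : jumpCount x c (c + 1) (n + 1) = jumpCount x c (c + 1) n + 1 := by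
          rw [jumpCount_succ, if_pos (by omega)]
        have hagree : ∀ r (ζ : ℤ × ℕ × Bool → ℝ), AgreeUntil c x n (Function.update ζ i r) ζ :=
          fun r ζ => agreeUntil_update (fun k _ h _ => by simp [hi, h]) (fun m _ => by simp [hi])
            (fun m hm => by simp only [hi, ne_eq, Prod.mk.injEq, true_and, and_true]; omega)
        have hF' : Measurable fun q : ℝ × ℝ => {q : ℝ × ℝ | m * p⁻¹ * q.2 < q.1}.indicator
            (fun q => ∫⁻ b, F (q.1 - m * p⁻¹ * q.2, b) ∂expLaw) q := by
          refine Measurable.indicator ?_ (measurableSet_lt (by fun_prop) (by fun_prop))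
          exact (hF.lintegral_prod_right' (ν := expLaw)).fun_comp (by fun_prop)
        rw [lintegral_resample i (hmeas (n + 1) hF), hprobR hr]
        have hstep : ∀ ζ, ∫⁻ r, (DrivenUntil w c x (n + 1)).indicator
            (fun ζ => F (residualClocks w c ζ x (n + 1))) (Function.update ζ i r) ∂expLaw =
            (DrivenUntil w c x n).indicator (fun ζ =>
              {q : ℝ × ℝ | m * p⁻¹ * q.2 < q.1}.indicator
                (fun q => ∫⁻ b, F (q.1 - m * p⁻¹ * q.2, b) ∂expLaw) (residualClocks w c ζ x n)) ζ :=
          fun ζ => by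
          classical
          simp only [Set.indicator_apply, drivenUntil_succ, Set.mem_inter_iff, Set.mem_ofPred_eq,
            goesLeft_iff_residual hpos hx hc, residualClocks, if_pos hc, if_neg hnl,
            ((hagree _ ζ).mem_iff hpos hx), (hagree _ ζ).residual_eq, hj]
          have e1 : ¬ x (n + 1) = x n - 1 := by omega
          rw [← hc, ← hp, ← hm]
          simp only [e1, iff_false, hstrict]
          by_cases h1 : ζ ∈ DrivenUntil w (x n) x n
          · by_cases h2 : m * p⁻¹ * (residualClocks w (x n) ζ x n).2 <
                (residualClocks w (x n) ζ x n).1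
            · simp only [h1, h2, and_self, if_true]
              refine lintegral_congr fun r => ?_
              rw [hi, hc, Function.update_self]
            · simp [h1, h2]
          · simp [h1]
        rw [lintegral_congr hstep, ih hF']
        rw [lintegral_lintegral_swap hF'.aemeasurable, mul_assoc]
        have hFF : Measurable fun a => ∫⁻ b, F (a, b) ∂expLaw := hF.lintegral_prod_right'
        rw [← lintegral_race_strict hρ' hFF]
        rfl
      · have hnl : x (n + 1) = c - 1 := by omega
        set i : ℤ × ℕ × Bool := (c, jumpCount x c (c - 1) n + 1, false) with hi
        have hj : jumpCount x c (c - 1) (n + 1) = jumpCount x c (c - 1) n + 1 := by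
          rw [jumpCount_succ, if_pos (by omega)]
        have hagree : ∀ r (ζ : ℤ × ℕ × Bool → ℝ), AgreeUntil c x n (Function.update ζ i r) ζ :=
          fun r ζ => agreeUntil_update (fun k _ h _ => by simp [hi, h])
            (fun m hm => by simp only [hi, ne_eq, Prod.mk.injEq, true_and, and_true]; omega)
            (fun m _ => by simp [hi])
        have hswap : Measurable fun b => ∫⁻ a, F (a, b) ∂expLaw := hF.lintegral_prod_left'
        have hF' : Measurable fun q : ℝ × ℝ => {q : ℝ × ℝ | p * m⁻¹ * q.1 ≤ q.2}.indicator
            (fun q => ∫⁻ a, F (a, q.2 - p * m⁻¹ * q.1) ∂expLaw) q := by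
          refine Measurable.indicator ?_ (measurableSet_le (by fun_prop) (by fun_prop))
          exact hswap.fun_comp (by fun_prop)
        rw [lintegral_resample i (hmeas (n + 1) hF), hprobL hl]
        have hstep : ∀ ζ, ∫⁻ r, (DrivenUntil w c x (n + 1)).indicator
            (fun ζ => F (residualClocks w c ζ x (n + 1))) (Function.update ζ i r) ∂expLaw =
            (DrivenUntil w c x n).indicator (fun ζ =>
              {q : ℝ × ℝ | p * m⁻¹ * q.1 ≤ q.2}.indicator
                (fun q => ∫⁻ a, F (a, q.2 - p * m⁻¹ * q.1) ∂expLaw) (residualClocks w c ζ x n)) ζ :=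
          fun ζ => by
          classical
          simp only [Set.indicator_apply, drivenUntil_succ, Set.mem_inter_iff, Set.mem_ofPred_eq,
            goesLeft_iff_residual hpos hx hc, residualClocks, if_pos hc, if_pos hnl,
            ((hagree _ ζ).mem_iff hpos hx), (hagree _ ζ).residual_eq, hj]
          have e1 : x (n + 1) = x n - 1 := hl
          rw [← hc, ← hp, ← hm]
          simp only [e1, iff_true]
          by_cases h1 : ζ ∈ DrivenUntil w (x n) x n
          · by_cases h2 : p * m⁻¹ * (residualClocks w (x n) ζ x n).1 ≤
                (residualClocks w (x n) ζ x n).2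
            · simp only [h1, h2, and_self, if_true]
              refine lintegral_congr fun r => ?_
              rw [hi, hc, Function.update_self]
            · simp [h1, h2]
          · simp [h1]
        rw [lintegral_congr hstep, ih hF', mul_assoc,
          lintegral_lintegral_swap (f := fun a b => F (a, b)) hF.aemeasurable,
          ← lintegral_race hρ hswap]
        rfl
    -- Away from `c` the two clocks of this visit are fresh and do not enter the residual clocks, so
    -- the integral factors into the past and a single race.
    · set i : ℤ × ℕ × Bool := (x n, localTime x n (x n), false) with hi
      set j : ℤ × ℕ × Bool := (x n, localTime x n (x n), true) with hj
      have hagree : ∀ (b : Bool) r (ζ : ℤ × ℕ × Bool → ℝ),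
          AgreeUntil c x n (Function.update ζ (x n, localTime x n (x n), b) r) ζ := fun b r ζ =>
        agreeUntil_update (fun k hk _ b' h => by
            simp only [Prod.mk.injEq] at h
            have := localTime_lt x hk (y := x n) rfl
            rw [h.1] at h
            omega)
          (fun m _ h => hc (by simp only [Prod.mk.injEq] at h; exact h.1.symm))
          (fun m _ h => hc (by simp only [Prod.mk.injEq] at h; exact h.1.symm))
      have hmem : ∀ ζ a b, Function.update (Function.update ζ i a) j b ∈ DrivenUntil w c x n ↔
          ζ ∈ DrivenUntil w c x n := fun ζ a b =>
        ((hagree true b _).mem_iff hpos hx).trans ((hagree false a ζ).mem_iff hpos hx)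
      have hres : ∀ ζ a b, residualClocks w c (Function.update (Function.update ζ i a) j b) x n =
          residualClocks w c ζ x n := fun ζ a b =>
        (hagree true b _).residual_eq.trans (hagree false a ζ).residual_eq
      have hija : ∀ (ζ : ℤ × ℕ × Bool → ℝ) a b,
          Function.update (Function.update ζ i a) j b i = a := fun ζ a b => by
        rw [Function.update_of_ne (by simp [hi, hj]), Function.update_self]
      have hijb : ∀ (ζ : ℤ × ℕ × Bool → ℝ) a b,
          Function.update (Function.update ζ i a) j b j = b := fun ζ a b => Function.update_self ..
      rw [lintegral_resample_two i j (hmeas (n + 1) hF)]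
      have hfac : ∀ ζ a b, (DrivenUntil w c x (n + 1)).indicator
          (fun ζ => F (residualClocks w c ζ x (n + 1)))
            (Function.update (Function.update ζ i a) j b) =
          (DrivenUntil w c x n).indicator (fun ζ => F (residualClocks w c ζ x n)) ζ *
            {b | p * m⁻¹ * a ≤ b ↔ x (n + 1) = x n - 1}.indicator (fun _ => 1) b := fun ζ a b => by
        classical
        simp only [Set.indicator_apply, drivenUntil_succ, Set.mem_inter_iff, Set.mem_ofPred_eq,
          goesLeft_iff_of_ne hpos hc, residualClocks, if_neg hc, hmem, hres, ← hi, ← hj, hija, hijb,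
          ← hp, ← hm]
        by_cases h1 : ζ ∈ DrivenUntil w c x n <;>
          by_cases h2 : p * m⁻¹ * a ≤ b ↔ x (n + 1) = x n - 1 <;> simp [h1, h2]
      have hms : ∀ a, Measurable ({b | p * m⁻¹ * a ≤ b ↔ x (n + 1) = x n - 1}.indicator
          fun _ => (1 : ℝ≥0∞)) := fun a => by
        refine measurable_const.indicator ?_
        by_cases h : x (n + 1) = x n - 1
        · simp only [h, iff_true]; exact measurableSet_Ici
        · simp only [h, iff_false, not_le]; exact measurableSet_Iio
      have hrace : ∫⁻ a, ∫⁻ b, {b | p * m⁻¹ * a ≤ b ↔ x (n + 1) = x n - 1}.indicator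
          (fun _ => (1 : ℝ≥0∞)) b ∂expLaw ∂expLaw = ENNReal.ofReal (stepProb w x n) := by
        rcases hx n with hr | hl
        · have e1 : ¬ x (n + 1) = x n - 1 := by omega
          simp only [e1, iff_false, hstrict]
          have := lintegral_race_strict hρ' (F := fun _ => 1) measurable_const
          rw [lintegral_const, measure_univ, mul_one, mul_one] at this
          rw [hprobR hr, ← this, lintegral_lintegral_swap]
          · rfl
          · exact (measurable_const.indicator (measurableSet_lt (f := fun q : ℝ × ℝ => m * p⁻¹ * q.2)
              (g := fun q => q.1) (by fun_prop) (by fun_prop))).aemeasurable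
        · simp only [hl, iff_true]
          have := lintegral_race hρ (F := fun _ => 1) measurable_const
          rw [lintegral_const, measure_univ, mul_one, mul_one] at this
          rw [hprobL hl, ← this]
      simp_rw [hfac, lintegral_const_mul _ (hms _)]
      have hmrace : Measurable fun a => ∫⁻ b, {b | p * m⁻¹ * a ≤ b ↔
          x (n + 1) = x n - 1}.indicator (fun _ => (1 : ℝ≥0∞)) b ∂expLaw := by
        refine Measurable.lintegral_prod_right' (f := fun q : ℝ × ℝ =>
          {b | p * m⁻¹ * q.1 ≤ b ↔ x (n + 1) = x n - 1}.indicator (fun _ => (1 : ℝ≥0∞)) q.2) ?_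
        have hs : MeasurableSet {q : ℝ × ℝ | p * m⁻¹ * q.1 ≤ q.2} :=
          measurableSet_le (by fun_prop) (by fun_prop)
        by_cases h : x (n + 1) = x n - 1
        · simp only [h, iff_true]; exact measurable_const.indicator hs
        · simp only [h, iff_false]; exact measurable_const.indicator hs.compl
      simp_rw [lintegral_const_mul _ hmrace, hrace]
      rw [lintegral_mul_const _ (hmeas n hF), ih hF]
      ring

end Law

/-! ### Path space and cylinder sets -/

section PathSpace

/-- A function on paths that depends on the first `n` steps only. -/
def DependsUntil {β : Type*} (n : ℕ) (f : (ℕ → ℤ) → β) : Prop :=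
  ∀ x x' : ℕ → ℤ, (∀ k ≤ n, x k = x' k) → f x = f x'

lemma DependsUntil.exists_eq {β : Type*} {n : ℕ} {f : (ℕ → ℤ) → β} (h : DependsUntil n f) :
    ∃ g : (Fin (n + 1) → ℤ) → β, ∀ x, f x = g fun i => x i :=
  ⟨fun q => f fun k => if hk : k < n + 1 then q ⟨k, hk⟩ else 0, fun x => h _ _ fun k hk => by
    simp [Nat.lt_succ_of_le hk]⟩

/-- Such a function factors through the countable discrete space of finite paths, where every map is
measurable. -/
lemma DependsUntil.measurable_comp {Ω β : Type*} {m : MeasurableSpace Ω} [MeasurableSpace β] {n : ℕ}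
    {f : (ℕ → ℤ) → β} (h : DependsUntil n f) {X : ℕ → Ω → ℤ} (hX : ∀ k ≤ n, Measurable[m] (X k)) :
    Measurable[m] fun ω => f (X · ω) := by
  obtain ⟨g, hg⟩ := h.exists_eq
  simp_rw [hg]
  exact (Measurable.of_discrete (f := g)).comp (measurable_pi_lambda _ fun i => hX i (by omega))

lemma DependsUntil.measurable {β : Type*} [MeasurableSpace β] {n : ℕ} {f : (ℕ → ℤ) → β}
    (h : DependsUntil n f) : Measurable f :=
  h.measurable_comp (X := fun k (x : ℕ → ℤ) => x k) fun k _ => measurable_pi_apply k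

/-- The paths that agree with `q` up to time `n`. -/
def pathCylinder (q : ℕ → ℤ) (n : ℕ) : Set (ℕ → ℤ) := {x | ∀ k ≤ n, x k = q k}

lemma dependsUntil_pathCylinder (q : ℕ → ℤ) (n : ℕ) :
    DependsUntil n fun x : ℕ → ℤ => x ∈ pathCylinder q n := fun x x' h => by
  simp only [pathCylinder, Set.mem_ofPred_eq, eq_iff_iff]
  exact forall₂_congr fun k hk => by rw [h k hk]

lemma measurableSet_pathCylinder (q : ℕ → ℤ) (n : ℕ) : MeasurableSet (pathCylinder q n) := by
  exact measurableSet_setOfPred.2 (dependsUntil_pathCylinder q n).measurable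

lemma DependsUntil.preimage_eq_biUnion {β : Type*} {n : ℕ} {f : (ℕ → ℤ) → β} (h : DependsUntil n f)
    (S : Set β) : f ⁻¹' S = ⋃ q ∈ {q : Fin (n + 1) → ℤ | f (fun k => if hk : k < n + 1 then q ⟨k, hk⟩ else 0) ∈ S},
      pathCylinder (fun k => if hk : k < n + 1 then q ⟨k, hk⟩ else 0) n := by
  ext x
  simp only [Set.mem_preimage, Set.mem_iUnion, pathCylinder, Set.mem_ofPred_eq, exists_prop]
  constructor
  · intro hx
    refine ⟨fun i => x i, ?_, fun k hk => by simp [Nat.lt_succ_of_le hk]⟩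
    rwa [h _ x fun k hk => by simp [Nat.lt_succ_of_le hk]]
  · rintro ⟨q, h1, h2⟩
    rwa [h x _ h2]

lemma generateFrom_pathCylinder : (inferInstance : MeasurableSpace (ℕ → ℤ)) =
    MeasurableSpace.generateFrom {s | s = ∅ ∨ ∃ q n, s = pathCylinder q n} := by
  apply le_antisymm
  · refine iSup_le fun n => ?_
    rintro _ ⟨S, -, rfl⟩
    have h : DependsUntil n fun x : ℕ → ℤ => x n := fun x x' h => h n le_rfl
    have := h.preimage_eq_biUnion S
    rw [this]
    refine MeasurableSet.biUnion (Set.to_countable _) fun q _ => ?_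
    exact MeasurableSpace.measurableSet_generateFrom (Or.inr ⟨_, _, rfl⟩)
  · refine MeasurableSpace.generateFrom_le ?_
    rintro s (rfl | ⟨q, n, rfl⟩)
    · exact MeasurableSet.empty
    · exact measurableSet_pathCylinder q n

/-- The law of a path is determined by the probabilities of its finite beginnings. -/
lemma path_measure_ext {P Q : Measure (ℕ → ℤ)} [IsProbabilityMeasure P] [IsProbabilityMeasure Q]
    (h : ∀ q n, P (pathCylinder q n) = Q (pathCylinder q n)) : P = Q := by
  refine ext_of_generate_finite _ generateFrom_pathCylinder ?_ ?_ (by simp)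
  · rintro s (rfl | ⟨q, n, rfl⟩) t (rfl | ⟨q', n', rfl⟩) ⟨x, hx, hx'⟩
    · exact hx.elim
    · exact hx.elim
    · exact hx'.elim
    · refine Or.inr ⟨x, max n n', ?_⟩
      ext y
      simp only [pathCylinder, Set.mem_inter_iff, Set.mem_ofPred_eq] at hx hx' ⊢
      constructor
      · rintro ⟨h1, h2⟩ k hk
        rcases le_max_iff.1 hk with h' | h'
        · rw [h1 k h', hx k h']
        · rw [h2 k h', hx' k h']
      · intro h1
        exact ⟨fun k hk => by rw [h1 k (by omega), hx k hk],
          fun k hk => by rw [h1 k (by omega), hx' k hk]⟩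
  · rintro s (rfl | ⟨q, n, rfl⟩)
    · simp
    · exact h q n

end PathSpace

/-! ### Transition probabilities of the walk -/

section VRRW

variable {Ω : Type*} [MeasurableSpace Ω] {μ : Measure Ω} [IsProbabilityMeasure μ]
  {w : ℕ → ℝ} (hpos : ∀ n, 0 < w n) {X : ℕ → Ω → ℤ} (hX : IsVRRW μ w X)

/-- The natural filtration of the walk. -/
noncomputable abbrev IsVRRW.filtration (hX : IsVRRW μ w X) : Filtration ℕ ‹MeasurableSpace Ω› :=
  Filtration.natural X hX.stronglyMeasurable

/-- The transition probability from `x n` to `x n + e`, for `e = ±1`. -/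
noncomputable def transProb (w : ℕ → ℝ) (e : ℤ) (x : ℕ → ℤ) (n : ℕ) : ℝ :=
  w (localTime x n (x n + e)) / (w (localTime x n (x n + 1)) + w (localTime x n (x n - 1)))

lemma dependsUntil_transProb (w : ℕ → ℝ) (e : ℤ) (n : ℕ) :
    DependsUntil n fun x => transProb w e x n := fun x x' h => by
  simp only [transProb, h n le_rfl, localTime_congr h]

include hpos in
lemma transProb_nonneg (e : ℤ) (x : ℕ → ℤ) (n : ℕ) : 0 ≤ transProb w e x n :=
  div_nonneg (hpos _).le (add_nonneg (hpos _).le (hpos _).le)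

include hpos in
lemma transProb_add (x : ℕ → ℤ) (n : ℕ) : transProb w 1 x n + transProb w (-1) x n = 1 := by
  rw [transProb, transProb, ← add_div, ← sub_eq_add_neg]
  exact div_self (add_pos (hpos _) (hpos _)).ne'

include hX

omit [IsProbabilityMeasure μ] in
lemma IsVRRW.measurable_of_dependsUntil {β : Type*} [MeasurableSpace β] {n : ℕ}
    {f : (ℕ → ℤ) → β} (h : DependsUntil n f) :
    Measurable[hX.filtration n] fun ω => f (X · ω) :=
  h.measurable_comp fun k hk =>
    ((Filtration.stronglyAdapted_natural hX.stronglyMeasurable k).mono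
      ((hX.filtration).mono hk)).measurable

omit [IsProbabilityMeasure μ] in
lemma IsVRRW.measurableSet_of_dependsUntil {n : ℕ} {p : (ℕ → ℤ) → Prop} (h : DependsUntil n p) :
    MeasurableSet[hX.filtration n] {ω | p (X · ω)} :=
  @measurableSet_setOfPred _ (hX.filtration n) _ |>.2 (hX.measurable_of_dependsUntil h)

omit [IsProbabilityMeasure μ] in
lemma IsVRRW.measurable (n : ℕ) : Measurable (X n) := (hX.stronglyMeasurable n).measurable

omit [IsProbabilityMeasure μ] in
lemma IsVRRW.measurable_path : Measurable fun ω => (X · ω) :=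
  measurable_pi_lambda _ hX.measurable

include hpos

/-- The defining conditional expectation, integrated over an event of the past: the form used for
cylinder probabilities and the one-step equation. -/
lemma IsVRRW.measure_step {e : ℤ} (he : e = 1 ∨ e = -1) {n : ℕ} {A : Set Ω}
    (hA : MeasurableSet[hX.filtration n] A) :
    μ (A ∩ {ω | X (n + 1) ω = X n ω + e}) =
      ∫⁻ ω in A, ENNReal.ofReal (transProb w e (X · ω) n) ∂μ := by
  have hA' := (hX.filtration).le n _ hA
  have hS : MeasurableSet {ω | X (n + 1) ω = X n ω + e} :=
    measurableSet_eq_fun (hX.measurable _) ((hX.measurable n).add_const e)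
  have hce : μ[({ω | X (n + 1) ω = X n ω + e} : Set Ω).indicator (fun _ => (1 : ℝ)) |
      hX.filtration n] =ᵐ[μ] fun ω => transProb w e (X · ω) n := by
    rcases he with rfl | rfl
    · exact hX.step_right n
    · exact hX.step_left n
  have hint : Integrable (({ω | X (n + 1) ω = X n ω + e} : Set Ω).indicator (fun _ => (1 : ℝ))) μ :=
    (integrable_const 1).indicator hS
  have h1 := setIntegral_condExp ((hX.filtration).le n) hint hA
  have hint2 : Integrable (fun ω => transProb w e (X · ω) n) μ := integrable_condExp.congr hce
  rw [setIntegral_congr_ae hA' (hce.mono fun _ h _ => h)] at h1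
  rw [← ofReal_integral_eq_lintegral_ofReal hint2.integrableOn
    (ae_of_all _ fun ω => transProb_nonneg hpos e _ n), h1, integral_indicator hS,
    integral_const, smul_eq_mul, mul_one, measureReal_def, ENNReal.ofReal_toReal (measure_ne_top _ _),
    Measure.restrict_apply_univ, Measure.restrict_apply hS, Set.inter_comm]

lemma IsVRRW.ae_isNearestNeighbor : ∀ᵐ ω ∂μ, X 0 ω = 0 ∧ IsNearestNeighbor (X · ω) := by
  have h : ∀ n, ∀ᵐ ω ∂μ, X (n + 1) ω = X n ω + 1 ∨ X (n + 1) ω = X n ω - 1 := fun n => by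
    have h1 := hX.measure_step hpos (Or.inl rfl) (n := n) MeasurableSet.univ
    have h2 := hX.measure_step hpos (Or.inr rfl) (n := n) MeasurableSet.univ
    rw [Set.univ_inter, Measure.restrict_univ] at h1 h2
    have hS : ∀ e, MeasurableSet {ω | X (n + 1) ω = X n ω + e} := fun e =>
      measurableSet_eq_fun (hX.measurable _) ((hX.measurable n).add_const e)
    have hd : Disjoint {ω | X (n + 1) ω = X n ω + 1} {ω | X (n + 1) ω = X n ω + -1} :=
      Set.disjoint_left.2 fun ω h h' => by
        simp only [Set.mem_ofPred_eq] at h h'; omega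
    have hm : ∀ e, Measurable fun ω => ENNReal.ofReal (transProb w e (X · ω) n) := fun e =>
      ((hX.measurable_of_dependsUntil (dependsUntil_transProb w e n)).mono
        ((hX.filtration).le n) le_rfl).ennreal_ofReal
    have h3 : μ ({ω | X (n + 1) ω = X n ω + 1} ∪ {ω | X (n + 1) ω = X n ω + -1}) = 1 := by
      rw [measure_union hd (hS _), h1, h2, ← lintegral_add_left (hm 1)]
      simp_rw [← ENNReal.ofReal_add (transProb_nonneg hpos 1 _ n) (transProb_nonneg hpos (-1) _ n),
        transProb_add hpos]
      simp
    filter_upwards [(prob_compl_eq_zero_iff ((hS 1).union (hS (-1)))).2 h3] with ω hω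
    simpa [← sub_eq_add_neg] using hω
  filter_upwards [hX.start, ae_all_iff.2 h] with ω h0 h1
  exact ⟨h0, h1⟩

lemma IsVRRW.measure_pathCylinder {q : ℕ → ℤ} (hq0 : q 0 = 0) (hq : IsNearestNeighbor q) (n : ℕ) :
    μ {ω | (X · ω) ∈ pathCylinder q n} =
      ∏ k ∈ Finset.range n, ENNReal.ofReal (stepProb w q k) := by
  induction n with
  | zero =>
    have hm : MeasurableSet {ω | (X · ω) ∈ pathCylinder q 0} :=
      hX.measurable_path (measurableSet_pathCylinder q 0)
    rw [Finset.prod_range_zero, ← prob_compl_eq_zero_iff hm]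
    filter_upwards [hX.start] with ω h
    intro k hk
    obtain rfl : k = 0 := by omega
    exact h.trans hq0.symm
  | succ n ih =>
    set e := q (n + 1) - q n with he
    have he1 : e = 1 ∨ e = -1 := by rcases hq n with h | h <;> omega
    have hA : MeasurableSet[hX.filtration n] {ω | (X · ω) ∈ pathCylinder q n} :=
      hX.measurableSet_of_dependsUntil (dependsUntil_pathCylinder q n)
    have hset : {ω | (X · ω) ∈ pathCylinder q (n + 1)} =
        {ω | (X · ω) ∈ pathCylinder q n} ∩ {ω | X (n + 1) ω = X n ω + e} := by
      ext ω
      simp only [pathCylinder, Set.mem_inter_iff, Set.mem_ofPred_eq]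
      constructor
      · intro h
        exact ⟨fun k hk => h k (by omega), by rw [h (n + 1) le_rfl, h n (by omega)]; omega⟩
      · rintro ⟨h1, h2⟩ k hk
        rcases Nat.lt_succ_iff_lt_or_eq.1 (Nat.lt_succ_of_le hk) with h | rfl
        · exact h1 k (by omega)
        · rw [h2, h1 n le_rfl]; omega
    rw [hset, hX.measure_step hpos he1 hA, Finset.prod_range_succ, ← ih, mul_comm,
      ← setLIntegral_const]
    refine setLIntegral_congr_fun ((hX.filtration).le n _ hA) fun ω hω => ?_
    have hω' : ∀ k ≤ n, X k ω = q k := hω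
    have h1 : ∀ y, localTime (X · ω) n y = localTime q n y := fun y => localTime_congr hω' y
    simp only [transProb, stepProb, h1, hω' n le_rfl]
    congr 4
    omega

end VRRW

/-- Two laws of nearest neighbour paths started at `0` agree as soon as they give the same
probability to all finite beginnings. -/
lemma path_measure_ext_of_isNearestNeighbor {P Q : Measure (ℕ → ℤ)} [IsProbabilityMeasure P]
    [IsProbabilityMeasure Q] (hP : ∀ᵐ x ∂P, x 0 = 0 ∧ IsNearestNeighbor x)
    (hQ : ∀ᵐ x ∂Q, x 0 = 0 ∧ IsNearestNeighbor x)
    (h : ∀ q, q 0 = 0 → IsNearestNeighbor q → ∀ n, P (pathCylinder q n) = Q (pathCylinder q n)) :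
    P = Q := by
  refine path_measure_ext fun q n => ?_
  by_cases hex : ∃ q' ∈ pathCylinder q n, q' 0 = 0 ∧ IsNearestNeighbor q'
  · obtain ⟨q', h1, h2, h3⟩ := hex
    have : pathCylinder q n = pathCylinder q' n := by
      ext x
      simp only [pathCylinder, Set.mem_ofPred_eq] at h1 ⊢
      exact forall₂_congr fun k hk => by rw [h1 k hk]
    rw [this, h q' h2 h3 n]
  · have key : ∀ {ν : Measure (ℕ → ℤ)}, (∀ᵐ x ∂ν, x 0 = 0 ∧ IsNearestNeighbor x) →
        ν (pathCylinder q n) = 0 := fun hR =>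
      measure_mono_null (fun x hx hx' => hex ⟨x, hx, hx'⟩) hR
    rw [key hP, key hQ]

/-! ### The driven path has the law of the walk; balance has probability zero -/

section DrivenPath

open Classical in
/-- The path driven by the clocks `ζ`, stopped at time `n`. -/
noncomputable def drivenHistory (w : ℕ → ℝ) (c : ℤ) (ζ : ℤ × ℕ × Bool → ℝ) : ℕ → ℕ → ℤ
  | 0 => fun _ => 0
  | n + 1 => Function.update (drivenHistory w c ζ n) (n + 1)
      (if GoesLeft w c ζ (drivenHistory w c ζ n) n then drivenHistory w c ζ n n - 1
        else drivenHistory w c ζ n n + 1)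

/-- The path driven by the clocks `ζ`. -/
noncomputable def drivenPath (w : ℕ → ℝ) (c : ℤ) (ζ : ℤ × ℕ × Bool → ℝ) (n : ℕ) : ℤ :=
  drivenHistory w c ζ n n

variable {w : ℕ → ℝ} {c : ℤ} {ζ : ℤ × ℕ × Bool → ℝ}

lemma drivenHistory_eq {n k : ℕ} (hk : k ≤ n) : drivenHistory w c ζ n k = drivenPath w c ζ k := by
  induction n with
  | zero => obtain rfl : k = 0 := by omega
            rfl
  | succ n ih =>
    rcases Nat.le_succ_iff.1 hk with h | rfl
    · rw [drivenHistory, Function.update_of_ne (by omega), ih h]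
    · rfl

lemma goesLeft_congr {x x' : ℕ → ℤ} {n : ℕ} (h : ∀ k ≤ n, x k = x' k) :
    GoesLeft w c ζ x n ↔ GoesLeft w c ζ x' n := by
  have h1 : ∀ k ≤ n, ∀ y, localTime x k y = localTime x' k y := fun k hk =>
    localTime_congr fun l hl => h l (hl.trans hk)
  have h2 : ∀ f y z, alarm w f x y z n = alarm w f x' y z n := fun f y z => by
    rw [alarm, alarm, jumpCount_congr h, h1 n le_rfl, clockSum, clockSum]
    congr 1
    refine Finset.sum_congr rfl fun k hk => ?_
    have hk := Finset.mem_range.1 hk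
    rw [h k hk.le, h (k + 1) hk, h1 k hk.le, jumpCount_congr fun l hl => h l (hl.trans hk.le)]
  simp only [GoesLeft, h n le_rfl, h1 n le_rfl, h2]

lemma isDriven_drivenPath (w : ℕ → ℝ) (c : ℤ) (ζ : ℤ × ℕ × Bool → ℝ) :
    IsDriven w c ζ (drivenPath w c ζ) := by
  classical
  have key : ∀ n, drivenPath w c ζ (n + 1) = if GoesLeft w c ζ (drivenPath w c ζ) n then
      drivenPath w c ζ n - 1 else drivenPath w c ζ n + 1 := fun n => by
    rw [drivenPath, drivenHistory, Function.update_self, drivenHistory_eq le_rfl]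
    simp only [goesLeft_congr (x := drivenHistory w c ζ n) (x' := drivenPath w c ζ) fun k hk =>
      drivenHistory_eq hk]
  exact ⟨rfl, fun n h => by rw [key, if_pos h], fun n h => by rw [key, if_neg h]⟩

lemma drivenPath_mem_pathCylinder {q : ℕ → ℤ} (hq0 : q 0 = 0) (hq : IsNearestNeighbor q) (n : ℕ) :
    drivenPath w c ζ ∈ pathCylinder q n ↔ ζ ∈ DrivenUntil w c q n := by
  have hd := isDriven_drivenPath w c ζ
  constructor
  · intro h k hk
    have hk' : ∀ l ≤ k, drivenPath w c ζ l = q l := fun l hl => h l (by omega)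
    rw [← goesLeft_congr hk', ← h k hk.le, ← h (k + 1) hk]
    exact ⟨hd.left k, fun h' => hd.goesLeft_of rfl h'⟩
  · intro h k
    induction k using Nat.strong_induction_on with
    | _ k ih' =>
      cases k with
      | zero => intro _; rw [hd.start, hq0]
      | succ k =>
        intro hk
        have hk' : ∀ l ≤ k, drivenPath w c ζ l = q l := by
          intro l hl
          exact ih' l (by omega) (by omega)
        have h1 := h k (by omega)
        rw [← goesLeft_congr hk', ← hk' k le_rfl] at h1
        by_cases hg : GoesLeft w c ζ (drivenPath w c ζ) k
        · rw [hd.left k hg, h1.1 hg]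
        · have h2 := fun h' => hg (h1.2 h')
          rw [hd.right k hg, hk' k le_rfl]
          rw [hk' k le_rfl] at h2
          rcases hq k with h' | h'
          · exact h'.symm
          · exact absurd h' h2

/-- The preimage of a cylinder is empty or is `DrivenUntil` along any driven path inside the
cylinder. -/
lemma measurable_drivenPath (hpos : ∀ n, 0 < w n) (c : ℤ) : Measurable (drivenPath w c) := by
  have h : Measurable[_, MeasurableSpace.generateFrom {s | s = ∅ ∨ ∃ q n, s = pathCylinder q n}]
      (drivenPath w c) := by
    refine measurable_generateFrom ?_
    rintro s (rfl | ⟨q, n, rfl⟩)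
    · exact MeasurableSet.empty
    by_cases hex : ∃ ζ, drivenPath w c ζ ∈ pathCylinder q n
    · obtain ⟨ζ, hζ⟩ := hex
      have hd := isDriven_drivenPath w c ζ
      have : drivenPath w c ⁻¹' pathCylinder q n = DrivenUntil w c (drivenPath w c ζ) n := by
        ext ζ'
        rw [← drivenPath_mem_pathCylinder hd.start hd.isNearestNeighbor]
        exact forall₂_congr fun k hk => by rw [hζ k hk]
      rw [this]
      exact measurableSet_drivenUntil hpos hd.isNearestNeighbor n
    · rw [Set.preimage_eq_empty_iff.2]
      · exact MeasurableSet.empty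
      · rw [Set.disjoint_left]
        rintro x hx ⟨ζ, rfl⟩
        exact hex ⟨ζ, hx⟩
  rwa [← generateFrom_pathCylinder] at h

/-- The walk driven by independent exponential clocks is a vertex reinforced random walk. -/
theorem IsVRRW.map_eq {Ω : Type*} [MeasurableSpace Ω] {μ : Measure Ω} [IsProbabilityMeasure μ]
    (hpos : ∀ n, 0 < w n) {X : ℕ → Ω → ℤ} (hX : IsVRRW μ w X) (c : ℤ) :
    μ.map (fun ω => (X · ω)) = (clockLaw _).map (drivenPath w c) := by
  have hm := measurable_drivenPath hpos c
  have := Measure.isProbabilityMeasure_map hX.measurable_path.aemeasurable (μ := μ)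
  have := Measure.isProbabilityMeasure_map hm.aemeasurable (μ := clockLaw _)
  have hms : MeasurableSet {x : ℕ → ℤ | x 0 = 0 ∧ IsNearestNeighbor x} := by
    refine measurableSet_setOfPred.2 (Measurable.and ?_ (Measurable.forall fun n => ?_))
    · exact DependsUntil.measurable (n := 0) fun x x' h => by rw [h 0 le_rfl]
    · exact DependsUntil.measurable (n := n + 1) fun x x' h => by
        rw [h (n + 1) le_rfl, h n (by omega)]
  refine path_measure_ext_of_isNearestNeighbor ?_ ?_ fun q hq0 hq n => ?_
  · exact (ae_map_iff hX.measurable_path.aemeasurable hms).2 (hX.ae_isNearestNeighbor hpos)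
  · refine (ae_map_iff hm.aemeasurable hms).2 (ae_of_all _ fun ζ => ?_)
    have hd := isDriven_drivenPath w c ζ
    exact ⟨hd.start, hd.isNearestNeighbor⟩
  · rw [Measure.map_apply hX.measurable_path (measurableSet_pathCylinder q n),
      Measure.map_apply hm (measurableSet_pathCylinder q n)]
    refine (hX.measure_pathCylinder hpos hq0 hq n).trans ?_
    have h := lintegral_drivenUntil hpos hq (c := c) n (F := fun _ => 1) measurable_const
    rw [lintegral_indicator (measurableSet_drivenUntil hpos hq n)] at h
    simp only [lintegral_const, measure_univ, mul_one, Measure.restrict_apply, MeasurableSet.univ,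
      Set.univ_inter, one_mul] at h
    rw [← h]
    congr 1
    ext ζ
    exact (drivenPath_mem_pathCylinder hq0 hq n).symm

/-- The path jumps infinitely often from `c` to both sides, although its two sides are balanced. -/
def BalancedAt (w : ℕ → ℝ) (c : ℤ) (x : ℕ → ℤ) : Prop :=
  (∃ᶠ n in atTop, x n = c ∧ x (n + 1) = c - 1) ∧ (∃ᶠ n in atTop, x n = c ∧ x (n + 1) = c + 1) ∧
    (FiniteJumpSum w x c (c - 1) ∨ Tendsto (fun n => cumWeight w (localTime x n (c - 1)) -
      cumWeight w (localTime x n (c + 1))) atTop (nhds 0))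

lemma measurable_frequently_jump (y z : ℤ) :
    Measurable fun x : ℕ → ℤ => ∃ᶠ n in atTop, x n = y ∧ x (n + 1) = z := by
  simp only [frequently_atTop]
  refine Measurable.forall fun N => Measurable.exists fun n => ?_
  exact DependsUntil.measurable (n := n + 1) fun x x' h => by
    rw [h (n + 1) le_rfl, h n (by omega)]

lemma measurable_finiteJumpSum (w : ℕ → ℝ) (y z : ℤ) :
    Measurable fun x : ℕ → ℤ => FiniteJumpSum w x y z := by
  have : ∀ x : ℕ → ℤ, FiniteJumpSum w x y z ↔ ∃ K : ℕ, ∀ n, jumpSum w x y z n ≤ K := fun x => by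
    constructor
    · rintro ⟨B, hB⟩
      obtain ⟨K, hK⟩ := exists_nat_ge B
      exact ⟨K, fun n => (hB ⟨n, rfl⟩).trans hK⟩
    · rintro ⟨K, hK⟩
      exact ⟨K, by rintro _ ⟨n, rfl⟩; exact hK n⟩
  simp only [this]
  refine Measurable.exists fun K => Measurable.forall fun n => ?_
  exact DependsUntil.measurable (n := n) fun x x' h => by rw [jumpSum_congr h]

lemma measurableSet_balancedAt (w : ℕ → ℝ) (c : ℤ) : MeasurableSet {x | BalancedAt w c x} := by
  refine measurableSet_setOfPred.2 ((measurable_frequently_jump _ _).and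
    ((measurable_frequently_jump _ _).and ((measurable_finiteJumpSum w _ _).or ?_)))
  refine measurableSet_setOfPred.1 (measurableSet_tendsto _ fun n => ?_)
  exact DependsUntil.measurable (n := n) fun x x' h => by simp only [localTime_congr h]

/-- Almost surely, the two sides of a site from which the walk jumps infinitely often in both
directions are not balanced. -/
theorem IsVRRW.ae_not_balancedAt {Ω : Type*} [MeasurableSpace Ω] {μ : Measure Ω}
    [IsProbabilityMeasure μ] (hpos : ∀ n, 0 < w n) (hmono : Monotone w) {X : ℕ → Ω → ℤ}
    (hX : IsVRRW μ w X) : ∀ᵐ ω ∂μ, ∀ c, ¬ BalancedAt w c (X · ω) := by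
  refine ae_all_iff.2 fun c => ?_
  have hm := measurable_drivenPath hpos c
  have hB := measurableSet_balancedAt w c
  suffices h : ∀ᵐ ζ ∂clockLaw (ℤ × ℕ × Bool), ¬ BalancedAt w c (drivenPath w c ζ) by
    have h1 := (ae_map_iff hm.aemeasurable hB.compl).2 h
    rw [← hX.map_eq hpos c] at h1
    exact (ae_map_iff hX.measurable_path.aemeasurable hB.compl).1 h1
  -- The almost sure properties of the clocks that `driven_exclusion` needs. A natural number bounds
  -- the sums, so that the quantifier is countable.
  set G : Set (ℤ × ℕ × Bool → ℝ) := {ζ | (∀ i, 0 ≤ ζ i) ∧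
    ∃ C : ℕ, ∀ I, ∑ i ∈ Finset.range I, (ζ (c, i, false) - 2) ≤ C} with hG
  have hGm : MeasurableSet G := by
    refine measurableSet_setOfPred.2 (Measurable.and (Measurable.forall fun i => ?_)
      (Measurable.exists fun C => Measurable.forall fun I => ?_))
    · exact measurableSet_setOfPred.1 (measurableSet_le measurable_const (measurable_pi_apply i))
    · exact measurableSet_setOfPred.1 (measurableSet_le (by fun_prop) measurable_const)
  have hGae : ∀ᵐ ζ ∂clockLaw (ℤ × ℕ × Bool), ζ ∈ G := by
    filter_upwards [clockLaw_nonneg, clockLaw_sum_le (j := fun i => ((c, i, false) : ℤ × ℕ × Bool))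
      fun i j h => by simpa using h] with ζ h1 ⟨C, hC⟩
    obtain ⟨K, hK⟩ := exists_nat_ge C
    exact ⟨h1, K, fun I => (hC I).trans hK⟩
  have hnull : clockLaw (ℤ × ℕ × Bool) (G ∩ drivenPath w c ⁻¹' {x | BalancedAt w c x}) = 0 := by
    refine clockLaw_null_of_subsingleton (c, 0, false) (hGm.inter (hm hB)) fun ζ => ?_
    have key : ∀ r s, r < s →
        Function.update ζ (c, 0, false) r ∈ G ∩ drivenPath w c ⁻¹' {x | BalancedAt w c x} →
        Function.update ζ (c, 0, false) s ∈ G ∩ drivenPath w c ⁻¹' {x | BalancedAt w c x} →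
        False := by
      rintro r s hrs ⟨⟨h1, K, hK⟩, h2, h3, h4⟩ ⟨⟨-, K', hK'⟩, h6, -, h7⟩
      exact driven_exclusion hpos hmono h1
        (fun i hi => by rw [Function.update_of_ne hi, Function.update_of_ne hi])
        (by simpa using hrs) (isDriven_drivenPath w c _) (isDriven_drivenPath w c _) h2 h3 h6
        ⟨K, hK⟩ ⟨K', hK'⟩ h4 h7
    intro r hr s hs
    rcases lt_trichotomy r s with h | h | h
    · exact (key r s h hr hs).elim
    · exact h
    · exact (key s r h hs hr).elim
  filter_upwards [hGae, measure_eq_zero_iff_ae_notMem.1 hnull] with ζ h1 h2 h3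
  exact h2 ⟨h1, h3⟩

end DrivenPath

/-! ### One-step equation and the supermartingale bound -/

/-- The path that follows `x` until time `n` and then moves in the direction `e` for ever. -/
def extendPath (x : ℕ → ℤ) (n : ℕ) (e : ℤ) (k : ℕ) : ℤ :=
  if k ≤ n then x k else x n + e * ((k - n : ℕ) : ℤ)

lemma extendPath_of_le {x : ℕ → ℤ} {n k : ℕ} {e : ℤ} (h : k ≤ n) : extendPath x n e k = x k :=
  if_pos h

lemma extendPath_succ (x : ℕ → ℤ) (n : ℕ) (e : ℤ) : extendPath x n e (n + 1) = x n + e := by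
  simp [extendPath]

lemma dependsUntil_extendPath {β : Type*} (f : (ℕ → ℤ) → β) (n : ℕ) (e : ℤ) :
    DependsUntil n fun x => f (extendPath x n e) := fun x x' h => by
  have : extendPath x n e = extendPath x' n e := by
    funext k
    unfold extendPath
    split_ifs with hk
    · exact h k hk
    · rw [h n le_rfl]
  simp only [this]

section OneStep

variable {Ω : Type*} [MeasurableSpace Ω] {μ : Measure Ω} [IsProbabilityMeasure μ]
  {w : ℕ → ℝ} (hpos : ∀ n, 0 < w n) {X : ℕ → Ω → ℤ} (hX : IsVRRW μ w X)

include hpos hX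

lemma IsVRRW.lintegral_step {e : ℤ} (he : e = 1 ∨ e = -1) {n : ℕ} {G : (ℕ → ℤ) → ℝ≥0∞}
    (hG : DependsUntil n G) : ∫⁻ ω in {ω | X (n + 1) ω = X n ω + e}, G (X · ω) ∂μ =
      ∫⁻ ω, ENNReal.ofReal (transProb w e (X · ω) n) * G (X · ω) ∂μ := by
  have hle := (hX.filtration).le n
  have hm := hX.measurable_of_dependsUntil hG
  have hp : Measurable[hX.filtration n] fun ω => ENNReal.ofReal (transProb w e (X · ω) n) :=
    (hX.measurable_of_dependsUntil (dependsUntil_transProb w e n)).ennreal_ofReal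
  have heq : (μ.restrict {ω | X (n + 1) ω = X n ω + e}).trim hle =
      (μ.withDensity fun ω => ENNReal.ofReal (transProb w e (X · ω) n)).trim hle := by
    refine @Measure.ext _ (hX.filtration n) _ _ fun A hA => ?_
    rw [trim_measurableSet_eq hle hA, trim_measurableSet_eq hle hA, Measure.restrict_apply (hle _ hA),
      withDensity_apply _ (hle _ hA), hX.measure_step hpos he hA]
  rw [← lintegral_trim hle hm, heq, lintegral_trim hle hm,
    lintegral_withDensity_eq_lintegral_mul _ (hp.mono hle le_rfl) (hm.mono hle le_rfl)]
  rfl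

/-- The one-step equation. -/
lemma IsVRRW.lintegral_succ {n : ℕ} {H : (ℕ → ℤ) → ℝ≥0∞} (hH : DependsUntil (n + 1) H) :
    ∫⁻ ω, H (X · ω) ∂μ =
      ∫⁻ ω, (ENNReal.ofReal (transProb w 1 (X · ω) n) * H (extendPath (X · ω) n 1) +
        ENNReal.ofReal (transProb w (-1) (X · ω) n) * H (extendPath (X · ω) n (-1))) ∂μ := by
  have hS : ∀ e, MeasurableSet {ω | X (n + 1) ω = X n ω + e} := fun e =>
    measurableSet_eq_fun (hX.measurable _) ((hX.measurable n).add_const e)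
  have hm : ∀ e, Measurable fun ω => H (extendPath (X · ω) n e) := fun e =>
    (hX.measurable_of_dependsUntil (dependsUntil_extendPath H n e)).mono ((hX.filtration).le n) le_rfl
  have hp : ∀ e, Measurable fun ω => ENNReal.ofReal (transProb w e (X · ω) n) := fun e =>
    ((hX.measurable_of_dependsUntil (dependsUntil_transProb w e n)).mono
      ((hX.filtration).le n) le_rfl).ennreal_ofReal
  have hpm : Measurable fun ω => ENNReal.ofReal (transProb w 1 (X · ω) n) *
      H (extendPath (X · ω) n 1) := (hp 1).mul (hm 1)
  rw [lintegral_add_left hpm,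
    ← hX.lintegral_step hpos (Or.inl rfl) (dependsUntil_extendPath H n 1),
    ← hX.lintegral_step hpos (Or.inr rfl) (dependsUntil_extendPath H n (-1)),
    ← lintegral_indicator (hS 1), ← lintegral_indicator (hS (-1)),
    ← lintegral_add_left ((hm 1).indicator (hS 1))]
  refine lintegral_congr_ae ?_
  filter_upwards [hX.ae_isNearestNeighbor hpos] with ω hω'
  have hω := hω'.2
  have key : ∀ e, X (n + 1) ω = X n ω + e → H (X · ω) = H (extendPath (X · ω) n e) := fun e he =>
    hH _ _ fun k hk => by
      rcases Nat.lt_succ_iff_lt_or_eq.1 (Nat.lt_succ_of_le hk) with h | rfl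
      · rw [extendPath_of_le (by omega)]
      · rw [extendPath_succ]; exact he
  have hin : ∀ e e' : ℤ, e ≠ e' → X (n + 1) ω = X n ω + e →
      ω ∈ {ω | X (n + 1) ω = X n ω + e} ∧ ω ∉ {ω | X (n + 1) ω = X n ω + e'} := fun e e' hne h =>
    ⟨h, fun h' => hne (add_left_cancel (h.symm.trans h'))⟩
  rcases hω n with h | h
  · obtain ⟨h1, h2⟩ := hin 1 (-1) (by decide) h
    rw [Set.indicator_of_mem h1, Set.indicator_of_notMem h2, add_zero, key 1 h]
  · obtain ⟨h1, h2⟩ := hin (-1) 1 (by decide) h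
    rw [Set.indicator_of_mem h1, Set.indicator_of_notMem h2, zero_add, key (-1) h]

/-- A supermartingale argument: an event on which a nonnegative potential exceeds `1` is unlikely
if the potential is small at the start and does not grow on average before the event occurs. -/
theorem IsVRRW.exit_bound {n₀ : ℕ} {C : (ℕ → ℤ) → Prop} (hC : DependsUntil n₀ C)
    {B : ℕ → (ℕ → ℤ) → Prop} (hB : ∀ n, DependsUntil n (B n))
    {V : ℕ → (ℕ → ℤ) → ℝ} (hV : ∀ n, DependsUntil n (V n)) (hV0 : ∀ n x, 0 ≤ V n x)
    (hBV : ∀ n x, B n x → 1 ≤ V n x)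
    (hdrift : ∀ n ≥ n₀, ∀ x, IsNearestNeighbor x → x 0 = 0 → C x → (∀ k, n₀ ≤ k → k ≤ n → ¬ B k x) →
      transProb w 1 x n * V (n + 1) (extendPath x n 1) +
        transProb w (-1) x n * V (n + 1) (extendPath x n (-1)) ≤ V n x)
    {ε : ℝ} (hε : ∀ x, IsNearestNeighbor x → x 0 = 0 → C x → V n₀ x ≤ ε) :
    μ {ω | C (X · ω) ∧ ∃ n ≥ n₀, B n (X · ω)} ≤ ENNReal.ofReal ε * μ {ω | C (X · ω)} := by
  classical
  -- The potential restricted to `C` and frozen at `1` once the bad event has occurred. The drift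
  -- condition, required only before that, makes its integral non-increasing, and it dominates the
  -- indicator of the bad event.
  set U : ℕ → (ℕ → ℤ) → ℝ≥0∞ := fun n x => if C x then
    (if ∃ k, n₀ ≤ k ∧ k ≤ n ∧ B k x then 1 else ENNReal.ofReal (V n x)) else 0 with hU
  have hUdep : ∀ n ≥ n₀, DependsUntil n (U n) := fun n hn x x' h => by
    have h1 : C x ↔ C x' := iff_of_eq (hC x x' fun k hk => h k (hk.trans hn))
    have h2 : (∃ k, n₀ ≤ k ∧ k ≤ n ∧ B k x) ↔ ∃ k, n₀ ≤ k ∧ k ≤ n ∧ B k x' :=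
      exists_congr fun k => and_congr_right fun _ => and_congr_right fun hk =>
        iff_of_eq (hB k x x' fun l hl => h l (hl.trans hk))
    simp only [hU, h1, h2, hV n x x' h]
  have hdec : ∀ n ≥ n₀, ∫⁻ ω, U (n + 1) (X · ω) ∂μ ≤ ∫⁻ ω, U n (X · ω) ∂μ := fun n hn => by
    rw [hX.lintegral_succ hpos (hUdep (n + 1) (by omega))]
    refine lintegral_mono_ae ?_
    filter_upwards [hX.ae_isNearestNeighbor hpos] with ω hω'
    obtain ⟨h0, hω⟩ := hω'
    set x : ℕ → ℤ := (X · ω) with hx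
    have hCe : ∀ e, C (extendPath x n e) ↔ C x := fun e =>
      iff_of_eq (hC _ _ fun k hk => extendPath_of_le (hk.trans hn))
    have hp := transProb_nonneg hpos (w := w) 1 x n
    have hp' := transProb_nonneg hpos (w := w) (-1) x n
    by_cases hCx : C x
    swap
    · simp [hU, hCe, hCx]
    have hle : ∀ e, U (n + 1) (extendPath x n e) ≤ 1 ∨
        U (n + 1) (extendPath x n e) = ENNReal.ofReal (V (n + 1) (extendPath x n e)) := fun e => by
      simp only [hU, hCe, if_pos hCx]
      split_ifs
      · exact Or.inl le_rfl
      · exact Or.inr rfl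
    by_cases hbad : ∃ k, n₀ ≤ k ∧ k ≤ n ∧ B k x
    · have hU1 : ∀ e, U (n + 1) (extendPath x n e) = 1 := fun e => by
        obtain ⟨k, h1, h2, h3⟩ := hbad
        have : ∃ k, n₀ ≤ k ∧ k ≤ n + 1 ∧ B k (extendPath x n e) := ⟨k, h1, by omega, by
          rwa [hB k _ x fun l hl => extendPath_of_le (hl.trans h2)]⟩
        simp only [hU, hCe, if_pos hCx, if_pos this]
      rw [hU1, hU1, mul_one, mul_one, ← ENNReal.ofReal_add hp hp', transProb_add hpos]
      simp [hU, if_pos hCx, if_pos hbad]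
    · have hUn : U n x = ENNReal.ofReal (V n x) := by simp only [hU, if_pos hCx, if_neg hbad]
      have hU1 : ∀ e, U (n + 1) (extendPath x n e) ≤
          ENNReal.ofReal (V (n + 1) (extendPath x n e)) := fun e => by
        simp only [hU, hCe, if_pos hCx]
        split_ifs with hb
        · obtain ⟨k, h1, h2, h3⟩ := hb
          rcases Nat.lt_succ_iff_lt_or_eq.1 (Nat.lt_succ_of_le h2) with h | rfl
          · exact absurd ⟨k, h1, by omega, by
              rwa [hB k _ x fun l hl => extendPath_of_le (by omega)] at h3⟩ hbad
          · exact ENNReal.one_le_ofReal.2 (hBV _ _ h3)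
        · exact le_rfl
      rw [hUn]
      refine le_trans (add_le_add (mul_le_mul_right (hU1 1) _) (mul_le_mul_right (hU1 (-1)) _)) ?_
      rw [← ENNReal.ofReal_mul hp, ← ENNReal.ofReal_mul hp',
        ← ENNReal.ofReal_add (mul_nonneg hp (hV0 _ _)) (mul_nonneg hp' (hV0 _ _))]
      refine ENNReal.ofReal_le_ofReal (hdrift n hn x hω h0 hCx fun k h1 h2 h3 => hbad ⟨k, h1, h2, h3⟩)
  have hdec' : ∀ n ≥ n₀, ∫⁻ ω, U n (X · ω) ∂μ ≤ ∫⁻ ω, U n₀ (X · ω) ∂μ := fun n hn => by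
    induction n, hn using Nat.le_induction with
    | base => exact le_rfl
    | succ n hn ih => exact (hdec n hn).trans ih
  have hCm : MeasurableSet {ω | C (X · ω)} :=
    (hX.filtration).le n₀ _ (hX.measurableSet_of_dependsUntil hC)
  have hstart : ∫⁻ ω, U n₀ (X · ω) ∂μ ≤ ENNReal.ofReal ε * μ {ω | C (X · ω)} := by
    rw [← setLIntegral_const, ← lintegral_indicator hCm]
    refine lintegral_mono_ae ?_
    filter_upwards [hX.ae_isNearestNeighbor hpos] with ω hω'
    obtain ⟨h0, hω⟩ := hω'
    by_cases hCx : C (X · ω)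
    · rw [Set.indicator_of_mem (show ω ∈ {ω | C (X · ω)} from hCx)]
      have h1 := hε _ hω h0 hCx
      simp only [hU, if_pos hCx]
      split_ifs with hb
      · obtain ⟨k, h2, h3, h4⟩ := hb
        obtain rfl : k = n₀ := by omega
        exact ENNReal.one_le_ofReal.2 ((hBV _ _ h4).trans h1)
      · exact ENNReal.ofReal_le_ofReal h1
    · simp [hU, hCx]
  have hS : {ω | C (X · ω) ∧ ∃ n ≥ n₀, B n (X · ω)} =
      ⋃ n, {ω | C (X · ω) ∧ ∃ k, n₀ ≤ k ∧ k ≤ n ∧ B k (X · ω)} := by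
    ext ω
    simp only [Set.mem_iUnion, Set.mem_ofPred_eq]
    constructor
    · rintro ⟨h1, n, h2, h3⟩
      exact ⟨n, h1, n, h2, le_rfl, h3⟩
    · rintro ⟨n, h1, k, h2, -, h3⟩
      exact ⟨h1, k, h2, h3⟩
  have hmono : Monotone fun n => {ω | C (X · ω) ∧ ∃ k, n₀ ≤ k ∧ k ≤ n ∧ B k (X · ω)} :=
    fun m n hmn ω ⟨h1, k, h2, h3, h4⟩ => ⟨h1, k, h2, h3.trans hmn, h4⟩
  rw [hS, hmono.measure_iUnion]
  refine iSup_le fun n => ?_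
  refine le_trans ?_ ((hdec' (max n n₀) (le_max_right _ _)).trans hstart)
  refine le_trans (measure_mono (hmono (le_max_left n n₀))) ?_
  have hm : MeasurableSet {ω | C (X · ω) ∧ ∃ k, n₀ ≤ k ∧ k ≤ max n n₀ ∧ B k (X · ω)} := by
    refine (hX.filtration).le (max n n₀) _ (hX.measurableSet_of_dependsUntil
      (p := fun x => C x ∧ ∃ k, n₀ ≤ k ∧ k ≤ max n n₀ ∧ B k x) fun x x' h => ?_)
    have hCC := hC x x' fun k hk => h k (hk.trans (le_max_right _ _))
    have : (∃ k, n₀ ≤ k ∧ k ≤ max n n₀ ∧ B k x) ↔ ∃ k, n₀ ≤ k ∧ k ≤ max n n₀ ∧ B k x' :=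
      exists_congr fun k => and_congr_right fun _ => and_congr_right fun hk =>
        iff_of_eq (hB k x x' fun l hl => h l (hl.trans hk))
    simp only [hCC, this]
  rw [← lintegral_indicator_one hm]
  refine lintegral_mono fun ω => Set.indicator_le' (s := {ω | C (X · ω) ∧ ∃ k, n₀ ≤ k ∧ k ≤ max n n₀ ∧ B k (X · ω)}) (f := 1)
    (g := fun ω => U (max n n₀) (X · ω)) (fun ω h => ?_) (fun _ _ => zero_le) ω
  have h' : C (X · ω) ∧ ∃ k, n₀ ≤ k ∧ k ≤ max n n₀ ∧ B k (X · ω) := h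
  simp only [hU, if_pos h'.1, if_pos h'.2, Pi.one_apply, le_refl]

end OneStep

/-! ### The martingales of the sites -/

section Martingale

variable {Ω : Type*} [MeasurableSpace Ω] {μ : Measure Ω} [IsProbabilityMeasure μ]
  {w : ℕ → ℝ} (hpos : ∀ n, 0 < w n) (hmono : Monotone w) {X : ℕ → Ω → ℤ} (hX : IsVRRW μ w X)

lemma siteMart_succ (w : ℕ → ℝ) (x : ℕ → ℤ) (y : ℤ) (n : ℕ) :
    siteMart w x y (n + 1) = siteMart w x y n + (if x n = y then
      (if x (n + 1) = x n + 1 then (w (localTime x n (y + 1)))⁻¹ else 0) -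
        (if x (n + 1) = x n - 1 then (w (localTime x n (y - 1)))⁻¹ else 0) else 0) := by
  rw [siteMart, siteMart, jumpSum_succ, jumpSum_succ]
  by_cases h : x n = y
  · simp only [h, true_and, if_true]; ring
  · simp [h]

lemma dependsUntil_siteMart (w : ℕ → ℝ) (y : ℤ) (n : ℕ) :
    DependsUntil n fun x => siteMart w x y n := fun x x' h => by
  simp only [siteMart, jumpSum_congr h]

include hpos hmono in
lemma abs_siteMart_succ_sub_le (x : ℕ → ℤ) (y : ℤ) (n : ℕ) :
    |siteMart w x y (n + 1) - siteMart w x y n| ≤ (w 0)⁻¹ := by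
  rw [siteMart_succ, add_sub_cancel_left]
  have h1 : ∀ k, (w k)⁻¹ ≤ (w 0)⁻¹ := fun k => inv_anti₀ (hpos 0) (hmono (Nat.zero_le k))
  have h2 : ∀ k, 0 < (w k)⁻¹ := fun k => inv_pos.2 (hpos k)
  have h3 := h1 (localTime x n (y + 1))
  have h4 := h1 (localTime x n (y - 1))
  have h5 := h2 (localTime x n (y + 1))
  have h6 := h2 (localTime x n (y - 1))
  rw [abs_le]
  split_ifs <;> constructor <;> linarith

include hpos hmono hX

/-- At `y` a jump to a neighbour has probability proportional to the weight of that neighbour and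
contributes its inverse, so the two sides cancel. -/
lemma IsVRRW.martingale_siteMart (y : ℤ) :
    Martingale (fun n ω => siteMart w (X · ω) y n) hX.filtration μ := by
  have hle := (hX.filtration).le
  have hmeas : ∀ n, Measurable[hX.filtration n] fun ω => siteMart w (X · ω) y n := fun n =>
    hX.measurable_of_dependsUntil (dependsUntil_siteMart w y n)
  refine martingale_of_condExp_sub_eq_zero_nat (fun n => (hmeas n).stronglyMeasurable)
    (fun n => ?_) fun n => ?_
  · refine Integrable.of_bound ((hmeas n).mono (hle n) le_rfl).aestronglyMeasurable (n * (w 0)⁻¹)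
      (ae_of_all _ fun ω => ?_)
    rw [Real.norm_eq_abs]
    induction n with
    | zero => simp [siteMart, jumpSum_zero]
    | succ n ih =>
      have h1 := abs_siteMart_succ_sub_le hpos hmono (X · ω) y n
      have h2 := abs_add_le (siteMart w (X · ω) y (n + 1) - siteMart w (X · ω) y n)
        (siteMart w (X · ω) y n)
      rw [sub_add_cancel] at h2
      push_cast
      linarith
  · set g : ℤ → Ω → ℝ := fun e ω =>
      if X n ω = y then (w (localTime (X · ω) n (y + e)))⁻¹ else 0 with hg
    set S : ℤ → Ω → ℝ := fun e => ({ω | X (n + 1) ω = X n ω + e} : Set Ω).indicator fun _ => (1 : ℝ)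
      with hS
    have hSm : ∀ e, MeasurableSet {ω | X (n + 1) ω = X n ω + e} := fun e =>
      measurableSet_eq_fun (hX.measurable _) ((hX.measurable n).add_const e)
    have hSi : ∀ e, Integrable (S e) μ := fun e => (integrable_const 1).indicator (hSm e)
    have hgm : ∀ e, StronglyMeasurable[hX.filtration n] (g e) := fun e =>
      (hX.measurable_of_dependsUntil (f := fun x => if x n = y then
        (w (localTime x n (y + e)))⁻¹ else 0) fun x x' h => by
          simp only [h n le_rfl, localTime_congr h]).stronglyMeasurable
    have hgb : ∀ e, ∀ᵐ ω ∂μ, ‖g e ω‖ ≤ (w 0)⁻¹ := fun e => ae_of_all _ fun ω => by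
      simp only [hg]
      split_ifs
      · rw [Real.norm_eq_abs, abs_of_pos (inv_pos.2 (hpos _))]
        exact inv_anti₀ (hpos 0) (hmono (Nat.zero_le _))
      · simpa using (hpos 0).le
    have hgi : ∀ e, Integrable (g e * S e) μ := fun e =>
      (hSi e).bdd_mul ((hgm e).mono (hle n)).aestronglyMeasurable (hgb e)
    have hdiff : (fun ω => siteMart w (X · ω) y (n + 1)) - (fun ω => siteMart w (X · ω) y n) =
        g 1 * S 1 - g (-1) * S (-1) := by
      funext ω
      simp only [Pi.sub_apply, Pi.mul_apply, siteMart_succ, add_sub_cancel_left, hg, hS,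
        Set.indicator_apply, Set.mem_ofPred_eq, ← sub_eq_add_neg]
      by_cases h : X n ω = y <;> simp [h]
    have hce : ∀ e, e = 1 ∨ e = -1 →
        μ[S e | hX.filtration n] =ᵐ[μ] fun ω => transProb w e (X · ω) n := by
      rintro e (rfl | rfl)
      · exact hX.step_right n
      · exact hX.step_left n
    have hc : ∀ e, e = 1 ∨ e = -1 → μ[g e * S e | hX.filtration n] =ᵐ[μ]
        fun ω => g e ω * transProb w e (X · ω) n := fun e he =>
      (condExp_stronglyMeasurable_mul_of_bound (hle n) (hgm e) (hSi e) _ (hgb e)).trans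
        ((hce e he).mono fun ω h => by simp only [Pi.mul_apply, h])
    rw [hdiff]
    refine (condExp_sub (hgi 1) (hgi (-1)) _).trans ?_
    filter_upwards [hc 1 (Or.inl rfl), hc (-1) (Or.inr rfl)] with ω h1 h2
    rw [Pi.sub_apply, h1, h2, Pi.zero_apply]
    simp only [hg]
    split_ifs with h
    · simp only [transProb, h]
      have e1 := (hpos (localTime (X · ω) n (y + 1))).ne'
      have e2 := (hpos (localTime (X · ω) n (y + -1))).ne'
      field_simp
      simp
    · simp

/-- Bounded increments suffice for this, so it holds without any critical series converging. -/
lemma IsVRRW.ae_martDichotomy : ∀ᵐ ω ∂μ, MartDichotomy w (X · ω) :=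
  ae_all_iff.2 fun y => (hX.martingale_siteMart hpos hmono y).bddAbove_range_iff_bddBelow_range
    (R := ⟨(w 0)⁻¹, (inv_pos.2 (hpos 0)).le⟩)
    (ae_of_all _ fun ω n => abs_siteMart_succ_sub_le hpos hmono (X · ω) y n)

lemma IsVRRW.ae_tendsto_of_bounded
    (hb : ∀ᵐ ω ∂μ, ∀ y, ∃ K, ∀ n, |siteMart w (X · ω) y n| ≤ K) :
    ∀ᵐ ω ∂μ, ∀ y, ∃ l, Tendsto (siteMart w (X · ω) y) atTop (nhds l) := by
  refine ae_all_iff.2 fun y => ?_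
  filter_upwards [hb, (hX.martingale_siteMart hpos hmono y).submartingale.bddAbove_iff_exists_tendsto
    (R := ⟨(w 0)⁻¹, (inv_pos.2 (hpos 0)).le⟩)
    (ae_of_all _ fun ω n => abs_siteMart_succ_sub_le hpos hmono (X · ω) y n)] with ω h1 h2
  obtain ⟨K, hK⟩ := h1 y
  exact h2.1 ⟨K, by rintro _ ⟨n, rfl⟩; exact (le_abs_self _).trans (hK n)⟩

end Martingale

/-! ### Potentials for the martingales and for exits -/

section Tail

/-- The tail `∑_{j ≥ z} f j` of a series. -/
noncomputable def tailSum (f : ℕ → ℝ) (z : ℕ) : ℝ := ∑' j, f (j + z)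

variable {f : ℕ → ℝ} (hf0 : ∀ j, 0 ≤ f j) (hf : Summable f)

include hf in
lemma tailSum_eq (z : ℕ) : tailSum f z = f z + tailSum f (z + 1) := by
  rw [tailSum, ((summable_nat_add_iff z).2 hf).tsum_eq_zero_add, zero_add]
  congr 1
  exact tsum_congr fun j => by congr 1; omega

include hf0 in
lemma tailSum_nonneg (z : ℕ) : 0 ≤ tailSum f z := tsum_nonneg fun _ => hf0 _

include hf0 hf in
lemma tailSum_anti : Antitone (tailSum f) := antitone_nat_of_succ_le fun z => by
  rw [tailSum_eq hf z]; linarith [hf0 z]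

lemma tailSum_tendsto (f : ℕ → ℝ) : Tendsto (tailSum f) atTop (nhds 0) := tendsto_sum_nat_add f

end Tail

lemma localTime_extendPath_succ (x : ℕ → ℤ) (n : ℕ) (e z : ℤ) :
    localTime (extendPath x n e) (n + 1) z = localTime x n z + if x n + e = z then 1 else 0 := by
  rw [localTime_succ, extendPath_succ, localTime_congr fun k hk => extendPath_of_le hk]

section Potential

variable {w : ℕ → ℝ} (hpos : ∀ n, 0 < w n) (x : ℕ → ℤ) (n : ℕ)

/-- Squared displacement of the martingale of `y` plus a bound for its future quadratic variation. -/
noncomputable def martPotential (w : ℕ → ℝ) (y : ℤ) (m : ℝ) (n : ℕ) (x : ℕ → ℤ) : ℝ :=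
  (siteMart w x y n - m) ^ 2 + tailSum (fun j => ((w j)⁻¹) ^ 2) (localTime x n (y + 1)) +
    tailSum (fun j => ((w j)⁻¹) ^ 2) (localTime x n (y - 1))

/-- A bound for the probability of ever jumping to the unvisited site `z`, if the probability to do
so on the `j`-th visit to its neighbour `s` is at most `e j`. -/
noncomputable def exitPotential (e : ℕ → ℝ) (s z : ℤ) (n : ℕ) (x : ℕ → ℤ) : ℝ :=
  if 0 < localTime x n z then 1 else tailSum e (localTime x n s + if x n = s then 0 else 1)

lemma dependsUntil_exitPotential (e : ℕ → ℝ) (s z : ℤ) (n : ℕ) :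
    DependsUntil n (exitPotential e s z n) := fun x x' h => by
  simp only [exitPotential, h n le_rfl, localTime_congr h]

lemma martPotential_nonneg (w : ℕ → ℝ) (y : ℤ) (m : ℝ) (n : ℕ) (x : ℕ → ℤ) :
    0 ≤ martPotential w y m n x :=
  add_nonneg (add_nonneg (sq_nonneg _) (tailSum_nonneg (fun _ => sq_nonneg _) _))
    (tailSum_nonneg (fun _ => sq_nonneg _) _)

lemma exitPotential_nonneg {e : ℕ → ℝ} (he : ∀ j, 0 ≤ e j) (s z : ℤ) (n : ℕ) (x : ℕ → ℤ) :
    0 ≤ exitPotential e s z n x := by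
  unfold exitPotential
  split_ifs
  · exact zero_le_one
  · exact tailSum_nonneg he _
  · exact tailSum_nonneg he _

include hpos

lemma transProb_nonneg_add : 0 ≤ transProb w 1 x n ∧ 0 ≤ transProb w (-1) x n ∧
    transProb w 1 x n + transProb w (-1) x n = 1 :=
  ⟨transProb_nonneg hpos 1 x n, transProb_nonneg hpos (-1) x n, transProb_add hpos x n⟩

/-- A jump from `y` to a neighbour adds to the square exactly the term that leaves the tail of that
neighbour, and the cross term averages to zero by `hbal`. Away from `y` only the tails change, and
they shrink. -/
lemma martPotential_drift (hsq : Summable fun j => ((w j)⁻¹) ^ 2) (y : ℤ) (m : ℝ) :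
    transProb w 1 x n * martPotential w y m (n + 1) (extendPath x n 1) +
      transProb w (-1) x n * martPotential w y m (n + 1) (extendPath x n (-1)) ≤
      martPotential w y m n x := by
  obtain ⟨hp, hq, hpq⟩ := transProb_nonneg_add hpos x n
  have hM : ∀ e, siteMart w (extendPath x n e) y n = siteMart w x y n := fun e =>
    dependsUntil_siteMart w y n _ _ fun k hk => extendPath_of_le hk
  have hZ : ∀ e z, localTime (extendPath x n e) n z = localTime x n z := fun e z =>
    localTime_congr (fun k hk => extendPath_of_le hk) z
  have hanti := tailSum_anti (f := fun j => ((w j)⁻¹) ^ 2) (fun j => sq_nonneg _) hsq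
  simp only [martPotential, siteMart_succ, localTime_extendPath_succ, hM, hZ, extendPath_succ,
    extendPath_of_le le_rfl]
  by_cases hy : x n = y
  · have e1 : ¬ (y + 1 = y - 1) := by omega
    have e2 : ¬ (y + -1 = y + 1) := by omega
    have e3 : y + -1 = y - 1 := by omega
    simp only [hy, if_true, e1, if_false, e3, show ¬ (y - 1 = y + 1) by omega]
    have t1 := tailSum_eq hsq (localTime x n (y + 1))
    have t2 := tailSum_eq hsq (localTime x n (y - 1))
    have hbal : transProb w 1 x n * (w (localTime x n (y + 1)))⁻¹ =
        transProb w (-1) x n * (w (localTime x n (y - 1)))⁻¹ := by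
      simp only [transProb, hy, e3]
      have := (hpos (localTime x n (y + 1))).ne'
      have := (hpos (localTime x n (y - 1))).ne'
      field_simp
    simp only [add_zero, sub_zero, zero_sub]
    rw [t1, t2]
    set a := (w (localTime x n (y + 1)))⁻¹
    set b := (w (localTime x n (y - 1)))⁻¹
    set T := tailSum (fun j => ((w j)⁻¹) ^ 2) (localTime x n (y + 1) + 1)
    set T' := tailSum (fun j => ((w j)⁻¹) ^ 2) (localTime x n (y - 1) + 1)
    have hq' : transProb w (-1) x n = 1 - transProb w 1 x n := by linarith
    rw [hq'] at hbal ⊢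
    apply le_of_eq
    have : transProb w 1 x n * ((siteMart w x y n + a - m) ^ 2 + T + (b ^ 2 + T')) +
        (1 - transProb w 1 x n) * ((siteMart w x y n + -b - m) ^ 2 + (a ^ 2 + T) + T') -
        ((siteMart w x y n - m) ^ 2 + (a ^ 2 + T) + (b ^ 2 + T')) =
        2 * (siteMart w x y n - m) * (transProb w 1 x n * a - (1 - transProb w 1 x n) * b) := by ring
    rw [hbal, sub_self, mul_zero] at this
    linarith
  · simp only [if_neg hy, add_zero]
    have key : ∀ e : ℤ, (siteMart w x y n - m) ^ 2 +
        tailSum (fun j => ((w j)⁻¹) ^ 2) (localTime x n (y + 1) + if x n + e = y + 1 then 1 else 0) +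
        tailSum (fun j => ((w j)⁻¹) ^ 2) (localTime x n (y - 1) + if x n + e = y - 1 then 1 else 0) ≤
        (siteMart w x y n - m) ^ 2 + tailSum (fun j => ((w j)⁻¹) ^ 2) (localTime x n (y + 1)) +
        tailSum (fun j => ((w j)⁻¹) ^ 2) (localTime x n (y - 1)) := fun e => by
      have := hanti (Nat.le_add_right (localTime x n (y + 1)) (if x n + e = y + 1 then 1 else 0))
      have := hanti (Nat.le_add_right (localTime x n (y - 1)) (if x n + e = y - 1 then 1 else 0))
      linarith
    refine (add_le_add (mul_le_mul_of_nonneg_left (key 1) hp)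
      (mul_le_mul_of_nonneg_left (key (-1)) hq)).trans ?_
    rw [← add_mul, hpq, one_mul]

/-- On the `j`-th visit to `s` the tail gives up its term `e j`, which pays for the potential `1`
reached with probability at most `e j`. The condition `hne` rules out entering `z` from the far
side. -/
lemma exitPotential_drift {e : ℕ → ℝ} (he0 : ∀ j, 0 ≤ e j) (he : Summable e) {s z δ : ℤ}
    (hδ : δ = 1 ∨ δ = -1) (hz : z = s + δ) (hfresh : localTime x n z = 0) (hne : x n ≠ z + δ)
    (hexit : x n = s → transProb w δ x n ≤ e (localTime x n s)) :
    transProb w 1 x n * exitPotential e s z (n + 1) (extendPath x n 1) +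
      transProb w (-1) x n * exitPotential e s z (n + 1) (extendPath x n (-1)) ≤
      exitPotential e s z n x := by
  obtain ⟨hp, hq, hpq⟩ := transProb_nonneg_add hpos x n
  have hnz : x n ≠ z := fun h => by have := localTime_pos x h; omega
  have hx0 : exitPotential e s z n x = tailSum e (localTime x n s + if x n = s then 0 else 1) := by
    rw [exitPotential, if_neg (by omega)]
  rw [hx0]
  have hval : ∀ ε : ℤ, ε = 1 ∨ ε = -1 → x n + ε ≠ z →
      exitPotential e s z (n + 1) (extendPath x n ε) = tailSum e (localTime x n s + 1) := fun ε _ h => by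
    rw [exitPotential, localTime_extendPath_succ, localTime_extendPath_succ, extendPath_succ, hfresh,
      if_neg h, if_neg (by omega)]
    congr 1
    split_ifs <;> omega
  by_cases hs : x n = s
  · have h1 : exitPotential e s z (n + 1) (extendPath x n δ) = 1 := by
      rw [exitPotential, localTime_extendPath_succ, if_pos (by rw [if_pos (by omega)]; omega)]
    rw [if_pos hs, add_zero, tailSum_eq he]
    have h2 := hexit hs
    have h3 := tailSum_nonneg he0 (localTime x n s + 1)
    rcases hδ with rfl | rfl
    · rw [h1, hval (-1) (Or.inr rfl) (by omega)]
      nlinarith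
    · rw [h1, hval 1 (Or.inl rfl) (by omega)]
      nlinarith
  · rw [hval 1 (Or.inl rfl) (by omega), hval (-1) (Or.inr rfl) (by omega), if_neg hs, ← add_mul, hpq,
      one_mul]

end Potential

section PathFacts

variable {x : ℕ → ℤ}

lemma jumpSum_eq_zero_of_localTime_eq_zero (w : ℕ → ℝ) {y : ℤ} {n : ℕ} (h : localTime x n y = 0)
    (z : ℤ) : jumpSum w x y z n = 0 := by
  refine Finset.sum_eq_zero fun k hk => if_neg fun h' => ?_
  have h1 := localTime_pos x h'.1
  have h2 := localTime_mono x y (Finset.mem_range.1 hk).le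
  simp only at h2
  omega

lemma sites_nonempty_of_eventually_mem {a b : ℤ} (h : ∀ᶠ n in atTop, x n ∈ Set.Icc a b) :
    (sitesVisitedInfinitelyOften x).Nonempty ∧ sitesVisitedInfinitelyOften x ⊆ Set.Icc a b := by
  constructor
  · by_contra hcon
    have h1 : ∀ y ∈ Set.Icc a b, ∀ᶠ n in atTop, x n ≠ y := fun y _ => by
      by_contra h2
      exact hcon ⟨y, h2⟩
    have h2 := (eventually_all_finite (Set.finite_Icc a b)).2 h1
    obtain ⟨n, h3, h4⟩ := (h.and h2).exists
    exact h4 _ h3 rfl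
  · intro y hy
    obtain ⟨n, h1, h2⟩ := (Filter.Frequently.and_eventually hy h).exists
    rwa [← h1]

lemma mem_Icc_of_localTime_eq_zero (hx : IsNearestNeighbor x) {a b : ℤ} {n : ℕ} (h0 : x 0 ∈ Set.Icc a b)
    (ha : localTime x n (a - 1) = 0) (hb : localTime x n (b + 1) = 0) : ∀ k ≤ n, x k ∈ Set.Icc a b := by
  intro k
  induction k with
  | zero => exact fun _ => h0
  | succ k ih =>
    intro hk
    have h1 := ih (by omega)
    have h2 : ∀ y, localTime x n y = 0 → x (k + 1) ≠ y := fun y hy h => by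
      have h3 := localTime_pos x h
      have h4 := localTime_mono x y hk
      simp only at h4
      omega
    have h3 := h2 _ ha
    have h4 := h2 _ hb
    have h5 := h1.1
    have h6 := h1.2
    constructor <;> rcases hx k with h | h <;> omega

lemma encard_Icc_int (a b : ℤ) : (Set.Icc a b).encard = ((b + 1 - a).toNat : ℕ∞) := by
  rw [← Finset.coe_Icc, Set.encard_coe_eq_coe_finsetCard, Int.card_Icc]

lemma transProb_le {w : ℕ → ℝ} (hpos : ∀ n, 0 < w n) (hmono : Monotone w) {δ : ℤ}
    (hδ : δ = 1 ∨ δ = -1) {n v : ℕ} (h : localTime x n (x n + δ) = 0)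
    (hv : v ≤ localTime x n (x n - δ)) : transProb w δ x n ≤ w 0 * (w v)⁻¹ := by
  have key : ∀ a b : ℝ, a = w 0 → w v ≤ b → a / (a + b) ≤ w 0 * (w v)⁻¹ := fun a b ha hb => by
    rw [ha, div_eq_mul_inv]
    exact mul_le_mul_of_nonneg_left (inv_anti₀ (hpos v) (by linarith [hpos 0])) (hpos 0).le
  rcases hδ with rfl | rfl
  · exact key _ _ (by rw [h]) (hmono hv)
  · rw [transProb, add_comm (w _) (w _)]
    simp only [sub_neg_eq_add] at hv
    rw [← sub_eq_add_neg]
    exact key _ _ (by rw [sub_eq_add_neg, h]) (hmono hv)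

end PathFacts

section Bounded

variable {Ω : Type*} [MeasurableSpace Ω] {μ : Measure Ω} [IsProbabilityMeasure μ]
  {w : ℕ → ℝ} (hpos : ∀ n, 0 < w n) {X : ℕ → Ω → ℤ} (hX : IsVRRW μ w X)

lemma dependsUntil_martPotential (w : ℕ → ℝ) (y : ℤ) (m : ℝ) (n : ℕ) :
    DependsUntil n (martPotential w y m n) := fun x x' h => by
  simp only [martPotential, siteMart, jumpSum_congr h, localTime_congr h]

lemma martPotential_ge {w : ℕ → ℝ} {y : ℤ} {m K : ℝ} (hK : 0 < K) {n : ℕ} {x : ℕ → ℤ}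
    (h : K ≤ |siteMart w x y n - m|) : 1 ≤ martPotential w y m n x / K ^ 2 := by
  rw [le_div_iff₀ (by positivity), one_mul, martPotential]
  have h1 := pow_le_pow_left₀ hK.le h 2
  rw [sq_abs] at h1
  have h2 := tailSum_nonneg (f := fun j => ((w j)⁻¹) ^ 2) (fun _ => sq_nonneg _)
    (localTime x n (y + 1))
  have h3 := tailSum_nonneg (f := fun j => ((w j)⁻¹) ^ 2) (fun _ => sq_nonneg _)
    (localTime x n (y - 1))
  linarith

lemma martPotential_start_le (w : ℕ → ℝ) (hsq : Summable fun j => ((w j)⁻¹) ^ 2) (y : ℤ) (n : ℕ)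
    (x : ℕ → ℤ) : martPotential w y (siteMart w x y n) n x ≤ 2 * tailSum (fun j => ((w j)⁻¹) ^ 2) 0 := by
  have hanti := tailSum_anti (f := fun j => ((w j)⁻¹) ^ 2) (fun _ => sq_nonneg _) hsq
  have h1 := hanti (Nat.zero_le (localTime x n (y + 1)))
  have h2 := hanti (Nat.zero_le (localTime x n (y - 1)))
  rw [martPotential, sub_self]
  linarith

include hpos hX

/-- A maximal inequality: `exit_bound` with `martPotential` divided by `K ^ 2` bounds the
probability of ever reaching height `K` by a constant over `K ^ 2`. -/
lemma IsVRRW.ae_siteMart_bounded (hsq : Summable fun j => ((w j)⁻¹) ^ 2) :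
    ∀ᵐ ω ∂μ, ∀ y, ∃ K, ∀ n, |siteMart w (X · ω) y n| ≤ K := by
  refine ae_all_iff.2 fun y => ?_
  set T := 2 * tailSum (fun j => ((w j)⁻¹) ^ 2) 0
  have hb : ∀ K : ℝ, 0 < K → μ {ω | ∃ n ≥ 0, K ≤ |siteMart w (X · ω) y n|} ≤ ENNReal.ofReal (T / K ^ 2) := by
    intro K hK
    have := hX.exit_bound hpos (n₀ := 0) (C := fun _ => True) (fun _ _ _ => rfl)
      (B := fun n x => K ≤ |siteMart w x y n|) (fun n x x' h => by
        simp only [dependsUntil_siteMart w y n x x' h])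
      (V := fun n x => martPotential w y 0 n x / K ^ 2)
      (fun n x x' h => by simp only [dependsUntil_martPotential w y 0 n x x' h])
      (fun n x => div_nonneg (martPotential_nonneg w y 0 n x) (sq_nonneg K))
      (fun n x h => martPotential_ge hK (by rwa [sub_zero]))
      (fun n _ x _ _ _ _ => by
        rw [← mul_div_assoc, ← mul_div_assoc, ← add_div]
        exact div_le_div_of_nonneg_right (martPotential_drift hpos x n hsq y 0) (sq_nonneg K))
      (ε := T / K ^ 2) (fun x _ _ _ => by
        refine div_le_div_of_nonneg_right ?_ (sq_nonneg K)
        have := martPotential_start_le w hsq y 0 x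
        rwa [show siteMart w x y 0 = 0 by simp [siteMart, jumpSum_zero]] at this)
    simpa using this
  rw [ae_iff]
  refine le_antisymm (ge_of_tendsto' (x := atTop) (f := fun k : ℕ =>
    ENNReal.ofReal (T / ((k : ℝ) + 1) ^ 2)) ?_ fun k => ?_) zero_le
  · rw [← ENNReal.ofReal_zero]
    refine ENNReal.tendsto_ofReal ?_
    refine Tendsto.div_atTop tendsto_const_nhds ?_
    exact (tendsto_pow_atTop two_ne_zero).comp
      (tendsto_atTop_add_const_right _ _ tendsto_natCast_atTop_atTop)
  · refine le_trans (measure_mono fun ω hω => ?_) (hb ((k : ℝ) + 1) (by positivity))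
    simp only [Set.mem_ofPred_eq, not_exists, not_forall, not_le] at hω ⊢
    obtain ⟨n, hn⟩ := hω ((k : ℝ) + 1)
    exact ⟨n, Nat.zero_le n, hn.le⟩

end Bounded

/-! ### Four sites with positive probability -/

/-- The path `0, 1, 2, 1, 2, …`. -/
def zigzagPath (k : ℕ) : ℤ := if k = 0 then 0 else 2 - ((k % 2 : ℕ) : ℤ)

lemma isNearestNeighbor_zigzagPath : IsNearestNeighbor zigzagPath := fun k => by
  rw [zigzagPath, if_neg (by omega), zigzagPath]
  by_cases h : k = 0
  · rw [if_pos h]; omega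
  · rw [if_neg h]; omega

lemma localTime_zigzagPath (m : ℕ) : localTime zigzagPath (2 * m) 0 = 1 ∧
    localTime zigzagPath (2 * m) 1 = m ∧ localTime zigzagPath (2 * m) 2 = m ∧
    localTime zigzagPath (2 * m) 3 = 0 ∧ localTime zigzagPath (2 * m) 4 = 0 ∧
    localTime zigzagPath (2 * m) (-1) = 0 := by
  induction m with
  | zero => simp [localTime_zero, zigzagPath]
  | succ m ih =>
    have h1 : zigzagPath (2 * m + 1) = 1 := by rw [zigzagPath, if_neg (by omega)]; omega
    have h2 : zigzagPath (2 * m + 1 + 1) = 2 := by rw [zigzagPath, if_neg (by omega)]; omega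
    rw [show 2 * (m + 1) = 2 * m + 1 + 1 by ring]
    simp only [localTime_succ, h1, h2]
    simpa using ih

section StayFour

variable {w : ℕ → ℝ} (hpos : ∀ n, 0 < w n)

include hpos

/-- While the walk stays in `{0, 1, 2, 3}` and the martingales of `1` and `2` move little, the
inner sites are much more visited than the outer ones. -/
lemma inner_dominates {x : ℕ → ℤ} (hx : IsNearestNeighbor x) {C A K : ℝ}
    (hC : ∀ x y z : ℕ, z ≤ x + y + 1 → cumWeight w z ≤ max (cumWeight w x) (cumWeight w y) + C)
    (hC0 : 0 ≤ C) (hA : C ≤ A) {n₀ n : ℕ} (hn : n₀ ≤ n)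
    (hl : localTime x n (-1) = 0) (hr : localTime x n 4 = 0)
    (h1 : |siteMart w x 1 n - siteMart w x 1 n₀| ≤ K)
    (h2 : |siteMart w x 2 n - siteMart w x 2 n₀| ≤ K)
    (h3 : cumWeight w (localTime x n₀ 0) + A + K ≤ cumWeight w (localTime x n₀ 2))
    (h4 : cumWeight w (localTime x n₀ 3) + A + K ≤ cumWeight w (localTime x n₀ 1)) :
    cumWeight w (localTime x n 0) + (A - C) ≤ cumWeight w (localTime x n 1) ∧
      cumWeight w (localTime x n 3) + (A - C) ≤ cumWeight w (localTime x n 2) := by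
  have e0 := cumWeight_localTime_sub (w := w) hx 0 n₀ n
  have e1 := cumWeight_localTime_sub (w := w) hx 1 n₀ n
  have e2 := cumWeight_localTime_sub (w := w) hx 2 n₀ n
  have e3 := cumWeight_localTime_sub (w := w) hx 3 n₀ n
  simp only [siteMart] at h1 h2
  norm_num at e0 e1 e2 e3 h1 h2
  have hl0 : localTime x n₀ (-1) = 0 := by
    have := localTime_mono x (-1) hn; simp only at this; omega
  have hr0 : localTime x n₀ 4 = 0 := by
    have := localTime_mono x 4 hn; simp only at this; omega
  rw [jumpSum_eq_zero_of_localTime_eq_zero w hl, jumpSum_eq_zero_of_localTime_eq_zero w hl0] at e0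
  rw [jumpSum_eq_zero_of_localTime_eq_zero w hr, jumpSum_eq_zero_of_localTime_eq_zero w hr0] at e3
  have m1 := jumpSum_mono (x := x) hpos 0 1 hn
  have m2 := jumpSum_mono (x := x) hpos 3 2 hn
  rw [abs_le] at h1 h2
  -- While `-1` and `4` are unvisited, each of these differences moves with a martingale, up to
  -- inward jumps that only help. The doubling bound `hC` then replaces `2` by `1`, and `1` by `2`,
  -- at the price `C`.
  have d20 : cumWeight w (localTime x n 0) + A ≤ cumWeight w (localTime x n 2) := by linarith
  have d13 : cumWeight w (localTime x n 3) + A ≤ cumWeight w (localTime x n 1) := by linarith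
  have n1 := localTime_le_neighbors' hx 1 n
  have n2 := localTime_le_neighbors' hx 2 n
  norm_num at n1 n2
  have c1 := hC _ _ _ n1
  have c2 := hC _ _ _ n2
  constructor
  · have := le_max_left (cumWeight w (localTime x n 1)) (cumWeight w (localTime x n 3))
    rcases max_choice (cumWeight w (localTime x n 1)) (cumWeight w (localTime x n 3)) with h | h <;>
      rw [h] at c2 <;> linarith
  · rcases max_choice (cumWeight w (localTime x n 0)) (cumWeight w (localTime x n 2)) with h | h <;>
      rw [h] at c1 <;> linarith

end StayFour

section FourSites

variable {Ω : Type*} [MeasurableSpace Ω] {μ : Measure Ω} [IsProbabilityMeasure μ]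
  {w : ℕ → ℝ} (hpos : ∀ n, 0 < w n) (hmono : Monotone w) (hdiv : ¬ Summable (fun n => 1 / w n))
  {X : ℕ → Ω → ℤ} (hX : IsVRRW μ w X) {α : ℝ} (hα : 0 ≤ α) (hs : CriticalSummable w α)

lemma IsVRRW.measure_pathCylinder_pos (hpos : ∀ n, 0 < w n) (hX : IsVRRW μ w X) {q : ℕ → ℤ}
    (hq0 : q 0 = 0) (hq : IsNearestNeighbor q) (n : ℕ) :
    0 < μ {ω | (X · ω) ∈ pathCylinder q n} := by
  rw [hX.measure_pathCylinder hpos hq0 hq]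
  refine pos_iff_ne_zero.2 (Finset.prod_ne_zero_iff.2 fun k _ => ?_)
  exact (ENNReal.ofReal_pos.2 (div_pos (hpos _) (add_pos (hpos _) (hpos _)))).ne'

/-- If the walk has begun as `q`, an event of conditional probability less than one fails with
positive probability. -/
lemma IsVRRW.measure_compl_pos (hpos : ∀ n, 0 < w n) (hX : IsVRRW μ w X) {q : ℕ → ℤ}
    (hq0 : q 0 = 0) (hq : IsNearestNeighbor q) {n₀ : ℕ} {B : ℕ → (ℕ → ℤ) → Prop} {ε : ℝ} (hε : ε < 1)
    (h : μ {ω | (X · ω) ∈ pathCylinder q n₀ ∧ ∃ n ≥ n₀, B n (X · ω)} ≤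
      ENNReal.ofReal ε * μ {ω | (X · ω) ∈ pathCylinder q n₀}) :
    0 < μ {ω | (X · ω) ∈ pathCylinder q n₀ ∧ ∀ n ≥ n₀, ¬ B n (X · ω)} := by
  have hp := hX.measure_pathCylinder_pos hpos hq0 hq n₀
  by_contra! hcon
  have hsub : {ω | (X · ω) ∈ pathCylinder q n₀} ⊆
      {ω | (X · ω) ∈ pathCylinder q n₀ ∧ ∃ n ≥ n₀, B n (X · ω)} ∪
      {ω | (X · ω) ∈ pathCylinder q n₀ ∧ ∀ n ≥ n₀, ¬ B n (X · ω)} := fun ω hω => by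
    by_cases hb : ∃ n ≥ n₀, B n (X · ω)
    · exact Or.inl ⟨hω, hb⟩
    · push Not at hb
      exact Or.inr ⟨hω, hb⟩
  have h1 := (measure_mono (μ := μ) hsub).trans (measure_union_le _ _)
  rw [le_antisymm hcon zero_le, add_zero] at h1
  have h2 := h1.trans h
  refine absurd h2 (not_le.2 ?_)
  calc ENNReal.ofReal ε * μ {ω | (X · ω) ∈ pathCylinder q n₀}
      < 1 * μ {ω | (X · ω) ∈ pathCylinder q n₀} := by
        refine ENNReal.mul_lt_mul_left hp.ne' (measure_ne_top _ _) ?_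
        exact ENNReal.ofReal_lt_one.2 hε
    _ = _ := one_mul _

include hpos hmono hdiv hα hs

/-- The exit probabilities. -/
lemma exit_sequence {b : ℝ} (hb : 0 < b) : ∃ A₀, α ≤ A₀ ∧ ∀ A ≥ A₀,
    (∀ j, 0 ≤ w 0 * (w (levelShift w A j))⁻¹) ∧ Summable (fun j => w 0 * (w (levelShift w A j))⁻¹) ∧
      ∀ z, tailSum (fun j => w 0 * (w (levelShift w A j))⁻¹) z ≤ b := by
  have h := (hs.tendsto_tsum hpos hmono hdiv hα).const_mul (w 0)
  rw [mul_zero] at h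
  obtain ⟨A₀, hA₀⟩ := eventually_atTop.1 (h.eventually (ge_mem_nhds hb))
  refine ⟨max α A₀, le_max_left _ _, fun A hA => ?_⟩
  have h0 : ∀ j, 0 ≤ w 0 * (w (levelShift w A j))⁻¹ := fun j =>
    mul_nonneg (hpos 0).le (inv_pos.2 (hpos _)).le
  have h1 : Summable fun j => w 0 * (w (levelShift w A j))⁻¹ :=
    (hs.mono hpos hmono hdiv hα ((le_max_left _ _).trans hA)).mul_left _
  refine ⟨h0, h1, fun z => ?_⟩
  refine (tailSum_anti h0 h1 (Nat.zero_le z)).trans ?_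
  rw [tailSum]
  simp only [add_zero, tsum_mul_left]
  exact hA₀ A ((le_max_right _ _).trans hA)

include hX

/-- The forced zigzag gives the inner sites a lead of `A₀ + C + K`. As long as two martingales move
by less than `K`, the lead keeps the chances of leaving `{0, 1, 2, 3}` summable. The potential
starts at no more than `1 / 2`, so with positive probability the walk stays, and `left_end` forces
all four sites to be recurrent. -/
theorem IsVRRW.measure_four_sites_pos :
    0 < μ {ω | (sitesVisitedInfinitelyOften (X · ω)).encard = 4} := by
  have hsq := hs.summable_sq hpos hmono hdiv hα
  obtain ⟨C, hC0, hC⟩ := hs.cumWeight_add_le hpos hmono hdiv hα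
  obtain ⟨A₀, hA₀, hexit⟩ := exit_sequence hpos hmono hdiv hα hs (b := 1 / 8) (by norm_num)
  obtain ⟨he0, hes, het⟩ := hexit A₀ le_rfl
  set e : ℕ → ℝ := fun j => w 0 * (w (levelShift w A₀ j))⁻¹ with he
  set T := tailSum (fun j => ((w j)⁻¹) ^ 2) 0 with hT
  have hT0 : 0 ≤ T := tailSum_nonneg (fun _ => sq_nonneg _) 0
  set K : ℝ := 16 * T + 1 with hK
  have hK0 : 0 < K := by linarith
  -- Each of the four terms of the potential gets `1 / 8`.
  have hKT : 2 * T / K ^ 2 ≤ 1 / 8 := by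
    rw [div_le_iff₀ (by positivity)]
    nlinarith
  obtain ⟨m, hm⟩ := ((cumWeight_tendsto hpos hdiv).eventually
    (eventually_ge_atTop (cumWeight w 1 + (A₀ + C) + K))).exists
  set q := zigzagPath
  have hq := isNearestNeighbor_zigzagPath
  obtain ⟨q0, q1, q2, q3, q4, q5⟩ := localTime_zigzagPath m
  set n₀ := 2 * m with hn₀
  have hZ : ∀ x ∈ pathCylinder q n₀, ∀ z, localTime x n₀ z = localTime q n₀ z := fun x hx z =>
    localTime_congr hx z
  have hMq : ∀ x ∈ pathCylinder q n₀, ∀ y, siteMart w x y n₀ = siteMart w q y n₀ := fun x hx y =>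
    dependsUntil_siteMart w y n₀ _ _ hx
  set B : ℕ → (ℕ → ℤ) → Prop := fun n x => K ≤ |siteMart w x 1 n - siteMart w q 1 n₀| ∨
    K ≤ |siteMart w x 2 n - siteMart w q 2 n₀| ∨ 0 < localTime x n (-1) ∨ 0 < localTime x n 4 with hB
  set V : ℕ → (ℕ → ℤ) → ℝ := fun n x => martPotential w 1 (siteMart w q 1 n₀) n x / K ^ 2 +
    martPotential w 2 (siteMart w q 2 n₀) n x / K ^ 2 + exitPotential e 0 (-1) n x +
    exitPotential e 3 4 n x with hV
  have hnn1 : ∀ n x, 0 ≤ martPotential w 1 (siteMart w q 1 n₀) n x / K ^ 2 := fun n x =>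
    div_nonneg (martPotential_nonneg ..) (sq_nonneg K)
  have hnn2 : ∀ n x, 0 ≤ martPotential w 2 (siteMart w q 2 n₀) n x / K ^ 2 := fun n x =>
    div_nonneg (martPotential_nonneg ..) (sq_nonneg K)
  have hnn3 := fun n x => exitPotential_nonneg he0 0 (-1) n x
  have hnn4 := fun n x => exitPotential_nonneg he0 3 4 n x
  have hbound := hX.exit_bound hpos (n₀ := n₀) (dependsUntil_pathCylinder q n₀) (B := B)
    (fun n x x' h => by simp only [hB, dependsUntil_siteMart w _ n x x' h, localTime_congr h])
    (V := V) (fun n x x' h => by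
      simp only [hV, dependsUntil_martPotential w _ _ n x x' h, dependsUntil_exitPotential _ _ _ n x x' h])
    (fun n x => by
      have := hnn1 n x; have := hnn2 n x; have := hnn3 n x; have := hnn4 n x
      simp only [hV]; linarith)
    (fun n x h => by
      have := hnn1 n x; have := hnn2 n x; have := hnn3 n x; have := hnn4 n x
      simp only [hV]
      rcases h with h | h | h | h
      · linarith [martPotential_ge hK0 h]
      · linarith [martPotential_ge hK0 h]
      · have : exitPotential e 0 (-1) n x = 1 := if_pos h
        linarith
      · have : exitPotential e 3 4 n x = 1 := if_pos h
        linarith)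
    (fun n hn x hx h0 hCx hnb => by
      have hb := hnb n hn le_rfl
      simp only [hB, not_or, not_le, not_lt, Nat.le_zero] at hb
      obtain ⟨b1, b2, b3, b4⟩ := hb
      rw [← hMq x hCx] at b1 b2
      obtain ⟨i1, i2⟩ := inner_dominates hpos hx hC hC0 (A := A₀ + C) (by linarith) hn b3 b4 b1.le b2.le
        (by rw [hZ x hCx, hZ x hCx, q0, q2]; exact hm)
        (by
          rw [hZ x hCx, hZ x hCx, q3, q1]
          have := cumWeight_mono hpos (Nat.zero_le 1)
          linarith)
      rw [add_sub_cancel_right] at i1 i2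
      have hmem := mem_Icc_of_localTime_eq_zero hx (a := 0) (b := 3) (by rw [h0]; simp) b3 b4 n le_rfl
      have d1 := martPotential_drift hpos x n hsq 1 (siteMart w q 1 n₀)
      have d2 := martPotential_drift hpos x n hsq 2 (siteMart w q 2 n₀)
      have d3 := exitPotential_drift hpos x n he0 hes (s := 0) (z := -1) (δ := -1) (Or.inr rfl)
        (by norm_num) b3 (by have := hmem.1; omega) (fun h => by
          refine transProb_le hpos hmono (Or.inr rfl) (by rw [h]; exact b3) ?_
          rw [h]
          exact levelShift_le hpos hmono hdiv (hα.trans hA₀) i1)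
      have d4 := exitPotential_drift hpos x n he0 hes (s := 3) (z := 4) (δ := 1) (Or.inl rfl)
        (by norm_num) b4 (by have := hmem.2; omega) (fun h => by
          refine transProb_le hpos hmono (Or.inl rfl) (by rw [h]; exact b4) ?_
          rw [h]
          exact levelShift_le hpos hmono hdiv (hα.trans hA₀) i2)
      have d1' := div_le_div_of_nonneg_right d1 (sq_nonneg K)
      have d2' := div_le_div_of_nonneg_right d2 (sq_nonneg K)
      rw [add_div, mul_div_assoc, mul_div_assoc] at d1' d2'
      simp only [hV]
      linarith)
    (ε := 1 / 2) (fun x hx h0 hCx => by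
      have s1 := div_le_div_of_nonneg_right (martPotential_start_le w hsq 1 n₀ x) (sq_nonneg K)
      have s2 := div_le_div_of_nonneg_right (martPotential_start_le w hsq 2 n₀ x) (sq_nonneg K)
      have s3 : exitPotential e 0 (-1) n₀ x ≤ 1 / 8 := by
        rw [exitPotential, hZ x hCx, q5, if_neg (lt_irrefl 0)]; exact het _
      have s4 : exitPotential e 3 4 n₀ x ≤ 1 / 8 := by
        rw [exitPotential, hZ x hCx, q4, if_neg (lt_irrefl 0)]; exact het _
      rw [hMq x hCx] at s1 s2
      simp only [hV]
      linarith)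
  have hstay := hX.measure_compl_pos hpos (q := q) rfl hq (by norm_num) hbound
  refine hstay.trans_le (measure_mono_ae ?_)
  filter_upwards [hX.ae_isNearestNeighbor hpos, hX.ae_martDichotomy hpos hmono] with ω hω hd hmem
  obtain ⟨h0, hx⟩ := hω
  have hfresh : ∀ n ≥ n₀, localTime (X · ω) n (-1) = 0 ∧ localTime (X · ω) n 4 = 0 := fun n hn => by
    have := hmem.2 n hn
    simp only [hB, not_or, not_lt, Nat.le_zero] at this
    exact this.2.2
  have hin : ∀ᶠ n in atTop, X n ω ∈ Set.Icc (0 : ℤ) 3 := eventually_atTop.2 ⟨n₀, fun n hn =>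
    mem_Icc_of_localTime_eq_zero hx (a := 0) (b := 3) (by simp [h0]) (hfresh n hn).1
      (hfresh n hn).2 n le_rfl⟩
  obtain ⟨hne, hsub⟩ := sites_nonempty_of_eventually_mem (x := (X · ω)) hin
  obtain ⟨a, b, hab, hR⟩ := sites_eq_Icc hx ((Set.finite_Icc _ _).subset hsub) hne
  have h3 := (left_end hpos hdiv hx hd hab hR).2.2.2.2.2
  rw [hR] at hsub
  have ha := (hsub ⟨le_rfl, hab⟩).1
  have hb := (hsub ⟨hab, le_rfl⟩).2
  change (sitesVisitedInfinitelyOften (X · ω)).encard = 4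
  rw [hR, encard_Icc_int, show b + 1 - a = 4 by omega]
  rfl

end FourSites

/-! ### Five sites with positive probability -/

section FourSitesBalanced

variable {w : ℕ → ℝ} (hpos : ∀ n, 0 < w n) (hmono : Monotone w)
  (hdiv : ¬ Summable (fun n => 1 / w n))

include hpos hmono hdiv

lemma self_le_levelShift {a : ℝ} (ha : 0 ≤ a) (j : ℕ) : j ≤ levelShift w a j :=
  (le_levelShift_iff hpos hmono hdiv ha).2 (le_add_of_nonneg_right ha)

/-- If the walk localizes on four sites `a, …, a + 3`, then `a` and `a + 2` cannot stay closer than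
a subcritical distance. -/
lemma criticalSummable_of_four_sites_close {η : ℝ} (hη : 0 ≤ η) {x : ℕ → ℤ} (hx : IsNearestNeighbor x)
    (hd : MartDichotomy w x) {a b : ℤ} (hab : a ≤ b) (h : sitesVisitedInfinitelyOften x = Set.Icc a b)
    {n₀ : ℕ} (hclose : ∀ n ≥ n₀, cumWeight w (localTime x n (a + 2)) ≤
      cumWeight w (localTime x n a) + η) : CriticalSummable w η := by
  set F := levelShift w η
  obtain ⟨-, hfin, -⟩ := left_end hpos hdiv hx hd hab h
  obtain ⟨n₁, hn₁⟩ := eventually_atTop.1 (eventually_mem_Icc hx hab h)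
  have h1 : Summable fun j => (w (F j + j + 1))⁻¹ := by
    refine summable_of_finiteJumpSum hpos hmono (y := a) (z := a + 1) (f := fun j => F j + j + 1)
      (by rw [h]; exact ⟨le_rfl, hab⟩) (max n₀ n₁) (fun n hn hy => ?_) (fun n hn hy => ?_) hfin
    · have h2 := (hn₁ (n + 1) (by omega)).1
      rcases hx n with h' | h' <;> omega
    · have h2 := localTime_le_neighbors' hx (a + 1) n
      rw [add_sub_cancel_right, show a + 1 + 1 = a + 2 by ring] at h2
      have h3 := (le_levelShift_iff hpos hmono hdiv hη).2 (hclose n (by omega))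
      simp only [F]
      omega
  -- Increments of `W` decrease, so translating the pair `j`, `F j` upwards by `j + 1` keeps their
  -- distance at most `η`. The odd terms of the critical series are thus dominated by `h1`, and by
  -- monotonicity the even ones follow.
  have hF : ∀ j, F j + j + 1 ≤ F (2 * j + 1) := fun j => by
    refine (le_levelShift_iff hpos hmono hdiv hη).2 ?_
    have hj := self_le_levelShift hpos hmono hdiv hη j
    have hle := (le_levelShift_iff hpos hmono hdiv hη (y := F j) (j := j)).1 le_rfl
    have key : ∀ d, cumWeight w (j + d + j + 1) - cumWeight w (2 * j + 1) ≤
        cumWeight w (j + d) - cumWeight w j := fun d => by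
      induction d with
      | zero => simp [two_mul]
      | succ d ih =>
        have e1 : j + (d + 1) + j + 1 = (j + d + j + 1) + 1 := by ring
        have e2 : j + (d + 1) = (j + d) + 1 := by ring
        rw [e1, e2, cumWeight_succ w (j + d + j + 1), cumWeight_succ w (j + d)]
        linarith [inv_anti₀ (hpos (j + d)) (hmono (show j + d ≤ j + d + j + 1 by omega))]
    have := key (F j - j)
    rw [Nat.add_sub_cancel' hj] at this
    linarith
  have hodd : Summable fun j => (w (F (2 * j + 1)))⁻¹ :=
    h1.of_nonneg_of_le (fun j => (inv_pos.2 (hpos _)).le) fun j => inv_anti₀ (hpos _) (hmono (hF j))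
  have heven : Summable fun j => (w (F (2 * j)))⁻¹ := by
    rw [← summable_nat_add_iff 1]
    refine hodd.of_nonneg_of_le (fun j => (inv_pos.2 (hpos _)).le) fun j => ?_
    exact inv_anti₀ (hpos _) (hmono (levelShift_mono_right hpos hmono hdiv hη (by omega)))
  exact (heven.hasSum.even_add_odd hodd.hasSum (f := fun j => (w (F j))⁻¹)).summable

end FourSitesBalanced

/-- The path `0, 1, 0, -1, 0, 1, …`. -/
def crossPath (k : ℕ) : ℤ := if k % 4 = 1 then 1 else if k % 4 = 3 then -1 else 0

lemma isNearestNeighbor_crossPath : IsNearestNeighbor crossPath := fun k => by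
  have h : k % 4 = 0 ∨ k % 4 = 1 ∨ k % 4 = 2 ∨ k % 4 = 3 := by omega
  rcases h with h | h | h | h <;> simp [crossPath, Nat.add_mod, h]

lemma localTime_crossPath (m : ℕ) : localTime crossPath (4 * m) 0 = 2 * m + 1 ∧
    localTime crossPath (4 * m) 1 = m ∧ localTime crossPath (4 * m) (-1) = m ∧
    localTime crossPath (4 * m) 2 = 0 ∧ localTime crossPath (4 * m) (-2) = 0 ∧
    localTime crossPath (4 * m) 3 = 0 ∧ localTime crossPath (4 * m) (-3) = 0 := by
  induction m with
  | zero => simp [localTime_zero, crossPath]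
  | succ m ih =>
    have h1 : crossPath (4 * m + 1) = 1 := by simp [crossPath, Nat.add_mod]
    have h2 : crossPath (4 * m + 1 + 1) = 0 := by simp [crossPath, Nat.add_mod]
    have h3 : crossPath (4 * m + 1 + 1 + 1) = -1 := by simp [crossPath, Nat.add_mod]
    have h4 : crossPath (4 * m + 1 + 1 + 1 + 1) = 0 := by simp [crossPath, Nat.add_mod]
    rw [show 4 * (m + 1) = 4 * m + 1 + 1 + 1 + 1 by ring]
    simp only [localTime_succ, h1, h2, h3, h4]
    simp only [ih]
    norm_num
    ring

section StayFive

variable {w : ℕ → ℝ} (hpos : ∀ n, 0 < w n) (hmono : Monotone w)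
  (hdiv : ¬ Summable (fun n => 1 / w n))

include hpos hmono hdiv

/-- While the walk stays in `{-2, …, 2}` and its martingales move little, the sites `-1` and `1` are
almost equally visited, and much more than the outer sites. -/
lemma sides_balanced {x : ℕ → ℤ} (hx : IsNearestNeighbor x) {C A K η : ℝ}
    (hC : ∀ x y z : ℕ, z ≤ x + y + 1 → cumWeight w z ≤ max (cumWeight w x) (cumWeight w y) + C)
    (hA : 0 ≤ A) (hs : CriticalSummable w A) (hη : ∑' j, (w (levelShift w A j))⁻¹ ≤ η / 4)
    {n₀ n : ℕ} (hn : n₀ ≤ n) (hl : localTime x n (-3) = 0) (hr : localTime x n 3 = 0)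
    (h0 : ∀ k, n₀ ≤ k → k ≤ n → |siteMart w x 0 k - siteMart w x 0 n₀| ≤ η / 4)
    (h1 : ∀ k, n₀ ≤ k → k ≤ n → |siteMart w x 1 k - siteMart w x 1 n₀| ≤ K)
    (h2 : ∀ k, n₀ ≤ k → k ≤ n → |siteMart w x (-1) k - siteMart w x (-1) n₀| ≤ K)
    (h3 : localTime x n₀ 1 = localTime x n₀ (-1))
    (h4 : cumWeight w (localTime x n₀ 2) + A + C + η + K ≤ cumWeight w (localTime x n₀ 0))
    (h5 : cumWeight w (localTime x n₀ (-2)) + A + C + η + K ≤ cumWeight w (localTime x n₀ 0)) :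
    |cumWeight w (localTime x n 1) - cumWeight w (localTime x n (-1))| ≤ η ∧
      cumWeight w (localTime x n 2) + A ≤ cumWeight w (localTime x n 1) ∧
      cumWeight w (localTime x n (-2)) + A ≤ cumWeight w (localTime x n (-1)) := by
  induction n using Nat.strong_induction_on with
  | _ n ih =>
  have hmz : ∀ k ≤ n, ∀ y, localTime x n y = 0 → localTime x k y = 0 := fun k hk y hy => by
    have := localTime_mono x y hk; simp only at this; omega
  -- At earlier times `±1` lead `±2`, so the critical series bounds the inward jump sums. Together
  -- with the small movement of the martingale at `0`, this keeps `-1` and `1` balanced at time `n`.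
  have ih' : ∀ k, n₀ ≤ k → k < n →
      cumWeight w (localTime x k 2) + A ≤ cumWeight w (localTime x k 1) ∧
      cumWeight w (localTime x k (-2)) + A ≤ cumWeight w (localTime x k (-1)) := fun k hk hkn =>
    (ih k hkn hk (hmz k hkn.le _ hl) (hmz k hkn.le _ hr) (fun i hi hik => h0 i hi (by omega))
      (fun i hi hik => h1 i hi (by omega)) (fun i hi hik => h2 i hi (by omega))).2
  have j1 := (jumpSum_sub_le hpos hmono hdiv hA hs (x := x) (y := 2) (z := 1) (m := n₀) (n := n)
    fun k hk hkn _ => (ih' k hk hkn).1).trans hη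
  have j2 := (jumpSum_sub_le hpos hmono hdiv hA hs (x := x) (y := -2) (z := -1) (m := n₀) (n := n)
    fun k hk hkn _ => (ih' k hk hkn).2).trans hη
  have j1' := jumpSum_mono (x := x) hpos 2 1 hn
  have j2' := jumpSum_mono (x := x) hpos (-2) (-1) hn
  have e0 := cumWeight_localTime_sub (w := w) hx 0 n₀ n
  have e1 := cumWeight_localTime_sub (w := w) hx 1 n₀ n
  have e2 := cumWeight_localTime_sub (w := w) hx 2 n₀ n
  have e1' := cumWeight_localTime_sub (w := w) hx (-1) n₀ n
  have e2' := cumWeight_localTime_sub (w := w) hx (-2) n₀ n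
  have m0 := h0 n hn le_rfl
  have m1 := h1 n hn le_rfl
  have m2 := h2 n hn le_rfl
  simp only [siteMart, abs_le] at m0 m1 m2
  norm_num at e0 e1 e2 e1' e2' m0 m1 m2
  rw [jumpSum_eq_zero_of_localTime_eq_zero w hr,
    jumpSum_eq_zero_of_localTime_eq_zero w (hmz n₀ hn _ hr)] at e2
  rw [jumpSum_eq_zero_of_localTime_eq_zero w hl,
    jumpSum_eq_zero_of_localTime_eq_zero w (hmz n₀ hn _ hl)] at e2'
  have k1 := jumpSum_mono (x := x) hpos 1 0 hn
  have k2 := jumpSum_mono (x := x) hpos (-1) 0 hn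
  have hclose : |cumWeight w (localTime x n 1) - cumWeight w (localTime x n (-1))| ≤ η := by
    rw [h3] at e1
    rw [abs_le]
    constructor <;> linarith [m0.1, m0.2]
  have n0 := localTime_le_neighbors' hx 0 n
  norm_num at n0
  have c0 := hC _ _ _ n0
  have hcl := abs_le.1 hclose
  have d2 : cumWeight w (localTime x n 2) + A + C + η ≤ cumWeight w (localTime x n 0) := by
    linarith [m1.1, m1.2]
  have d2' : cumWeight w (localTime x n (-2)) + A + C + η ≤ cumWeight w (localTime x n 0) := by
    linarith [m2.1, m2.2]
  refine ⟨hclose, ?_, ?_⟩ <;>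
  · rcases max_choice (cumWeight w (localTime x n (-1))) (cumWeight w (localTime x n 1)) with h | h <;>
      rw [h] at c0 <;> linarith [hcl.1, hcl.2]

end StayFive

section FiveSites

variable {Ω : Type*} [MeasurableSpace Ω] {μ : Measure Ω} [IsProbabilityMeasure μ]
  {w : ℕ → ℝ} (hpos : ∀ n, 0 < w n) (hmono : Monotone w) (hdiv : ¬ Summable (fun n => 1 / w n))
  {X : ℕ → Ω → ℤ} (hX : IsVRRW μ w X) {α : ℝ} (hα : 0 ≤ α) (hs : CriticalSummable w α)

include hpos hmono hdiv

/-- If `-1` and `1` stay close to each other, localization inside `{-2, …, 2}` is on all five sites. -/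
lemma encard_eq_five_of_close {η : ℝ} (hη : 0 ≤ η) (hcrit : ¬ CriticalSummable w η) {x : ℕ → ℤ}
    (hx : IsNearestNeighbor x) (hd : MartDichotomy w x) {n₀ : ℕ}
    (hin : ∀ n ≥ n₀, x n ∈ Set.Icc (-2 : ℤ) 2)
    (hclose : ∀ n ≥ n₀, |cumWeight w (localTime x n 1) - cumWeight w (localTime x n (-1))| ≤ η) :
    (sitesVisitedInfinitelyOften x).encard = 5 := by
  obtain ⟨hne, hsub⟩ := sites_nonempty_of_eventually_mem (eventually_atTop.2 ⟨n₀, hin⟩)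
  obtain ⟨a, b, hab, hR⟩ := sites_eq_Icc hx ((Set.finite_Icc _ _).subset hsub) hne
  have h3 := (left_end hpos hdiv hx hd hab hR).2.2.2.2.2
  have hsub' := hsub
  rw [hR] at hsub'
  have ha := (hsub' ⟨le_rfl, hab⟩).1
  have hb := (hsub' ⟨hab, le_rfl⟩).2
  -- At least four sites within `{-2, …, 2}` leave only `a = -1` or `b = 1` to exclude, and there
  -- `-1` and `1` are an end site and the site two steps inwards.
  have hna : a ≠ -1 := fun h => by
    refine hcrit (criticalSummable_of_four_sites_close hpos hmono hdiv hη hx hd hab hR (n₀ := n₀) ?_)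
    intro n hn
    rw [h]
    have := (abs_le.1 (hclose n hn)).2
    norm_num
    linarith
  have hnb : b ≠ 1 := fun h => by
    refine hcrit (criticalSummable_of_four_sites_close hpos hmono hdiv hη hx.neg hd.neg
      (neg_le_neg hab) (sites_neg_Icc hR) (n₀ := n₀) ?_)
    intro n hn
    rw [h, localTime_neg, show (-1 + 2 : ℤ) = -(-1) by norm_num, localTime_neg]
    have := (abs_le.1 (hclose n hn)).1
    linarith
  rw [hR, encard_Icc_int, show b + 1 - a = 5 by omega]
  rfl

include hX hα hs

/-- The forced path visits `-1` and `1` equally often and leaves `±2` unvisited. With positive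
probability the martingale at `0` then moves by less than `η / 4` and the walk stays in `{-2, …,
2}`; divergence at `η` excludes four sites. -/
theorem IsVRRW.measure_five_sites_pos {η : ℝ} (hη : 0 < η) (hcrit : ¬ CriticalSummable w η) :
    0 < μ {ω | (sitesVisitedInfinitelyOften (X · ω)).encard = 5} := by
  have hsq := hs.summable_sq hpos hmono hdiv hα
  obtain ⟨C, hC0, hC⟩ := hs.cumWeight_add_le hpos hmono hdiv hα
  have hw0 := hpos 0
  -- The bound `1 / 16` is for the two exits; the other entry makes the critical series at `A` at
  -- most `η / 4`, as `sides_balanced` requires.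
  obtain ⟨A, hA, hexit⟩ := exit_sequence hpos hmono hdiv hα hs (b := min (1 / 16) (w 0 * (η / 4)))
    (lt_min (by norm_num) (by positivity))
  obtain ⟨he0, hes, het⟩ := hexit A le_rfl
  have hA0 := hα.trans hA
  have hJ : ∑' j, (w (levelShift w A j))⁻¹ ≤ η / 4 := by
    have := (het 0).trans (min_le_right _ _)
    rw [tailSum] at this
    simp only [add_zero, tsum_mul_left] at this
    exact le_of_mul_le_mul_left this hw0
  set e : ℕ → ℝ := fun j => w 0 * (w (levelShift w A j))⁻¹ with he
  set T := tailSum (fun j => ((w j)⁻¹) ^ 2) 0 with hT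
  have hT0 : 0 ≤ T := tailSum_nonneg (fun _ => sq_nonneg _) 0
  set K : ℝ := 16 * T + 1 with hK
  have hK0 : 0 < K := by linarith
  have hKT : 2 * T / K ^ 2 ≤ 1 / 8 := by
    rw [div_le_iff₀ (by positivity)]
    nlinarith
  have hη4 : 0 < η / 4 := by positivity
  -- Since `η / 4` may be small, the martingale at `0` is controlled by a late start instead: `hmT`
  -- makes its remaining variance small once `±1` have been visited `m` times.
  obtain ⟨m, hm, hmT⟩ := (((cumWeight_tendsto hpos hdiv).eventually
    (eventually_ge_atTop (A + C + η + K))).and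
    ((tailSum_tendsto fun j => ((w j)⁻¹) ^ 2).eventually
      (ge_mem_nhds (show (0 : ℝ) < (η / 4) ^ 2 / 16 by positivity)))).exists
  set q := crossPath
  have hq := isNearestNeighbor_crossPath
  obtain ⟨q0, q1, q1', q2, q2', q3, q3'⟩ := localTime_crossPath m
  set n₀ := 4 * m with hn₀
  have hZ : ∀ x ∈ pathCylinder q n₀, ∀ z, localTime x n₀ z = localTime q n₀ z := fun x hx z =>
    localTime_congr hx z
  have hMq : ∀ x ∈ pathCylinder q n₀, ∀ y, siteMart w x y n₀ = siteMart w q y n₀ := fun x hx y =>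
    dependsUntil_siteMart w y n₀ _ _ hx
  set B : ℕ → (ℕ → ℤ) → Prop := fun n x => η / 4 ≤ |siteMart w x 0 n - siteMart w q 0 n₀| ∨
    K ≤ |siteMart w x 1 n - siteMart w q 1 n₀| ∨ K ≤ |siteMart w x (-1) n - siteMart w q (-1) n₀| ∨
    0 < localTime x n (-3) ∨ 0 < localTime x n 3 with hB
  set V : ℕ → (ℕ → ℤ) → ℝ := fun n x => martPotential w 0 (siteMart w q 0 n₀) n x / (η / 4) ^ 2 +
    martPotential w 1 (siteMart w q 1 n₀) n x / K ^ 2 +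
    martPotential w (-1) (siteMart w q (-1) n₀) n x / K ^ 2 + exitPotential e (-2) (-3) n x +
    exitPotential e 2 3 n x with hV
  have hnn0 : ∀ n x, 0 ≤ martPotential w 0 (siteMart w q 0 n₀) n x / (η / 4) ^ 2 := fun n x =>
    div_nonneg (martPotential_nonneg ..) (sq_nonneg _)
  have hnn1 : ∀ n x, 0 ≤ martPotential w 1 (siteMart w q 1 n₀) n x / K ^ 2 := fun n x =>
    div_nonneg (martPotential_nonneg ..) (sq_nonneg K)
  have hnn2 : ∀ n x, 0 ≤ martPotential w (-1) (siteMart w q (-1) n₀) n x / K ^ 2 := fun n x =>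
    div_nonneg (martPotential_nonneg ..) (sq_nonneg K)
  have hnn3 := fun n x => exitPotential_nonneg he0 (-2) (-3) n x
  have hnn4 := fun n x => exitPotential_nonneg he0 2 3 n x
  have hbal : ∀ x, IsNearestNeighbor x → x ∈ pathCylinder q n₀ → ∀ n ≥ n₀,
      (∀ k, n₀ ≤ k → k ≤ n → ¬ B k x) → localTime x n (-3) = 0 ∧ localTime x n 3 = 0 ∧
      |cumWeight w (localTime x n 1) - cumWeight w (localTime x n (-1))| ≤ η ∧
      cumWeight w (localTime x n 2) + A ≤ cumWeight w (localTime x n 1) ∧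
      cumWeight w (localTime x n (-2)) + A ≤ cumWeight w (localTime x n (-1)) := by
    intro x hx hCx n hn hnb
    have hb : ∀ k, n₀ ≤ k → k ≤ n → |siteMart w x 0 k - siteMart w x 0 n₀| < η / 4 ∧
        |siteMart w x 1 k - siteMart w x 1 n₀| < K ∧
        |siteMart w x (-1) k - siteMart w x (-1) n₀| < K ∧
        localTime x k (-3) = 0 ∧ localTime x k 3 = 0 := fun k h1 h2 => by
      have := hnb k h1 h2
      simp only [hB, not_or, not_le, not_lt, Nat.le_zero] at this
      rwa [hMq x hCx, hMq x hCx, hMq x hCx]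
    have hbn := (hb n hn le_rfl).2.2.2
    refine ⟨hbn.1, hbn.2, ?_⟩
    refine sides_balanced hpos hmono hdiv hx hC hA0 (hs.mono hpos hmono hdiv hα hA) hJ hn hbn.1 hbn.2
      (fun k h1 h2 => (hb k h1 h2).1.le) (fun k h1 h2 => (hb k h1 h2).2.1.le)
      (fun k h1 h2 => (hb k h1 h2).2.2.1.le) ?_ ?_ ?_
    · rw [hZ x hCx, hZ x hCx, q1, q1']
    · rw [hZ x hCx, hZ x hCx, q2, q0, cumWeight_zero, zero_add]
      exact hm.trans (cumWeight_mono hpos (by omega))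
    · rw [hZ x hCx, hZ x hCx, q2', q0, cumWeight_zero, zero_add]
      exact hm.trans (cumWeight_mono hpos (by omega))
  have hbound := hX.exit_bound hpos (n₀ := n₀) (dependsUntil_pathCylinder q n₀) (B := B)
    (fun n x x' h => by simp only [hB, dependsUntil_siteMart w _ n x x' h, localTime_congr h])
    (V := V) (fun n x x' h => by
      simp only [hV, dependsUntil_martPotential w _ _ n x x' h, dependsUntil_exitPotential _ _ _ n x x' h])
    (fun n x => by
      have := hnn0 n x; have := hnn1 n x; have := hnn2 n x; have := hnn3 n x; have := hnn4 n x
      simp only [hV]; linarith)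
    (fun n x h => by
      have := hnn0 n x; have := hnn1 n x; have := hnn2 n x; have := hnn3 n x; have := hnn4 n x
      simp only [hV]
      rcases h with h | h | h | h | h
      · linarith [martPotential_ge hη4 h]
      · linarith [martPotential_ge hK0 h]
      · linarith [martPotential_ge hK0 h]
      · have : exitPotential e (-2) (-3) n x = 1 := if_pos h
        linarith
      · have : exitPotential e 2 3 n x = 1 := if_pos h
        linarith)
    (fun n hn x hx h0 hCx hnb => by
      obtain ⟨b3, b4, -, i2, i1⟩ := hbal x hx hCx n hn hnb
      have hmem := mem_Icc_of_localTime_eq_zero hx (a := -2) (b := 2) (by rw [h0]; simp) b3 b4 n le_rfl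
      have d0 := martPotential_drift hpos x n hsq 0 (siteMart w q 0 n₀)
      have d1 := martPotential_drift hpos x n hsq 1 (siteMart w q 1 n₀)
      have d2 := martPotential_drift hpos x n hsq (-1) (siteMart w q (-1) n₀)
      have d3 := exitPotential_drift hpos x n he0 hes (s := -2) (z := -3) (δ := -1) (Or.inr rfl)
        (by norm_num) b3 (by have := hmem.1; omega) (fun h => by
          refine transProb_le hpos hmono (Or.inr rfl) (by rw [h]; exact b3) ?_
          rw [h]
          exact levelShift_le hpos hmono hdiv hA0 i1)
      have d4 := exitPotential_drift hpos x n he0 hes (s := 2) (z := 3) (δ := 1) (Or.inl rfl)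
        (by norm_num) b4 (by have := hmem.2; omega) (fun h => by
          refine transProb_le hpos hmono (Or.inl rfl) (by rw [h]; exact b4) ?_
          rw [h]
          exact levelShift_le hpos hmono hdiv hA0 i2)
      have d0' := div_le_div_of_nonneg_right d0 (sq_nonneg (η / 4))
      have d1' := div_le_div_of_nonneg_right d1 (sq_nonneg K)
      have d2' := div_le_div_of_nonneg_right d2 (sq_nonneg K)
      rw [add_div, mul_div_assoc, mul_div_assoc] at d0' d1' d2'
      simp only [hV]
      linarith)
    (ε := 1 / 2) (fun x hx h0 hCx => by
      have s0 : martPotential w 0 (siteMart w x 0 n₀) n₀ x / (η / 4) ^ 2 ≤ 1 / 8 := by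
        rw [div_le_iff₀ (by positivity), martPotential, sub_self, zero_add (1 : ℤ),
          zero_sub (1 : ℤ), hZ x hCx, hZ x hCx, q1, q1']
        linarith
      have s1 := div_le_div_of_nonneg_right (martPotential_start_le w hsq 1 n₀ x) (sq_nonneg K)
      have s2 := div_le_div_of_nonneg_right (martPotential_start_le w hsq (-1) n₀ x) (sq_nonneg K)
      have s3 : exitPotential e (-2) (-3) n₀ x ≤ 1 / 16 := by
        rw [exitPotential, hZ x hCx, q3', if_neg (lt_irrefl 0)]
        exact (het _).trans (min_le_left _ _)
      have s4 : exitPotential e 2 3 n₀ x ≤ 1 / 16 := by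
        rw [exitPotential, hZ x hCx, q3, if_neg (lt_irrefl 0)]
        exact (het _).trans (min_le_left _ _)
      rw [hMq x hCx] at s0 s1 s2
      simp only [hV]
      linarith)
  have hstay := hX.measure_compl_pos hpos (q := q) rfl hq (by norm_num) hbound
  refine hstay.trans_le (measure_mono_ae ?_)
  filter_upwards [hX.ae_isNearestNeighbor hpos, hX.ae_martDichotomy hpos hmono] with ω hω hd hmem
  obtain ⟨h0, hx⟩ := hω
  have hb := fun n hn => hbal (X · ω) hx hmem.1 n hn fun k hk _ => hmem.2 k hk
  exact encard_eq_five_of_close hpos hmono hdiv hη.le hcrit hx hd (n₀ := n₀)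
    (fun n hn => mem_Icc_of_localTime_eq_zero hx (a := -2) (b := 2) (by simp [h0]) (hb n hn).1
      (hb n hn).2.1 n le_rfl) fun n hn => (hb n hn).2.2.1

end FiveSites

/-! ### Finite range -/

/-- The path visits `y` for the first time at time `n`. -/
def FirstHitsAt (y : ℤ) (n : ℕ) (x : ℕ → ℤ) : Prop := x n = y ∧ ∀ k < n, x k ≠ y

lemma dependsUntil_firstHitsAt (y : ℤ) (n : ℕ) : DependsUntil n (FirstHitsAt y n) := fun x x' h => by
  have : (∀ k < n, x k ≠ y) ↔ ∀ k < n, x' k ≠ y :=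
    forall_congr' fun k => ⟨fun h' hk => by rw [← h k hk.le]; exact h' hk,
      fun h' hk => by rw [h k hk.le]; exact h' hk⟩
  simp only [FirstHitsAt, h n le_rfl, this]

lemma exists_firstHitsAt {x : ℕ → ℤ} {y : ℤ} (h : ∃ n, x n = y) : ∃ n, FirstHitsAt y n x := by
  classical
  exact ⟨Nat.find h, Nat.find_spec h, fun k hk => Nat.find_min h hk⟩

lemma FirstHitsAt.unique {x : ℕ → ℤ} {y : ℤ} {m n : ℕ} (hm : FirstHitsAt y m x)
    (hn : FirstHitsAt y n x) : m = n := by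
  rcases lt_trichotomy m n with h | h | h
  · exact absurd hm.1 (hn.2 m h)
  · exact h
  · exact absurd hn.1 (hm.2 n h)

lemma lt_of_localTime_eq_zero {x : ℕ → ℤ} (hx : IsNearestNeighbor x) {z : ℤ} {n : ℕ} (h0 : z < x 0)
    (h : localTime x n z = 0) : ∀ k ≤ n, z < x k := by
  intro k
  induction k with
  | zero => exact fun _ => h0
  | succ k ih =>
    intro hk
    have h1 := ih (by omega)
    have h2 : x (k + 1) ≠ z := fun h' => by
      have h3 := localTime_pos x h'
      have h4 := localTime_mono x z hk
      simp only at h4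
      omega
    rcases hx k with h' | h' <;> omega

lemma FirstHitsAt.le {x : ℕ → ℤ} (hx : IsNearestNeighbor x) {y : ℤ} {n : ℕ} (h0 : y ≤ x 0)
    (h : FirstHitsAt y n x) : ∀ k ≤ n, y ≤ x k := by
  intro k
  induction k with
  | zero => exact fun _ => h0
  | succ k ih =>
    intro hk
    have h1 := ih (by omega)
    have h2 := h.2 k (by omega)
    rcases hx k with h' | h' <;> omega

lemma localTime_eq_zero_of_ne {x : ℕ → ℤ} {n : ℕ} {z : ℤ} (h : ∀ k ≤ n, x k ≠ z) :
    localTime x n z = 0 := by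
  rw [localTime, Finset.card_eq_zero, Finset.filter_eq_empty_iff]
  exact fun k hk => h k (by have := Finset.mem_range.1 hk; omega)

lemma FirstHitsAt.jumpSum_eq_zero {w : ℕ → ℝ} {x : ℕ → ℤ} {y : ℤ} {n : ℕ} (h : FirstHitsAt y n x)
    (z : ℤ) : jumpSum w x y z n = 0 :=
  Finset.sum_eq_zero fun k hk => if_neg fun h' => h.2 k (Finset.mem_range.1 hk) h'.1

/-- With `u = w 0` the weight of the unvisited left neighbour and `v` that of the right one, the
fraction is the probability of a right jump. So the exponential of `w 0` times the right jump sum,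
killed at the first left jump, is a submartingale. -/
lemma one_le_mul_exp {u v : ℝ} (hu : 0 < u) (hv : 0 < v) : 1 ≤ v / (v + u) * Real.exp (u * v⁻¹) := by
  have h1 := Real.add_one_le_exp (u * v⁻¹)
  calc 1 = v / (v + u) * (u * v⁻¹ + 1) := by field_simp; ring
    _ ≤ _ := mul_le_mul_of_nonneg_left h1 (by positivity)

section Early

variable {Ω : Type*} [MeasurableSpace Ω] {μ : Measure Ω} [IsProbabilityMeasure μ]
  {w : ℕ → ℝ} (hpos : ∀ n, 0 < w n) (hmono : Monotone w) {X : ℕ → Ω → ℤ} (hX : IsVRRW μ w X)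

include hpos hmono hX

/-- After the first visit to `y`, with probability bounded below the jumps from `y` to `y + 1`
accumulate before `y - 1` is visited. -/
lemma IsVRRW.early_visit_bound {y : ℤ} (hy : y ≤ 0) {B : ℝ} (hB : 0 < B) (n₀ : ℕ) :
    μ {ω | FirstHitsAt y n₀ (X · ω) ∧ ∃ n ≥ n₀, 0 < localTime (X · ω) n (y - 1) ∧
      jumpSum w (X · ω) y (y + 1) n < B} ≤
      ENNReal.ofReal (1 - Real.exp (-(w 0 * B + 1))) * μ {ω | FirstHitsAt y n₀ (X · ω)} := by
  have hw0 := hpos 0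
  -- One minus the normalized submartingale from `one_le_mul_exp`. The extra `1` in the exponent
  -- absorbs the overshoot of the last jump beyond `B`, which is at most `1` after multiplication by
  -- `w 0`.
  set V : ℕ → (ℕ → ℤ) → ℝ := fun n x => if jumpSum w x y (y + 1) n < B then
    (if 0 < localTime x n (y - 1) then 1 else
      1 - Real.exp (w 0 * jumpSum w x y (y + 1) n - (w 0 * B + 1))) else 0 with hV
  have hsub : ∀ J < B, 0 ≤ 1 - Real.exp (w 0 * J - (w 0 * B + 1)) := fun J hJ => by
    have := mul_lt_mul_of_pos_left hJ hw0
    have := Real.exp_le_one_iff.2 (show w 0 * J - (w 0 * B + 1) ≤ 0 by linarith)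
    linarith
  have hJd : ∀ n, DependsUntil n fun x => jumpSum w x y (y + 1) n := fun n x x' h => jumpSum_congr h _ _
  refine hX.exit_bound hpos (n₀ := n₀) (dependsUntil_firstHitsAt y n₀)
    (B := fun n x => 0 < localTime x n (y - 1) ∧ jumpSum w x y (y + 1) n < B)
    (fun n x x' h => by simp only [localTime_congr h, jumpSum_congr h]) (V := V)
    (fun n x x' h => by simp only [hV, localTime_congr h, jumpSum_congr h]) (fun n x => ?_)
    (fun n x h => by simp only [hV, if_pos h.1, if_pos h.2, le_refl])
    (fun n hn x hx h0 hC hnb => ?_) (fun x hx h0 hC => ?_)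
  · simp only [hV]
    split_ifs with h1 h2
    · exact zero_le_one
    · exact hsub _ h1
    · exact le_rfl
  · have hnb := hnb n hn le_rfl
    obtain ⟨hp, hq, hpq⟩ := transProb_nonneg_add (w := w) hpos x n
    have hJs : ∀ e : ℤ, jumpSum w (extendPath x n e) y (y + 1) (n + 1) = jumpSum w x y (y + 1) n +
        if x n = y ∧ x n + e = y + 1 then (w (localTime x n (y + 1)))⁻¹ else 0 := fun e => by
      have hc : ∀ k ≤ n, extendPath x n e k = x k := fun k hk => extendPath_of_le hk
      rw [jumpSum_succ, extendPath_succ, jumpSum_congr hc, hc n le_rfl, localTime_congr hc]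
    have hZs := localTime_extendPath_succ x n
    by_cases hJ : jumpSum w x y (y + 1) n < B
    swap
    · have : ∀ e, V (n + 1) (extendPath x n e) = 0 := fun e => by
        simp only [hV]
        rw [if_neg]
        rw [hJs]
        have := inv_pos.2 (hpos (localTime x n (y + 1)))
        split_ifs <;> linarith
      rw [this, this, mul_zero, mul_zero, add_zero]
      simp only [hV, if_neg hJ, le_refl]
    · have hZ : localTime x n (y - 1) = 0 := by
        by_contra hne
        exact hnb ⟨Nat.pos_of_ne_zero hne, hJ⟩
      have hlt := lt_of_localTime_eq_zero hx (show y - 1 < x 0 by omega) hZ n le_rfl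
      have hVn : V n x = 1 - Real.exp (w 0 * jumpSum w x y (y + 1) n - (w 0 * B + 1)) := by
        simp only [hV, if_pos hJ, hZ, lt_irrefl, if_false]
      by_cases hxy : x n = y
      · have hr : V (n + 1) (extendPath x n 1) ≤
            1 - Real.exp (w 0 * jumpSum w x y (y + 1) n - (w 0 * B + 1)) *
              Real.exp (w 0 * (w (localTime x n (y + 1)))⁻¹) := by
          have h1 : w 0 * (w (localTime x n (y + 1)))⁻¹ ≤ 1 := by
            rw [← div_eq_mul_inv, div_le_one (hpos _)]; exact hmono (Nat.zero_le _)
          have h2 := mul_lt_mul_of_pos_left hJ hw0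
          rw [← Real.exp_add]
          simp only [hV, hJs, hZs, hZ]
          rw [if_pos (show x n = y ∧ x n + 1 = y + 1 from ⟨hxy, by rw [hxy]⟩),
            if_neg (show ¬ x n + 1 = y - 1 by omega), add_zero, if_neg (lt_irrefl 0)]
          split_ifs with h
          · refine le_of_eq ?_
            congr 2
            ring
          · have := Real.exp_le_one_iff.2 (show w 0 * jumpSum w x y (y + 1) n - (w 0 * B + 1) +
              w 0 * (w (localTime x n (y + 1)))⁻¹ ≤ 0 by linarith)
            linarith
        have hl : V (n + 1) (extendPath x n (-1)) ≤ 1 := by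
          simp only [hV]
          split_ifs with h1 h2
          · exact le_rfl
          · have := Real.exp_pos (w 0 * jumpSum w (extendPath x n (-1)) y (y + 1) (n + 1) - (w 0 * B + 1))
            linarith
          · exact zero_le_one
        have hpe : transProb w 1 x n = w (localTime x n (y + 1)) / (w (localTime x n (y + 1)) + w 0) := by
          simp only [transProb, hxy]
          rw [hZ]
        have h1 := one_le_mul_exp hw0 (hpos (localTime x n (y + 1)))
        rw [← hpe] at h1
        have h2 := mul_le_mul_of_nonneg_left hr hp
        have h3 := mul_le_mul_of_nonneg_left hl hq
        have h4 := mul_le_mul_of_nonneg_left h1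
          (Real.exp_pos (w 0 * jumpSum w x y (y + 1) n - (w 0 * B + 1))).le
        rw [hVn]
        linarith
      · have : ∀ e : ℤ, (e = 1 ∨ e = -1) → V (n + 1) (extendPath x n e) = V n x := fun e he => by
          rw [hVn]
          simp only [hV, hJs, hZs, hZ]
          rw [if_neg (show ¬ (x n = y ∧ x n + e = y + 1) from fun h => hxy h.1),
            if_neg (show ¬ x n + e = y - 1 by omega), add_zero, add_zero, if_pos hJ,
            if_neg (lt_irrefl 0)]
        rw [this 1 (Or.inl rfl), this (-1) (Or.inr rfl), ← add_mul, hpq, one_mul]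
  · have h1 := hC.le hx (by omega)
    have hZ : localTime x n₀ (y - 1) = 0 := localTime_eq_zero_of_ne fun k hk => by
      have := h1 k hk
      omega
    simp only [hV, hC.jumpSum_eq_zero, if_pos hB, hZ, lt_irrefl, if_false, mul_zero, zero_sub, le_refl]

end Early

lemma jumpSum_to_eq_zero (w : ℕ → ℝ) {x : ℕ → ℤ} {n : ℕ} {z : ℤ} (h : localTime x n z = 0) (y : ℤ) :
    jumpSum w x y z n = 0 :=
  Finset.sum_eq_zero fun k hk => if_neg fun h' => by
    have h1 := localTime_pos x h'.2
    have h2 := localTime_mono x z (show k + 1 ≤ n from Finset.mem_range.1 hk)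
    simp only at h2
    omega

section Late

variable {w : ℕ → ℝ} (hpos : ∀ n, 0 < w n) (hmono : Monotone w)

include hpos hmono

lemma jumpSum_le_localTime (x : ℕ → ℤ) (y z : ℤ) (n : ℕ) :
    jumpSum w x y z n ≤ localTime x n y * (w 0)⁻¹ := by
  have hw := inv_pos.2 (hpos 0)
  have h1 : jumpSum w x y z n ≤ ∑ k ∈ Finset.range n, if x k = y then (w 0)⁻¹ else 0 := by
    refine Finset.sum_le_sum fun k _ => ?_
    have := inv_anti₀ (hpos 0) (hmono (Nat.zero_le (localTime x k z)))
    by_cases h : x k = y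
    · rw [if_pos h]; split_ifs <;> linarith
    · rw [if_neg h, if_neg fun h' => h h'.1]
  refine h1.trans ?_
  rw [← Finset.sum_filter, Finset.sum_const, nsmul_eq_mul]
  refine mul_le_mul_of_nonneg_right (Nat.cast_le.2 (Finset.card_le_card ?_)) hw.le
  exact Finset.filter_subset_filter _ (Finset.range_mono (Nat.le_succ n))

lemma jumpSum_succ_le (x : ℕ → ℤ) (y z : ℤ) (n : ℕ) :
    jumpSum w x y z (n + 1) ≤ jumpSum w x y z n + (w 0)⁻¹ := by
  rw [jumpSum_succ]
  have h6 : (w (localTime x n z))⁻¹ ≤ (w 0)⁻¹ := inv_anti₀ (hpos 0) (hmono (Nat.zero_le _))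
  have h7 := inv_pos.2 (hpos 0)
  split_ifs <;> linarith

variable (hdiv : ¬ Summable (fun n => 1 / w n)) {α : ℝ} (hα : 0 ≤ α) (hs : CriticalSummable w α)

include hdiv hα hs

/-- Once the jumps from `y` to `y + 1` have accumulated, the site `y` stays much more visited than
`y - 1`, or `y - 1` is hardly visited. -/
lemma left_dominates {x : ℕ → ℤ} (hx : IsNearestNeighbor x) (h0 : x 0 = 0) {y : ℤ} (hy : y ≤ 0)
    {B K A : ℝ} {r n : ℕ} (hn : r ≤ n) (hz : localTime x n (y - 2) = 0)
    (hr : localTime x r (y - 1) = 0)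
    (hM : ∀ k, r ≤ k → k ≤ n → |siteMart w x y k - B| ≤ K) (hB : α ≤ (B - K) / 2)
    (hB' : A + (2 * K + (w 0)⁻¹ + ∑' j, (w (levelShift w α j))⁻¹) ≤ (B - K) / 2) :
    cumWeight w (localTime x n (y - 1)) + A ≤ cumWeight w (localTime x n y) ∨
      cumWeight w (localTime x n (y - 1)) ≤ 2 * K + ∑' j, (w (levelShift w α j))⁻¹ := by
  have hs0 : localTime x 0 (y - 1) = 0 := by
    rw [localTime_zero, h0, if_neg (by omega)]
  -- The site `y - 1` is not the starting point and has not been entered from the unvisited `y - 2`,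
  -- so all its visits come from `y`.
  have hD : ∀ k ≤ n, cumWeight w (localTime x k (y - 1)) = jumpSum w x y (y - 1) k := fun k hk => by
    have hzk : localTime x k (y - 2) = 0 := by
      have := localTime_mono x (y - 2) hk; simp only at this; omega
    rw [cumWeight_localTime hx, hs0, cumWeight_zero, show y - 1 - 1 = y - 2 by ring,
      jumpSum_eq_zero_of_localTime_eq_zero w hzk, sub_add_cancel]
    ring
  have hb := barrier hpos hmono hdiv hα hs (x := x) (y := y) (A := B - K) (C₀ := 0) (K := 2 * K)
    hn hB (fun k hk hkn => by
      have h1 := (abs_le.1 (hM k hk hkn)).1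
      have h2 := cumWeight_localTime (w := w) hx (y + 1) k
      have h3 := cumWeight_nonneg hpos (localTime x 0 (y + 1))
      have h4 := jumpSum_nonneg (x := x) hpos (y + 1 + 1) (y + 1) k
      rw [siteMart] at h1
      rw [add_sub_cancel_right] at h2
      rw [hD k hkn]
      linarith)
    (fun t ht htn => by rw [hD n le_rfl, hD t htn, zero_add])
    (fun t ht htn => by
      have h1 := abs_le.1 (hM t ht htn)
      have h2 := abs_le.1 (hM n hn le_rfl)
      rw [abs_le]
      constructor <;> linarith)
  rw [hr, cumWeight_zero, zero_add, sub_zero] at hb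
  refine hb.imp (fun h => ?_) fun h => h
  linarith

end Late

section LateExit

variable {Ω : Type*} [MeasurableSpace Ω] {μ : Measure Ω} [IsProbabilityMeasure μ]
  {w : ℕ → ℝ} (hpos : ∀ n, 0 < w n) (hmono : Monotone w) (hdiv : ¬ Summable (fun n => 1 / w n))
  {X : ℕ → Ω → ℤ} (hX : IsVRRW μ w X) {α : ℝ} (hα : 0 ≤ α) (hs : CriticalSummable w α)

/-- At time `r` the jumps from `y` to `y + 1` have just accumulated to the amount `B`, and `y - 1`
has not been visited. -/
def AccumulatedAt (w : ℕ → ℝ) (y : ℤ) (B : ℝ) (r : ℕ) (x : ℕ → ℤ) : Prop :=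
  localTime x r (y - 1) = 0 ∧ B ≤ jumpSum w x y (y + 1) r ∧ ∀ k < r, jumpSum w x y (y + 1) k < B

lemma dependsUntil_accumulatedAt (w : ℕ → ℝ) (y : ℤ) (B : ℝ) (r : ℕ) :
    DependsUntil r (AccumulatedAt w y B r) := fun x x' h => by
  have : (∀ k < r, jumpSum w x y (y + 1) k < B) ↔ ∀ k < r, jumpSum w x' y (y + 1) k < B :=
    forall₂_congr fun k hk => by rw [jumpSum_congr fun j hj => h j (by omega)]
  simp only [AccumulatedAt, localTime_congr h, jumpSum_congr h, this]

include hpos hmono hX hdiv hα hs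

/-- At time `r` the martingale at `y` is close to `B`, and it is likely to stay there. Then `y + 1`
leads `y - 1`, and by `left_dominates` either `y` leads `y - 1` by `A` or `y - 1` has few visits.
Both cases make the steps to `y - 2` improbable enough to be summed. -/
lemma IsVRRW.late_exit_bound : ∃ B > 0, ∀ y ≤ 0, ∀ r,
    μ {ω | AccumulatedAt w y B r (X · ω) ∧ ∃ n ≥ r, 0 < localTime (X · ω) n (y - 2)} ≤
      ENNReal.ofReal (1 / 2) * μ {ω | AccumulatedAt w y B r (X · ω)} := by
  have hsq := hs.summable_sq hpos hmono hdiv hα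
  have hw0 := hpos 0
  have hw0' := inv_pos.2 hw0
  obtain ⟨A, hA, hexit⟩ := exit_sequence hpos hmono hdiv hα hs (b := 1 / 8) (by norm_num)
  obtain ⟨he0, hes, het⟩ := hexit A le_rfl
  have hA0 := hα.trans hA
  set T := tailSum (fun j => ((w j)⁻¹) ^ 2) 0 with hT
  have hT0 : 0 ≤ T := tailSum_nonneg (fun _ => sq_nonneg _) 0
  set K : ℝ := 2 * (w 0)⁻¹ + 8 * T + 1 with hK
  have hK0 : 0 < K := by positivity
  have hKT : ((w 0)⁻¹ ^ 2 + 2 * T) / K ^ 2 ≤ 1 / 4 := by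
    rw [div_le_iff₀ (by positivity)]
    nlinarith [mul_nonneg hw0'.le hT0]
  set J := ∑' j, (w (levelShift w α j))⁻¹ with hJ
  -- In the second case of `left_dominates` there have been fewer than `z₀` visits to `y - 1`. Each
  -- can exit with probability at most `w 0 / w N`, where `N` visits to `y` are guaranteed by `B ≥ N
  -- / w 0`; the choice of `N` makes the total at most `1 / 8`.
  obtain ⟨z₀, hz₀⟩ := ((cumWeight_tendsto hpos hdiv).eventually
    (eventually_gt_atTop (2 * K + J))).exists
  obtain ⟨N, hN⟩ := ((hs.weight_tendsto hpos hmono hdiv hα).eventually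
    (eventually_ge_atTop (8 * z₀ * w 0))).exists
  obtain ⟨B, hB0, hB1, hB2, hB3⟩ : ∃ B : ℝ, 0 < B ∧ α ≤ (B - K) / 2 ∧
      A + (2 * K + (w 0)⁻¹ + J) ≤ (B - K) / 2 ∧ N * (w 0)⁻¹ ≤ B :=
    ((eventually_gt_atTop (0 : ℝ)).and (((eventually_ge_atTop (2 * α + K)).mono
      fun B hB => by linarith).and (((eventually_ge_atTop (2 * (A + (2 * K + (w 0)⁻¹ + J)) + K)).mono
      fun B hB => by linarith).and (eventually_ge_atTop (N * (w 0)⁻¹))))).exists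
  set c := w 0 * (w N)⁻¹ with hc
  have hc0 : 0 ≤ c := mul_nonneg hw0.le (inv_pos.2 (hpos N)).le
  set f : ℕ → ℝ := fun j => if j < z₀ then c else 0 with hf
  have hf0 : ∀ j, 0 ≤ f j := fun j => by simp only [hf]; split_ifs <;> linarith
  have hfsum : HasSum f (z₀ * c) := by
    have : ∑ j ∈ Finset.range z₀, f j = z₀ * c := by
      rw [Finset.sum_congr rfl fun j hj => if_pos (Finset.mem_range.1 hj), Finset.sum_const,
        Finset.card_range, nsmul_eq_mul]
    rw [← this]
    exact hasSum_sum_of_ne_finset_zero fun j hj => if_neg fun h => hj (Finset.mem_range.2 h)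
  have hfc : z₀ * c ≤ 1 / 8 := by
    rw [hc, ← mul_assoc, ← div_eq_mul_inv, div_le_iff₀ (hpos N)]
    linarith
  set e : ℕ → ℝ := fun j => w 0 * (w (levelShift w A j))⁻¹ + f j with he
  have hee0 : ∀ j, 0 ≤ e j := fun j => add_nonneg (he0 j) (hf0 j)
  have hees : Summable e := hes.add hfsum.summable
  have heet : ∀ z, tailSum e z ≤ 1 / 4 := fun z => by
    refine (tailSum_anti hee0 hees (Nat.zero_le z)).trans ?_
    have h1 := het 0
    rw [tailSum] at h1 ⊢
    simp only [add_zero] at h1 ⊢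
    rw [hes.tsum_add hfsum.summable, hfsum.tsum_eq]
    linarith
  refine ⟨B, hB0, fun y hy r => ?_⟩
  set V : ℕ → (ℕ → ℤ) → ℝ := fun n x => martPotential w y B n x / K ^ 2 +
    exitPotential e (y - 1) (y - 2) n x with hV
  have hnn1 : ∀ n x, 0 ≤ martPotential w y B n x / K ^ 2 := fun n x =>
    div_nonneg (martPotential_nonneg ..) (sq_nonneg K)
  have hnn2 := fun n x => exitPotential_nonneg hee0 (y - 1) (y - 2) n x
  have hbound := hX.exit_bound hpos (n₀ := r) (dependsUntil_accumulatedAt w y B r)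
    (B := fun n x => K ≤ |siteMart w x y n - B| ∨ 0 < localTime x n (y - 2))
    (fun n x x' h => by simp only [dependsUntil_siteMart w _ n x x' h, localTime_congr h])
    (V := V) (fun n x x' h => by
      simp only [hV, dependsUntil_martPotential w _ _ n x x' h, dependsUntil_exitPotential _ _ _ n x x' h])
    (fun n x => add_nonneg (hnn1 n x) (hnn2 n x))
    (fun n x h => by
      have := hnn1 n x; have := hnn2 n x
      simp only [hV]
      rcases h with h | h
      · linarith [martPotential_ge hK0 h]
      · have : exitPotential e (y - 1) (y - 2) n x = 1 := if_pos h
        linarith)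
    (fun n hn x hx h0 hCx hnb => by
      have hb : ∀ k, r ≤ k → k ≤ n → |siteMart w x y k - B| < K ∧ localTime x k (y - 2) = 0 :=
        fun k h1 h2 => by
          have := hnb k h1 h2
          simp only [not_or, not_le, not_lt, Nat.le_zero] at this
          exact this
      have hzn := (hb n hn le_rfl).2
      have hlt := lt_of_localTime_eq_zero hx (by omega) hzn n le_rfl
      have d1 := martPotential_drift hpos x n hsq y B
      have d2 := exitPotential_drift hpos x n hee0 hees (s := y - 1) (z := y - 2) (δ := -1)
        (Or.inr rfl) (by ring) hzn (by omega) (fun h => by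
          have hp : ∀ v ≤ localTime x n y, transProb w (-1) x n ≤ w 0 * (w v)⁻¹ := fun v hv =>
            transProb_le hpos hmono (Or.inr rfl)
              (by rw [h, show y - 1 + -1 = y - 2 by ring]; exact hzn)
              (by rw [h, show y - 1 - -1 = y by ring]; exact hv)
          rcases left_dominates hpos hmono hdiv hα hs hx h0 hy hn hzn hCx.1
            (fun k h1 h2 => (hb k h1 h2).1.le) hB1 hB2 with h' | h'
          · exact (hp _ (levelShift_le hpos hmono hdiv hA0 h')).trans (le_add_of_nonneg_right (hf0 _))
          · have hlt : localTime x n (y - 1) < z₀ := by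
              by_contra! hge
              have := cumWeight_mono hpos hge
              linarith
            have hNy : N ≤ localTime x n y := by
              have h3 := hCx.2.1.trans (jumpSum_le_localTime hpos hmono x y (y + 1) r)
              have h4 : N ≤ localTime x r y := by
                exact_mod_cast le_of_mul_le_mul_right (hB3.trans h3) hw0'
              exact h4.trans (localTime_mono x y hn)
            refine (hp N hNy).trans ?_
            simp only [he, hf, if_pos hlt]
            exact le_add_of_nonneg_left (he0 _))
      have d1' := div_le_div_of_nonneg_right d1 (sq_nonneg K)
      rw [add_div, mul_div_assoc, mul_div_assoc] at d1'
      simp only [hV]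
      linarith)
    (ε := 1 / 2) (fun x hx h0 hCx => by
      obtain ⟨c1, c2, c3⟩ := hCx
      have hm : 0 ≤ siteMart w x y r - B ∧ siteMart w x y r - B ≤ (w 0)⁻¹ := by
        rw [siteMart, jumpSum_to_eq_zero w c1, sub_zero]
        refine ⟨by linarith, ?_⟩
        cases r with
        | zero => rw [jumpSum_zero] at c2; linarith
        | succ r => linarith [jumpSum_succ_le hpos hmono x y (y + 1) r, c3 r (Nat.lt_succ_self r)]
      have s1 : martPotential w y B r x / K ^ 2 ≤ 1 / 4 := by
        refine le_trans (div_le_div_of_nonneg_right ?_ (sq_nonneg K)) hKT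
        have hanti := tailSum_anti (f := fun j => ((w j)⁻¹) ^ 2) (fun _ => sq_nonneg _) hsq
        have h1 := hanti (Nat.zero_le (localTime x r (y + 1)))
        have h2 := hanti (Nat.zero_le (localTime x r (y - 1)))
        have h3 := pow_le_pow_left₀ hm.1 hm.2 2
        rw [martPotential]
        linarith
      have hz : localTime x r (y - 2) = 0 := localTime_eq_zero_of_ne fun k hk => by
        have := lt_of_localTime_eq_zero hx (by omega) c1 k hk
        omega
      have s2 : exitPotential e (y - 1) (y - 2) r x ≤ 1 / 4 := by
        rw [exitPotential, hz, if_neg (lt_irrefl 0)]; exact heet _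
      simp only [hV]
      linarith)
  refine le_trans (measure_mono fun ω hω => ?_) hbound
  obtain ⟨h1, n, hn, h2⟩ := hω
  exact ⟨h1, n, hn, Or.inr h2⟩

end LateExit

lemma measure_iUnion_inter_le {Ω : Type*} [MeasurableSpace Ω] {μ : Measure Ω} {D : ℕ → Set Ω}
    (hD : ∀ n, MeasurableSet (D n)) (hdisj : Pairwise (Function.onFun Disjoint D)) {E : Set Ω} {c : ℝ≥0∞}
    (h : ∀ n, μ (D n ∩ E) ≤ c * μ (D n)) : μ ((⋃ n, D n) ∩ E) ≤ c * μ (⋃ n, D n) := by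
  rw [Set.iUnion_inter, measure_iUnion hdisj hD, ← ENNReal.tsum_mul_left]
  exact (measure_iUnion_le _).trans (ENNReal.tsum_le_tsum h)

lemma AccumulatedAt.unique {w : ℕ → ℝ} {y : ℤ} {B : ℝ} {m n : ℕ} {x : ℕ → ℤ}
    (hm : AccumulatedAt w y B m x) (hn : AccumulatedAt w y B n x) : m = n := by
  rcases lt_trichotomy m n with h | h | h
  · exact absurd hm.2.1 (not_le.2 (hn.2.2 m h))
  · exact h
  · exact absurd hn.2.1 (not_le.2 (hm.2.2 n h))

lemma IsVRRW.neg {Ω : Type*} [MeasurableSpace Ω] {μ : Measure Ω} {w : ℕ → ℝ} {X : ℕ → Ω → ℤ}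
    (hX : IsVRRW μ w X) : IsVRRW μ w fun n ω => -X n ω := by
  have hsm : ∀ n, StronglyMeasurable fun ω => -X n ω := fun n => (hX.stronglyMeasurable n).neg
  have hfilt : Filtration.natural (fun n ω => -X n ω) hsm =
      Filtration.natural X hX.stronglyMeasurable := by
    ext n : 2
    simp only [Filtration.natural]
    refine iSup_congr fun j => iSup_congr fun _ => ?_
    have : (fun ω => -X j ω) = (fun z : ℤ => -z) ∘ X j := rfl
    rw [this, ← MeasurableSpace.comap_comp]
    congr 1
    exact (MeasurableEquiv.neg ℤ).measurableEmbedding.comap_eq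
  have hl : ∀ n ω (y : ℤ), localTime (fun k => -X k ω) n y = localTime (X · ω) n (-y) := fun n ω y => by
    simpa only [neg_neg] using localTime_neg (x := (X · ω)) n (-y)
  refine ⟨hsm, ?_, fun n => ?_, fun n => ?_⟩
  · filter_upwards [hX.start] with ω h
    rw [h, neg_zero]
  · rw [hfilt]
    have hset : {ω | -X (n + 1) ω = -X n ω + 1} = {ω | X (n + 1) ω = X n ω - 1} := by
      ext ω; simp only [Set.mem_ofPred_eq]; omega
    rw [hset]
    filter_upwards [hX.step_left n] with ω h
    rw [h, hl, hl, show -(-X n ω + 1) = X n ω - 1 by ring, show -(-X n ω - 1) = X n ω + 1 by ring,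
      add_comm (w _) (w _)]
  · rw [hfilt]
    have hset : {ω | -X (n + 1) ω = -X n ω - 1} = {ω | X (n + 1) ω = X n ω + 1} := by
      ext ω; simp only [Set.mem_ofPred_eq]; omega
    rw [hset]
    filter_upwards [hX.step_right n] with ω h
    rw [h, hl, hl, show -(-X n ω + 1) = X n ω - 1 by ring, show -(-X n ω - 1) = X n ω + 1 by ring,
      add_comm (w _) (w _)]

section RangeFinite

variable {Ω : Type*} [MeasurableSpace Ω] {μ : Measure Ω} [IsProbabilityMeasure μ]
  {w : ℕ → ℝ} (hpos : ∀ n, 0 < w n) (hmono : Monotone w) (hdiv : ¬ Summable (fun n => 1 / w n))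
  {X : ℕ → Ω → ℤ} (hX : IsVRRW μ w X) {α : ℝ} (hα : 0 ≤ α) (hs : CriticalSummable w α)

include hpos hmono hX hdiv hα hs

/-- Each new site on the left is the last one with probability bounded below. -/
lemma IsVRRW.measure_hit_le : ∃ c : ℝ≥0∞, c < 1 ∧ ∀ y ≤ 0,
    μ {ω | ∃ n, X n ω = y - 2} ≤ c * μ {ω | ∃ n, X n ω = y} := by
  obtain ⟨B, hB, hlate⟩ := hX.late_exit_bound hpos hmono hdiv hα hs
  set κ := Real.exp (-(w 0 * B + 1)) with hκ
  have hκ0 : 0 < κ := Real.exp_pos _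
  have hκ1 : κ ≤ 1 := Real.exp_le_one_iff.2 (by have := mul_pos (hpos 0) hB; linarith)
  refine ⟨ENNReal.ofReal (1 - κ / 2), ENNReal.ofReal_lt_one.2 (by linarith), fun y hy => ?_⟩
  set H : Set Ω := {ω | ∃ n, X n ω = y} with hH
  set bad : Set Ω := {ω | ∃ n, 0 < localTime (X · ω) n (y - 1) ∧
    jumpSum w (X · ω) y (y + 1) n < B} with hbad
  set G : Set Ω := ⋃ r, {ω | AccumulatedAt w y B r (X · ω)} with hG
  set E : Set Ω := {ω | ∃ n, 0 < localTime (X · ω) n (y - 2)} with hE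
  have hms : ∀ {n : ℕ} {p : (ℕ → ℤ) → Prop}, DependsUntil n p → MeasurableSet {ω | p (X · ω)} :=
    fun {n p} hp => (hX.filtration).le n _ (hX.measurableSet_of_dependsUntil hp)
  have hHU : H = ⋃ n, {ω | FirstHitsAt y n (X · ω)} := by
    ext ω
    simp only [hH, Set.mem_iUnion, Set.mem_ofPred_eq]
    exact ⟨fun h => exists_firstHitsAt h, fun ⟨n, h⟩ => ⟨n, h.1⟩⟩
  have hHm : MeasurableSet H := by
    rw [hHU]; exact MeasurableSet.iUnion fun n => hms (dependsUntil_firstHitsAt y n)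
  have hGm : MeasurableSet G := MeasurableSet.iUnion fun n => hms (dependsUntil_accumulatedAt w y B n)
  have h1 : μ (H ∩ bad) ≤ ENNReal.ofReal (1 - κ) * μ H := by
    rw [hHU]
    refine measure_iUnion_inter_le (fun n => hms (dependsUntil_firstHitsAt y n))
      (fun m n hmn => Set.disjoint_left.2 fun ω h1 h2 => hmn (FirstHitsAt.unique (x := (X · ω)) h1 h2)) fun n => ?_
    refine le_trans (measure_mono_ae ?_) (hX.early_visit_bound hpos hmono hy hB n)
    filter_upwards [hX.ae_isNearestNeighbor hpos] with ω hω hmem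
    obtain ⟨hf, k, hk1, hk2⟩ := hmem
    refine ⟨hf, k, ?_, hk1, hk2⟩
    by_contra! hlt
    have hle := FirstHitsAt.le hω.2 (by rw [hω.1]; exact hy) hf
    have := localTime_eq_zero_of_ne (x := (X · ω)) (n := k) (z := y - 1) fun j hj h => by
      have := hle j (by omega)
      omega
    omega
  have h2 : μ (G ∩ E) ≤ ENNReal.ofReal (1 / 2) * μ G := by
    refine measure_iUnion_inter_le (fun n => hms (dependsUntil_accumulatedAt w y B n))
      (fun m n hmn => Set.disjoint_left.2 fun ω h1 h2 => hmn (AccumulatedAt.unique (x := (X · ω)) h1 h2)) fun r => ?_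
    refine le_trans (measure_mono fun ω hω => ?_) (hlate y hy r)
    obtain ⟨h1, n, h2⟩ := hω
    exact ⟨h1, max n r, le_max_right _ _, h2.trans_le (localTime_mono _ _ (le_max_left n r))⟩
  have hcov : μ {ω | ∃ n, X n ω = y - 2} ≤ μ ((H ∩ bad) ∪ (G ∩ E)) := by
    refine measure_mono_ae ?_
    filter_upwards [hX.ae_isNearestNeighbor hpos] with ω hω hmem
    obtain ⟨n, hn⟩ := hmem
    set x : ℕ → ℤ := (X · ω)
    obtain ⟨h0, hx⟩ : x 0 = 0 ∧ IsNearestNeighbor x := hω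
    replace hn : x n = y - 2 := hn
    have hvis : ∀ z, y - 2 < z → z ≤ 0 → 0 < localTime x n z := fun z h1 h2 => by
      by_contra! h
      rcases h2.eq_or_lt with rfl | h2
      · have h3 := localTime_pos x h0
        have := localTime_mono x 0 (Nat.zero_le n)
        simp only at this
        omega
      · have h3 := lt_of_localTime_eq_zero hx (by rw [h0]; exact h2) (Nat.le_zero.1 h) n le_rfl
        rw [hn] at h3
        omega
    have hyH : ω ∈ H := by
      have := hvis y (by omega) hy
      by_contra hno
      rw [localTime_eq_zero_of_ne fun k _ hk => hno ⟨k, hk⟩] at this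
      exact lt_irrefl 0 this
    by_cases hb : ω ∈ bad
    · exact Or.inl ⟨hyH, hb⟩
    right
    have hnb : ∀ k, 0 < localTime x k (y - 1) → B ≤ jumpSum w x y (y + 1) k := fun k h1 => by
      by_contra! h
      exact hb ⟨k, h1, h⟩
    refine ⟨?_, n, localTime_pos x hn⟩
    have hex : ∃ r, B ≤ jumpSum w x y (y + 1) r := ⟨n, hnb n (hvis _ (by omega) (by omega))⟩
    classical
    have hspec := Nat.find_spec hex
    have hmin : ∀ k < Nat.find hex, jumpSum w x y (y + 1) k < B := fun k hk =>
      not_le.1 (Nat.find_min hex hk)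
    refine Set.mem_iUnion.2 ⟨Nat.find hex, ?_, hspec, hmin⟩
    generalize Nat.find hex = r at hspec hmin
    cases r with
    | zero => rw [jumpSum_zero] at hspec; exact absurd hspec (not_le.2 hB)
    | succ r =>
      have hlt := hmin r (Nat.lt_succ_self r)
      have hz : localTime x r (y - 1) = 0 := by
        by_contra hne
        exact absurd (hnb r (Nat.pos_of_ne_zero hne)) (not_le.2 hlt)
      -- The step at which the jump sum first reaches `B` is a jump to `y + 1`, so it cannot also be
      -- the first visit to `y - 1`.
      have hne : x (r + 1) ≠ y - 1 := by
        intro h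
        have h' : ¬ (x r = y ∧ x (r + 1) = y + 1) := by omega
        rw [jumpSum_succ, if_neg h'] at hspec
        linarith
      rw [localTime_succ, hz, if_neg hne]
  have hdisj : Disjoint G (H ∩ bad) := Set.disjoint_left.2 fun ω hω h => by
    obtain ⟨r, h1, h2, h3⟩ := Set.mem_iUnion.1 hω
    obtain ⟨-, k, h4, h5⟩ := h
    have hkr : k < r := by
      by_contra! hle
      have := jumpSum_mono (x := (X · ω)) hpos y (y + 1) hle
      linarith
    have := localTime_mono (X · ω) (y - 1) hkr.le
    simp only at this
    omega
  have hGH : G ⊆ H := fun ω hω => by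
    obtain ⟨r, h1, h2, h3⟩ := Set.mem_iUnion.1 hω
    by_contra hno
    have : jumpSum w (X · ω) y (y + 1) r = 0 := jumpSum_eq_zero_of_localTime_eq_zero w
      (localTime_eq_zero_of_ne fun k _ hk => hno ⟨k, hk⟩) _
    linarith
  -- With `h = μ H` and `b = μ (H ∩ bad)`, the two ways to reach `y - 2` cost at most `b + (h - b) /
  -- 2`, and `b ≤ (1 - κ) h` turns this into `(1 - κ / 2) h`.
  have hsum : μ G + μ (H ∩ bad) ≤ μ H := by
    rw [← measure_union' hdisj hGm]
    exact measure_mono (Set.union_subset hGH Set.inter_subset_left)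
  refine hcov.trans ((measure_union_le _ _).trans ?_)
  have f1 : μ (H ∩ bad) = ENNReal.ofReal (μ.real (H ∩ bad)) := by simp
  have f2 : μ (G ∩ E) = ENNReal.ofReal (μ.real (G ∩ E)) := by simp
  have f3 : μ H = ENNReal.ofReal (μ.real H) := by simp
  have f4 : μ G = ENNReal.ofReal (μ.real G) := by simp
  have n1 : 0 ≤ μ.real H := measureReal_nonneg
  have n2 : 0 ≤ μ.real G := measureReal_nonneg
  have n3 : 0 ≤ μ.real (H ∩ bad) := measureReal_nonneg
  have n4 : 0 ≤ μ.real (G ∩ E) := measureReal_nonneg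
  rw [f1, f3, ← ENNReal.ofReal_mul (by linarith), ENNReal.ofReal_le_ofReal_iff (by positivity)] at h1
  rw [f2, f4, ← ENNReal.ofReal_mul (by norm_num), ENNReal.ofReal_le_ofReal_iff (by positivity)] at h2
  rw [f1, f3, f4, ← ENNReal.ofReal_add n2 n3, ENNReal.ofReal_le_ofReal_iff n1] at hsum
  rw [f1, f2, f3, ← ENNReal.ofReal_mul (by linarith), ← ENNReal.ofReal_add n3 n4]
  refine ENNReal.ofReal_le_ofReal ?_
  linarith

/-- Iterating `measure_hit_le` along `-1, -3, -5, …` makes the hitting probabilities decay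
geometrically; a nearest-neighbour path that misses one of these sites stays to the right of it. -/
lemma IsVRRW.ae_bddBelow : ∀ᵐ ω ∂μ, ∃ a, ∀ n, a < X n ω := by
  obtain ⟨c, hc, h⟩ := hX.measure_hit_le hpos hmono hdiv hα hs
  have hk : ∀ k : ℕ, μ {ω | ∃ n, X n ω = -1 - 2 * (k : ℤ)} ≤ c ^ k := fun k => by
    induction k with
    | zero => rw [pow_zero]; exact prob_le_one
    | succ k ih =>
      rw [pow_succ', show -1 - 2 * ((k + 1 : ℕ) : ℤ) = (-1 - 2 * (k : ℤ)) - 2 by push_cast; ring]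
      exact (h _ (by omega)).trans (mul_le_mul_right ih c)
  have h0 : μ {ω | ∀ k : ℕ, ∃ n, X n ω = -1 - 2 * (k : ℤ)} = 0 :=
    le_antisymm (ge_of_tendsto' (ENNReal.tendsto_pow_atTop_nhds_zero_of_lt_one hc) fun k =>
      (measure_mono fun ω (hω : ∀ k : ℕ, ∃ n, X n ω = -1 - 2 * (k : ℤ)) => hω k).trans (hk k)) zero_le
  filter_upwards [hX.ae_isNearestNeighbor hpos, measure_eq_zero_iff_ae_notMem.1 h0] with ω hω hn
  simp only [not_forall, not_exists] at hn
  obtain ⟨k, hk⟩ := hn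
  refine ⟨-1 - 2 * (k : ℤ), fun n => ?_⟩
  exact lt_of_localTime_eq_zero hω.2 (by rw [hω.1]; omega)
    (localTime_eq_zero_of_ne fun j _ => hk j) n le_rfl

lemma IsVRRW.ae_mem_Icc : ∀ᵐ ω ∂μ, ∃ a b, ∀ n, X n ω ∈ Set.Icc a b := by
  filter_upwards [hX.ae_bddBelow hpos hmono hdiv hα hs,
    hX.neg.ae_bddBelow hpos hmono hdiv hα hs] with ω h1 h2
  obtain ⟨a, ha⟩ := h1
  obtain ⟨b, hb⟩ := h2
  exact ⟨a, -b, fun n => ⟨(ha n).le, by have := hb n; omega⟩⟩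

/-- In the localized regime the walk localizes on four or five sites. -/
theorem IsVRRW.ae_four_or_five_sites : ∀ᵐ ω ∂μ, ∃ a b,
    sitesVisitedInfinitelyOften (X · ω) = Set.Icc a b ∧ (b = a + 3 ∨ b = a + 4) := by
  filter_upwards [hX.ae_isNearestNeighbor hpos, hX.ae_mem_Icc hpos hmono hdiv hα hs,
    hX.ae_siteMart_bounded hpos (hs.summable_sq hpos hmono hdiv hα),
    hX.ae_not_balancedAt hpos hmono] with ω hω hin hb hU
  obtain ⟨a', b', hin⟩ := hin
  obtain ⟨hne, hsub⟩ := sites_nonempty_of_eventually_mem (x := (X · ω)) (Eventually.of_forall hin)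
  obtain ⟨a, b, hab, hR⟩ := sites_eq_Icc hω.2 ((Set.finite_Icc _ _).subset hsub) hne
  have h3 := (left_end hpos hdiv hω.2 (martDichotomy_of_bounded hb) hab hR).2.2.2.2.2
  have h4 := at_most_five_sites hpos hmono hdiv hα hs hω.2 hb hab hR fun c h1 h2 h3 =>
    hU c ⟨h2, h1, Or.inl h3⟩
  exact ⟨a, b, hR, by omega⟩

end RangeFinite

/-! ### Assembly -/

section Assembly

variable {Ω : Type*} [MeasurableSpace Ω] {μ : Measure Ω} [IsProbabilityMeasure μ]
  {w : ℕ → ℝ} (hpos : ∀ n, 0 < w n) (hmono : Monotone w) (hdiv : ¬ Summable (fun n => 1 / w n))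
  {X : ℕ → Ω → ℤ} (hX : IsVRRW μ w X)

lemma encard_Icc_add_three (a : ℤ) : (Set.Icc a (a + 3)).encard = 4 := by
  rw [encard_Icc_int, show a + 3 + 1 - a = 4 by ring]; rfl

lemma encard_Icc_add_four (a : ℤ) : (Set.Icc a (a + 4)).encard = 5 := by
  rw [encard_Icc_int, show a + 4 + 1 - a = 5 by ring]; rfl

include hpos hmono hdiv hX

lemma IsVRRW.criticalSummable_of_measure_four_sites_pos
    (h : 0 < μ {ω | (sitesVisitedInfinitelyOften (X · ω)).encard = 4}) :
    ∃ a, 0 ≤ a ∧ CriticalSummable w a := by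
  by_contra hno
  refine h.ne' (measure_eq_zero_iff_ae_notMem.2 ?_)
  filter_upwards [hX.ae_isNearestNeighbor hpos, hX.ae_martDichotomy hpos hmono] with ω hω hd h4
  replace h4 : (sitesVisitedInfinitelyOften (X · ω)).encard = 4 := h4
  have hfin : (sitesVisitedInfinitelyOften (X · ω)).Finite := Set.finite_of_encard_eq_coe (k := 4) h4
  have hne : (sitesVisitedInfinitelyOften (X · ω)).Nonempty := by
    rw [← Set.encard_ne_zero, h4]; norm_num
  obtain ⟨a, b, hab, hR⟩ := sites_eq_Icc hω.2 hfin hne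
  rw [hR, encard_Icc_int] at h4
  have hb : b = a + 3 := by
    have h5 : (b + 1 - a).toNat = 4 := by exact_mod_cast h4
    omega
  rw [hb] at hR
  exact hno (exists_criticalSummable_of_four_sites hpos hmono hdiv hω.2 hd hR)

lemma IsVRRW.ae_encard {α : ℝ} (hα : 0 ≤ α) (hs : CriticalSummable w α) :
    ∀ᵐ ω ∂μ, (sitesVisitedInfinitelyOften (X · ω)).encard = 4 ∨
      (sitesVisitedInfinitelyOften (X · ω)).encard = 5 := by
  filter_upwards [hX.ae_four_or_five_sites hpos hmono hdiv hα hs] with ω h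
  obtain ⟨a, b, hR, rfl | rfl⟩ := h
  · rw [hR]; exact Or.inl (encard_Icc_add_three a)
  · rw [hR]; exact Or.inr (encard_Icc_add_four a)

/-- Five sites would be balanced around the central one by `five_sites_balanced`, with infinitely
many jumps from it in both directions, which `ae_not_balancedAt` excludes. -/
lemma IsVRRW.ae_four_sites (hs : ∀ α, 0 < α → CriticalSummable w α) :
    ∀ᵐ ω ∂μ, (sitesVisitedInfinitelyOften (X · ω)).encard = 4 := by
  have hs1 := hs 1 one_pos
  have hsq := hs1.summable_sq hpos hmono hdiv zero_le_one
  filter_upwards [hX.ae_four_or_five_sites hpos hmono hdiv zero_le_one hs1,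
    hX.ae_isNearestNeighbor hpos, hX.ae_siteMart_bounded hpos hsq, hX.ae_not_balancedAt hpos hmono,
    hX.ae_tendsto_of_bounded hpos hmono (hX.ae_siteMart_bounded hpos hsq)] with ω h hω hb hU hc
  obtain ⟨a, b, hR, rfl | rfl⟩ := h
  · rw [hR]; exact encard_Icc_add_three a
  exfalso
  have hmem : ∀ i : ℤ, 0 ≤ i → i ≤ 4 → a + i ∈ sitesVisitedInfinitelyOften (X · ω) :=
    fun i h0 h4 => by rw [hR]; exact ⟨by omega, by omega⟩
  have j1 := (frequently_jump hω.2 (hmem 2 (by omega) (by omega))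
    (by rw [add_assoc]; exact hmem 3 (by omega) (by omega))).1
  have j2 := (frequently_jump hω.2 (hmem 1 (by omega) (by omega))
    (by rw [add_assoc]; exact hmem 2 (by omega) (by omega))).2
  have hbal := five_sites_balanced hpos hmono hdiv hs hω.2 hc hb hR
  refine hU (a + 2) ⟨?_, j1, Or.inr ?_⟩
  · rwa [show a + 1 + 1 = a + 2 by ring, show a + 1 = a + 2 - 1 by ring] at j2
  · rwa [show a + 2 - 1 = a + 1 by ring, show a + 2 + 1 = a + 3 by ring]

end Assembly

theorem mainTheorem1 {Ω : Type*} [MeasurableSpace Ω] (μ : Measure Ω) [IsProbabilityMeasure μ]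
    (w : ℕ → ℝ) (hpos : ∀ n, 0 < w n) (hmono : Monotone w)
    (hdiv : ¬ Summable (fun n => 1 / w n))
    (X : ℕ → Ω → ℤ) (hX : IsVRRW μ w X) :
    (0 < μ {ω | (sitesVisitedInfinitelyOften (X · ω)).encard = 4} ↔ criticalParam w < ∞) ∧
    ((∀ᵐ ω ∂μ, (sitesVisitedInfinitelyOften (X · ω)).encard = 4) ↔ criticalParam w = 0) ∧
    (((∀ᵐ ω ∂μ, (sitesVisitedInfinitelyOften (X · ω)).encard = 4 ∨
          (sitesVisitedInfinitelyOften (X · ω)).encard = 5) ∧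
        0 < μ {ω | (sitesVisitedInfinitelyOften (X · ω)).encard = 4} ∧
        0 < μ {ω | (sitesVisitedInfinitelyOften (X · ω)).encard = 5}) ↔
      0 < criticalParam w ∧ criticalParam w < ∞) := by

  have hI := criticalParam_lt_top_iff hpos hmono hdiv
  have hO := criticalParam_eq_zero_iff hpos hmono hdiv
  have h4 : criticalParam w < ∞ → 0 < μ {ω | (sitesVisitedInfinitelyOften (X · ω)).encard = 4} :=
    fun h => by
      obtain ⟨a, ha, hs⟩ := hI.1 h
      exact hX.measure_four_sites_pos hpos hmono hdiv ha hs
  have h4' : 0 < μ {ω | (sitesVisitedInfinitelyOften (X · ω)).encard = 4} → criticalParam w < ∞ :=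
    fun h => hI.2 (hX.criticalSummable_of_measure_four_sites_pos hpos hmono hdiv h)
  have hz : criticalParam w = 0 → ∀ᵐ ω ∂μ, (sitesVisitedInfinitelyOften (X · ω)).encard = 4 :=
    fun h => hX.ae_four_sites hpos hmono hdiv (hO.1 h)
  have h5 : criticalParam w < ∞ → criticalParam w ≠ 0 →
      0 < μ {ω | (sitesVisitedInfinitelyOften (X · ω)).encard = 5} := fun h hne => by
    obtain ⟨a, ha, hs⟩ := hI.1 h
    rw [Ne, hO] at hne
    push Not at hne
    obtain ⟨η, hη, hcrit⟩ := hne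
    exact hX.measure_five_sites_pos hpos hmono hdiv ha hs hη hcrit
  have hno5 : (∀ᵐ ω ∂μ, (sitesVisitedInfinitelyOften (X · ω)).encard = 4) →
      μ {ω | (sitesVisitedInfinitelyOften (X · ω)).encard = 5} = 0 := fun h => by
    refine measure_eq_zero_iff_ae_notMem.2 (h.mono fun ω h4 h5 => ?_)
    have h45 := h4.symm.trans h5
    exact absurd h45 (by decide)
  refine ⟨⟨h4', h4⟩, ⟨fun h => ?_, hz⟩, ⟨fun h => ?_, fun h => ?_⟩⟩
  · by_contra hne
    have hpos4 : 0 < μ {ω | (sitesVisitedInfinitelyOften (X · ω)).encard = 4} := by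
      -- Null measurability of the event is read off from its null complement.
      rw [show μ {ω | (sitesVisitedInfinitelyOften (X · ω)).encard = 4} = 1 from
        (prob_compl_eq_zero_iff₀ (NullMeasurableSet.of_compl (NullMeasurableSet.of_null h))).1 h]
      exact one_pos
    exact (h5 (h4' hpos4) hne).ne' (hno5 h)
  · refine ⟨pos_iff_ne_zero.2 fun h0 => h.2.2.ne' (hno5 (hz h0)), h4' h.2.1⟩
  · obtain ⟨a, ha, hs⟩ := hI.1 h.2
    exact ⟨hX.ae_encard hpos hmono hdiv ha hs, h4 h.2, h5 h.2 h.1.ne'⟩
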